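/- Let $M$ be a smooth manifold (finite-dimensional, Hausdorff, without boundary), $\tau:T^*M\to M$ its cotangent bundle, $\alpha$ the canonical 1-form, $\alpha_\xi(X)=\xi(D\tau(\xi)X)$, $\omega=d\alpha$, and $C$ the tautological vertical vector field, $C_\xi=\xi$. Hamiltonian vector fields $S$ of functions $K$ are defined by $DK=\omega(\cdot,S)$. A (conic) pseudo-Finsler metric is a smooth function $F:A\to(0,\infty)$ on an open set $A\subset TM\setminus 0$ whose fibres $A_p$ are conic, connected and non-empty, which is positively homogeneous of degree $1$ on fibres and whose fundamental tensor $g_v(u,w)=\frac12\frac{\partial^2}{\partial t\partial s}F(v+tu+sw)^2|_{t=s=0}$ is non-degenerate for all $v\in A$. Its Legendre transformation is $\mathscr L_F(v)=\frac12D_fF^2(v)\in T^*M$ ($D_f$ is the fibre derivative), and its reverse is $\tilde F(v)=F(-v)$ on $-A$. Let $F:A\to(0,\infty)$ and $\hat F:\hat A\to(0,\infty)$ be pseudo-Finsler metrics and $W$ a smooth vector field on $M$ such that * $W$ is homothetic for $F$: $(\psi^W_t)^*F=e^{-\sigma t}F$ for the local flow $\psi^W_t$ of $W$ and some $\sigma\in\mathbb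 R$; * $\hat F$ is the translation of $F$ by $W$: $v/\hat F(v)-W\in A$ and $F(v/\hat F(v)-W)=1$ for all $v\in\hat A$; * with $w=v/\hat F(v)-W$, either $g_w(w,v)>0$ for all $v\in\hat A$ (straight translation; put $\epsilon=1$, $F_\epsilon=F$), or $g_w(w,v)<0$ for all $v\in\hat A$ (reverse translation; put $\epsilon=-1$, $F_\epsilon=\tilde F$). Let $\mathscr L_{\hat F}^{-1}:\mathcal O\to\hat A$ be a smooth local inverse of $\mathscr L_{\hat F}$ on an open set $\mathcal O\subset T^*M$, and $\xi\in\mathcal O$. Then there is a smooth local inverse $\mathscr L_{F_\epsilon}^{-1}$ of $\mathscr L_{F_\epsilon}$ on $\mathcal O$ such that, for $\eta\in\mathcal O$, $$\frac{\mathscr L_{F_\epsilon}^{-1}(\eta)}{F_\epsilon(\mathscr L_{F_\epsilon}^{-1}(\eta))}=-\epsilon W+\epsilon\,\frac{\mathscr L_{\hat F}^{-1}(\eta)}{\hat F(\mathscr L_{\hat F}^{-1}(\eta))}.$$ For every such inverse, put $H_2=\hat F^*=\hat F\circ\mathscr L_{\hat F}^{-1}$ and $H_\epsilon=F_\epsilon^*=F_\epsilon\circ\mathscr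 L_{F_\epsilon}^{-1}$ on $\mathcal O$, and let $S_\epsilon$ be the Hamiltonian vector field of $H_\epsilon$. For $i=2,\epsilon$ let $\mathcal C^{(i)}_\xi=\ker\alpha_\xi\cap\ker DH_i(\xi)$ be the contact plane at $\xi$ of the level hypersurface of $H_i$. For $\eta\in\mathcal O$ let $\mathcal L^{(i)}_\eta=\ker D\tau(\eta)\cap\ker DH_i(\eta)$. Let the Jacobi curve of $\frac12H_i^2$ based at $\xi$ be $$\ell^{(i)}_\xi(t)=D\psi^{i}_{-t}\bigl(\mathcal L^{(i)}_{\psi^{i}_t(\xi)}\bigr)$$ for $t$ near $0$, where $\psi^{i}$ is the local flow on $\mathcal O$ of the Hamiltonian vector field of $\frac12H_i^2$. Then $T_\xi(T^*M)=\mathcal C^{(\epsilon)}_\xi\oplus\operatorname{span}\{C_\xi,(S_\epsilon)_\xi\}$. The restriction $\mathrm T:\mathcal C^{(2)}_\xi\to\mathcal C^{(\epsilon)}_\xi$ of the projection onto the first summand along the second is a linear isomorphism with $\omega(\mathrm TX,\mathrm TY)=\omega(X,Y)$. For all $t$ in a neighbourhood of $0$, $\ell^{(2)}_\xi(g(t))\subset\mathcal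 C^{(2)}_\xi$ and $$\mathrm T\,\ell^{(2)}_\xi(g(t))=\ell^{(\epsilon)}_\xi(t),$$ where $$g(t)=\frac{1}{H_2(\xi)\sigma}\ln\bigl(1+\epsilon\sigma H_\epsilon(\xi)t\bigr)\ \text{ if }\sigma\neq0,\qquad g(t)=\frac{\epsilon H_\epsilon(\xi)}{H_2(\xi)}\,t\ \text{ if }\sigma=0.$$ -/

import Mathlib

open Set Filter Topology Bundle Manifold
open scoped ContDiff

noncomputable section

namespace FinslerTranslation

variable {E : Type*} [NormedAddCommGroup E] [NormedSpace ℝ E]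
variable {M : Type*} [TopologicalSpace M] [ChartedSpace E M] [IsManifold 𝓘(ℝ, E) ∞ M]

/-! ### Conic pseudo-Finsler metrics -/

/-- A real function `toFun` on the tangent bundle, considered only on the subset `domain`. -/
structure ConicFunction (E : Type*) [NormedAddCommGroup E] [NormedSpace ℝ E]
    (M : Type*) [TopologicalSpace M] [ChartedSpace E M] where
  /-- The domain `A ⊆ TM`. -/
  domain : Set (TangentBundle 𝓘(ℝ, E) M)
  /-- The values of `F`; only those on `domain` are relevant. -/
  toFun : TangentBundle 𝓘(ℝ, E) M → ℝ

/-- The fundamental tensor `g_v(u, w) = ½ ∂²/∂t∂s F(v + t u + s w)² |_{t = s = 0}`. -/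
def fundamentalTensor (F : ConicFunction E M) (v : TangentBundle 𝓘(ℝ, E) M)
    (u w : TangentSpace 𝓘(ℝ, E) v.proj) : ℝ :=
  (1 / 2) * deriv (fun t : ℝ =>
    deriv (fun s : ℝ => F.toFun ⟨v.proj, v.2 + t • u + s • w⟩ ^ 2) 0) 0

/-- `F : A → (0, ∞)` is a (conic) pseudo-Finsler metric. -/
structure IsPseudoFinsler (F : ConicFunction E M) : Prop where
  isOpen_domain : IsOpen F.domain
  ne_zero : ∀ v ∈ F.domain, v.2 ≠ 0
  conic : ∀ v ∈ F.domain, ∀ c : ℝ, 0 < c →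
    (⟨v.proj, c • v.2⟩ : TangentBundle 𝓘(ℝ, E) M) ∈ F.domain
  isConnected_fiber : ∀ p : M,
    IsConnected {w : TangentSpace 𝓘(ℝ, E) p | (⟨p, w⟩ : TangentBundle 𝓘(ℝ, E) M) ∈ F.domain}
  smooth : ContMDiffOn 𝓘(ℝ, E).tangent 𝓘(ℝ, ℝ) ∞ F.toFun F.domain
  pos : ∀ v ∈ F.domain, 0 < F.toFun v
  homogeneous : ∀ v ∈ F.domain, ∀ c : ℝ, 0 < c →
    F.toFun ⟨v.proj, c • v.2⟩ = c * F.toFun v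
  nondegenerate : ∀ v ∈ F.domain, ∀ u : TangentSpace 𝓘(ℝ, E) v.proj,
    (∀ w, fundamentalTensor F v u w = 0) → u = 0

/-- The reverse metric `F̃(v) = F(-v)`, defined on `-A`. -/
def reverse (F : ConicFunction E M) : ConicFunction E M where
  domain := {v | (⟨v.proj, -v.2⟩ : TangentBundle 𝓘(ℝ, E) M) ∈ F.domain}
  toFun v := F.toFun ⟨v.proj, -v.2⟩

/-- The vector `v / F̂(v) - W`. -/
def navigationVector (F' : ConicFunction E M) (W : (p : M) → TangentSpace 𝓘(ℝ, E) p)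
    (v : TangentBundle 𝓘(ℝ, E) M) : TangentBundle 𝓘(ℝ, E) M :=
  ⟨v.proj, (F'.toFun v)⁻¹ • v.2 - W v.proj⟩

/-- `F'` is a translation of `F` by `W`: `F(v / F'(v) - W) = 1` for all `v` in the domain
of `F'`. -/
def IsTranslation (F F' : ConicFunction E M) (W : (p : M) → TangentSpace 𝓘(ℝ, E) p) : Prop :=
  ∀ v ∈ F'.domain, navigationVector F' W v ∈ F.domain ∧ F.toFun (navigationVector F' W v) = 1

/-- The translation `F'` of `F` by `W` is straight: `g_w(w, v) > 0` for `w = v / F'(v) - W`. -/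
def IsStraight (F F' : ConicFunction E M) (W : (p : M) → TangentSpace 𝓘(ℝ, E) p) : Prop :=
  ∀ v ∈ F'.domain,
    0 < fundamentalTensor F (navigationVector F' W v) (navigationVector F' W v).2 v.2

/-- The translation `F'` of `F` by `W` is reverse: `g_w(w, v) < 0` for `w = v / F'(v) - W`. -/
def IsReverse (F F' : ConicFunction E M) (W : (p : M) → TangentSpace 𝓘(ℝ, E) p) : Prop :=
  ∀ v ∈ F'.domain,
    fundamentalTensor F (navigationVector F' W v) (navigationVector F' W v).2 v.2 < 0

/-! ### Local flows and homothetic fields -/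

section Flow

variable {V : Type*} [NormedAddCommGroup V] [NormedSpace ℝ V]
  {H : Type*} [TopologicalSpace H] {N : Type*} [TopologicalSpace N] [ChartedSpace H N]

/-- `ψ` is a smooth local flow of the vector field `X`, defined for times `|t| < δ` and initial
points in the open set `U`, and staying in the set `D`. -/
structure IsLocalFlow (J : ModelWithCorners ℝ V H) (X : (y : N) → TangentSpace J y) (D : Set N)
    (δ : ℝ) (U : Set N) (ψ : ℝ → N → N) : Prop where
  pos : 0 < δ
  isOpen : IsOpen U
  smooth : ContMDiffOn (𝓘(ℝ, ℝ).prod J) J ∞ (fun q : ℝ × N => ψ q.1 q.2) (Ioo (-δ) δ ×ˢ U)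
  zero : ∀ y ∈ U, ψ 0 y = y
  mem : ∀ t ∈ Ioo (-δ) δ, ∀ y ∈ U, ψ t y ∈ D
  integralCurve : ∀ y ∈ U, IsMIntegralCurveOn (fun t => ψ t y) X (Ioo (-δ) δ)

end Flow

/-- `W` is homothetic for `F` with constant `σ`: its local flow `φ` satisfies
`(φ_t)^* F = exp (-σ t) F`. -/
def IsHomothetic (F : ConicFunction E M) (W : (p : M) → TangentSpace 𝓘(ℝ, E) p) (σ : ℝ) : Prop :=
  ∀ p : M, ∃ (δ : ℝ) (U : Set M) (φ : ℝ → M → M),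
    p ∈ U ∧ IsLocalFlow 𝓘(ℝ, E) W univ δ U φ ∧
    ∀ t ∈ Ioo (-δ) δ, ∀ v ∈ F.domain, v.proj ∈ U →
      tangentMap 𝓘(ℝ, E) 𝓘(ℝ, E) (φ t) v ∈ F.domain ∧
      F.toFun (tangentMap 𝓘(ℝ, E) 𝓘(ℝ, E) (φ t) v) = Real.exp (-(σ * t)) * F.toFun v

/-! ### The cotangent bundle and its symplectic structure -/

/-- The cotangent bundle `T*M`. -/
abbrev Cotangent (E : Type*) [NormedAddCommGroup E] [NormedSpace ℝ E]
    (M : Type*) [TopologicalSpace M] [ChartedSpace E M] : Type _ :=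
  TotalSpace (E →L[ℝ] ℝ) (fun p : M => TangentSpace 𝓘(ℝ, E) p →L[ℝ] Trivial M ℝ p)

/-- The model with corners of `T*M`. -/
abbrev cotangentModel (E : Type*) [NormedAddCommGroup E] [NormedSpace ℝ E] :
    ModelWithCorners ℝ (E × (E →L[ℝ] ℝ)) (ModelProd E (E →L[ℝ] ℝ)) :=
  𝓘(ℝ, E).prod 𝓘(ℝ, E →L[ℝ] ℝ)

/-- The tangent space `T_ξ(T*M)`. -/
abbrev TCotangent (ξ : Cotangent E M) : Type _ := TangentSpace (cotangentModel E) ξ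

/-- The canonical 1-form `α_ξ(X) = ξ(Dτ(ξ)(X))`. -/
def canonicalOneForm (ξ : Cotangent E M) : TCotangent ξ →L[ℝ] ℝ :=
  ContinuousLinearMap.comp (ξ.2 : TangentSpace 𝓘(ℝ, E) ξ.proj →L[ℝ] ℝ)
    (mfderiv (cotangentModel E) 𝓘(ℝ, E)
      (fun η : Cotangent E M => η.proj) ξ)

/-- The canonical 1-form written in the canonical chart of `T*M` around `ξ`. -/
def canonicalOneFormInChart (ξ : Cotangent E M) (y : E × (E →L[ℝ] ℝ)) :
    (E × (E →L[ℝ] ℝ)) →L[ℝ] ℝ :=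
  ((canonicalOneForm ((extChartAt (cotangentModel E) ξ).symm y)).comp
    (mfderiv 𝓘(ℝ, E × (E →L[ℝ] ℝ)) (cotangentModel E)
      (extChartAt (cotangentModel E) ξ).symm y)).comp
    (NormedSpace.fromTangentSpace (𝕜 := ℝ) y).symm.toContinuousLinearMap

/-- The canonical symplectic form `ω = dα`; the exterior derivative at `ξ` is computed in the chart
around `ξ`. -/
def symplecticForm (ξ : Cotangent E M) (X Y : TCotangent ξ) : ℝ :=
  extDeriv (fun y => ContinuousAlternatingMap.ofSubsingleton ℝ (E × (E →L[ℝ] ℝ)) ℝ (0 : Fin 1)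
      (canonicalOneFormInChart ξ y)) (extChartAt (cotangentModel E) ξ ξ)
    ![NormedSpace.fromTangentSpace _
        (mfderiv (cotangentModel E) 𝓘(ℝ, E × (E →L[ℝ] ℝ)) (extChartAt (cotangentModel E) ξ) ξ X),
      NormedSpace.fromTangentSpace _
        (mfderiv (cotangentModel E) 𝓘(ℝ, E × (E →L[ℝ] ℝ)) (extChartAt (cotangentModel E) ξ) ξ Y)]

/-- The tautological vector field `C` on `T*M`: `C_ξ` is the vertical vector at `ξ` that
corresponds to `ξ` itself under the derivative of the inclusion of the fibre. -/
def tautologicalField (ξ : Cotangent E M) : TCotangent ξ :=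
  mfderiv 𝓘(ℝ, E →L[ℝ] ℝ) (cotangentModel E)
    (fun p : E →L[ℝ] ℝ => (⟨ξ.proj, p⟩ : Cotangent E M)) ξ.2 ξ.2

/-- The Hamiltonian vector field `S` of `K`, defined by `DK = ω(·, S)`. -/
def hamiltonianField (K : Cotangent E M → ℝ) (ξ : Cotangent E M) : TCotangent ξ :=
  Classical.epsilon fun S : TCotangent ξ =>
    ∀ X : TCotangent ξ, mfderiv (cotangentModel E) 𝓘(ℝ, ℝ) K ξ X = symplecticForm ξ X S

/-! ### Legendre transformation, contact planes and Jacobi curves -/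

/-- The Legendre transformation `ℒ_F(v) = ½ D_f F²(v)`. -/
def legendre (F : ConicFunction E M) (v : TangentBundle 𝓘(ℝ, E) M) : Cotangent E M :=
  ⟨v.proj, (1 / 2 : ℝ) •
    fderiv ℝ (fun w : TangentSpace 𝓘(ℝ, E) v.proj => F.toFun ⟨v.proj, w⟩ ^ 2) v.2⟩

/-- `inv` is a smooth local inverse `𝒪 → A` of `ℒ_F`, defined on the open set `O`. -/
structure IsLegendreInverse (F : ConicFunction E M) (O : Set (Cotangent E M))
    (inv : Cotangent E M → TangentBundle 𝓘(ℝ, E) M) : Prop where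
  isOpen : IsOpen O
  mem : ∀ η ∈ O, inv η ∈ F.domain
  legendre_inv : ∀ η ∈ O, legendre F (inv η) = η
  smooth : ContMDiffOn (cotangentModel E) 𝓘(ℝ, E).tangent ∞ inv O

/-- The Legendre dual `F^* = F ∘ ℒ_F⁻¹` for the local inverse `inv` of `ℒ_F`. -/
def legendreDual (F : ConicFunction E M) (inv : Cotangent E M → TangentBundle 𝓘(ℝ, E) M)
    (η : Cotangent E M) : ℝ :=
  F.toFun (inv η)

/-- The local inverse `invε` of `ℒ_{F_ε}` on `O` corresponds to the local inverse `inv'` of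
`ℒ_{F'}`: `ℒ_{F_ε}⁻¹(η) / F_ε^*(η) = -ε W + ε ℒ_{F'}⁻¹(η) / F'^*(η)`. -/
def Corresponds (F' Fε : ConicFunction E M) (W : (p : M) → TangentSpace 𝓘(ℝ, E) p) (ε : ℝ)
    (O : Set (Cotangent E M)) (inv' invε : Cotangent E M → TangentBundle 𝓘(ℝ, E) M) : Prop :=
  ∀ η ∈ O,
    (⟨(invε η).proj, (legendreDual Fε invε η)⁻¹ • (invε η).2⟩ : TangentBundle 𝓘(ℝ, E) M) =
      ⟨(inv' η).proj,
        -(ε • W (inv' η).proj) + ε • ((legendreDual F' inv' η)⁻¹ • (inv' η).2)⟩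

/-- The contact plane `𝒞_ξ` at `ξ` of the level hypersurface of `h` through `ξ`: the kernel of `α`
on the tangent space `ker Dh(ξ)` of the hypersurface. -/
def contactPlane (h : Cotangent E M → ℝ) (ξ : Cotangent E M) : Submodule ℝ (TCotangent ξ) :=
  (canonicalOneForm ξ).ker ⊓ (mfderiv (cotangentModel E) 𝓘(ℝ, ℝ) h ξ).ker

/-- The Legendrean distribution `ℒ_ξ = T_ξ(τ⁻¹(x) ∩ h⁻¹(r))`, `x = τ(ξ)`, `r = h(ξ)`: the vertical
vectors that are tangent to the level hypersurface of `h`. -/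
def legendrean (h : Cotangent E M → ℝ) (ξ : Cotangent E M) : Submodule ℝ (TCotangent ξ) :=
  (mfderiv (cotangentModel E) 𝓘(ℝ, E) (fun η : Cotangent E M => η.proj) ξ).ker ⊓
    (mfderiv (cotangentModel E) 𝓘(ℝ, ℝ) h ξ).ker

/-- `ℓ` is, for `t` near `0`, the Jacobi curve of the Hamiltonian `½ h² : O → ℝ` based at `ξ`:
`ℓ(t) = Dψ_{-t}(ℒ_{ψ_t(ξ)})`, where `ψ` is the local flow of the Hamiltonian vector field of `½ h²`.
As `Dψ_{-t}` at `ψ_t(ξ)` is the inverse of `Dψ_t(ξ)`, the image under it is written as the preimage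
under `Dψ_t(ξ)`. -/
def IsJacobiCurve (h : Cotangent E M → ℝ) (O : Set (Cotangent E M)) (ξ : Cotangent E M)
    (ℓ : ℝ → Submodule ℝ (TCotangent ξ)) : Prop :=
  ∃ (δ : ℝ) (U : Set (Cotangent E M)) (ψ : ℝ → Cotangent E M → Cotangent E M), ξ ∈ U ∧
    IsLocalFlow (cotangentModel E) (hamiltonianField fun η => (1 / 2) * h η ^ 2) O δ U ψ ∧
    ∀ t ∈ Ioo (-δ) δ, ℓ t = (legendrean h (ψ t ξ)).comap
      (mfderiv (cotangentModel E) (cotangentModel E) (ψ t) ξ).toLinearMap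

/-- The reparametrization `g(t) = ln(1 + ε σ H_ε t) / (H₂ σ)`, which is `ε H_ε t / H₂` (the limit
for `σ → 0`) if `σ = 0`. -/
def reparam (σ ε Hε H₂ t : ℝ) : ℝ :=
  if σ = 0 then ε * Hε * t / H₂ else Real.log (1 + ε * σ * Hε * t) / (H₂ * σ)

end FinslerTranslation

end

/-!
Put `h = F_ε^*`, `k = F'^*` and `H₁(η) = η(W)`. Pairing the equation that relates the two local
inverses with `η` gives `k = H₁ + ε h` (`isPhaseTranslation`). The Hamiltonian flow of `H₁` is the
cotangent lift `Θ` of the flow of `W`. It preserves the canonical 1-form `α`, maps vertical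
vectors to vertical vectors, and scales `h` by `exp (σ s)`, because `W` is homothetic
(`IsHomothetic.fderiv_inChart`, `IsPhaseTranslation.comp_cotangentLift`). Hence `Θ_s` scales the
Hamiltonian field `S_h` as well, and the flow of `S_k = S_{H₁} + ε S_h` at time `s` is `Θ_s` after
the flow of `S_h` at time `ε ∫₀ˢ exp (σ r) dr`.

The flow `ψ²` of `½ k²` is that of `S_k`, run with the constant factor `k`, and the flow `ψ^ε` of
`½ h²` is that of `S_h` with the factor `h`; so `ψ²` at time `s / k` equals `Θ_s` after `ψ^ε` at
time `(ε / h) ∫₀ˢ exp (σ r) dr` (`IsPhaseTranslation.flow_eq`). The inverse of this change of time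
is the function `g` of the theorem. Differentiating in the initial point, along a vector `X` with
`dk(X) = 0`, one obtains `Dψ²_{g(t)} X = DΘ (Dψ^ε_t X - t dh(X) S_h)`. Since `Dψ^ε_t` maps the
tautological field `C` to `C + t h S_h`, the vector `Dψ²_{g(t)} X` is vertical if and only if
`Dψ^ε_t (X - (dh(X) / h) C)` is (`IsPhaseTranslation.jacobi_iff`). On the contact plane of `k`,
the map `X ↦ X - (dh(X) / h) C` is exactly the projection along `C` and `S_h`, because `α(C) = 0`,
`dh(C) = α(S_h) = h` and `dh(S_h) = 0`; it preserves `ω` because `ω(C, ·) = α` vanishes there.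
That the Jacobi curves lie in the contact planes follows from the invariance of `k` and of `α` on
`ker dk` under `ψ²`.

All of this is carried out in `E × E*` with germs of flows, and transported to `T*M` by the
canonical chart around `ξ`, which identifies `α` with `p dx` (`canonicalOneForm_eq`).

For the existence of the local inverse, differentiate `F (v / F'(v) - W) = 1` in the fibre: with
`w = v / F'(v) - W` and `η = ℒ_{F'}(v)`, this gives `η = (k - η(W)) DF(w)`
(`IsTranslation.covec_legendre`), and `k - η(W)` has the sign `ε` of `g_w(w, v)`. So
`(k - η(W)) w` is the preimage of `η` under `ℒ_{F_ε}`.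
-/

noncomputable section

namespace FinslerTranslation

set_option maxSynthPendingDepth 3

/-! ### Germs of flows on a normed space -/

section FlowGerm

theorem minSmoothness_two_le : minSmoothness ℝ 2 ≤ (∞ : ℕ∞ω) := by
  rw [minSmoothness_of_isRCLikeNormedField]
  exact WithTop.coe_le_coe.2 (le_top : (2 : ℕ∞) ≤ ⊤)

theorem exists_box {X : Type*} [PseudoMetricSpace X] {P : ℝ × X → Prop} {x₀ : X}
    (h : ∀ᶠ q in 𝓝 ((0 : ℝ), x₀), P q) :
    ∃ δ > 0, ∀ t ∈ Ioo (-δ) δ, ∀ x ∈ Metric.ball x₀ δ, P (t, x) := by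
  obtain ⟨δ, hδ, h⟩ := Metric.eventually_nhds_iff_ball.mp h
  refine ⟨δ, hδ, fun t ht x hx => h _ ?_⟩
  rw [← ball_prod_same, Real.ball_eq_Ioo]
  exact ⟨by simpa using ht, hx⟩

theorem eventually_of_box {X : Type*} [PseudoMetricSpace X] {P : ℝ × X → Prop} {x₀ : X}
    {δ : ℝ} (hδ : 0 < δ)
    (h : ∀ t ∈ Ioo (-δ) δ, ∀ x ∈ Metric.ball x₀ δ, P (t, x)) :
    ∀ᶠ q in 𝓝 ((0 : ℝ), x₀), P q := by
  refine Metric.eventually_nhds_iff_ball.mpr ⟨δ, hδ, fun q hq => ?_⟩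
  rw [← ball_prod_same, Real.ball_eq_Ioo] at hq
  exact h _ (by simpa using hq.1) _ hq.2

/-- Functions whose time derivatives vanish near `(0, x₀)` do not depend on time there. The
neighbourhood is uniform in the index `i`, which later ranges over tangent vectors. -/
theorem eventually_eq_of_hasDerivAt_zero {ι : Type*} {X : Type*} [PseudoMetricSpace X]
    {G : ℝ → X → ι → ℝ} {x₀ : X}
    (h : ∀ᶠ q in 𝓝 ((0 : ℝ), x₀), ∀ i, HasDerivAt (fun s => G s q.2 i) 0 q.1) :
    ∀ᶠ q in 𝓝 ((0 : ℝ), x₀), ∀ i, G q.1 q.2 i = G 0 q.2 i := by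
  obtain ⟨δ, hδ, h⟩ := exists_box h
  refine eventually_of_box hδ fun t ht x hx i => ?_
  have h0 : (0 : ℝ) ∈ Ioo (-δ) δ := ⟨by linarith, hδ⟩
  exact (convex_Ioo (-δ) δ).is_const_of_fderivWithin_eq_zero (𝕜 := ℝ) (f := fun s => G s x i)
    (fun s hs => (h s hs x hx i).differentiableAt.differentiableWithinAt)
    (fun s hs => by
      have := ((h s hs x hx i).hasFDerivAt.hasFDerivWithinAt (s := Ioo (-δ) δ)).fderivWithin
        (isOpen_Ioo.uniqueDiffWithinAt hs)
      rw [this]; ext; simp) ht h0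

variable {X : Type*} [NormedAddCommGroup X] [NormedSpace ℝ X]

/-- `ψ` is a smooth flow of the vector field `V` for small times and initial points near `x₀`. Only
the germ of `ψ` at `(0, x₀)` matters: no domain is recorded. -/
structure IsFlowGerm (V : X → X) (x₀ : X) (ψ : ℝ → X → X) : Prop where
  smooth : ∀ᶠ q in 𝓝 ((0 : ℝ), x₀), ContDiffAt ℝ ∞ (fun q : ℝ × X => ψ q.1 q.2) q
  zero : ∀ᶠ x in 𝓝 x₀, ψ 0 x = x
  deriv : ∀ᶠ q in 𝓝 ((0 : ℝ), x₀), HasDerivAt (fun s => ψ s q.2) (V (ψ q.1 q.2)) q.1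

/-- Two families of integral curves of a `C¹` vector field with the same initial values coincide
near `(0, x₀)`. -/
theorem eventually_eq_of_integralCurves {V : X → X} {x₀ : X} {Y : Type*} [NormedAddCommGroup Y]
    [NormedSpace ℝ Y] {y₀ : Y} (hV : ContDiffAt ℝ 1 V x₀) {a b : ℝ → Y → X}
    (ha : Tendsto (fun q : ℝ × Y => a q.1 q.2) (𝓝 (0, y₀)) (𝓝 x₀))
    (hb : Tendsto (fun q : ℝ × Y => b q.1 q.2) (𝓝 (0, y₀)) (𝓝 x₀))
    (ha' : ∀ᶠ q in 𝓝 ((0 : ℝ), y₀), HasDerivAt (fun s => a s q.2) (V (a q.1 q.2)) q.1)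
    (hb' : ∀ᶠ q in 𝓝 ((0 : ℝ), y₀), HasDerivAt (fun s => b s q.2) (V (b q.1 q.2)) q.1)
    (h0 : ∀ᶠ y in 𝓝 y₀, a 0 y = b 0 y) :
    ∀ᶠ q in 𝓝 ((0 : ℝ), y₀), a q.1 q.2 = b q.1 q.2 := by
  obtain ⟨K, s, hs, hK⟩ := hV.exists_lipschitzOnWith
  have h0' : ∀ᶠ q in 𝓝 ((0 : ℝ), y₀), a 0 q.2 = b 0 q.2 :=
    (continuous_snd.tendsto ((0 : ℝ), y₀)).eventually h0
  obtain ⟨δ, hδ, h⟩ := exists_box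
    (ha'.and (hb'.and ((ha.eventually hs).and ((hb.eventually hs).and h0'))))
  have hz : (0 : ℝ) ∈ Ioo (-δ) δ := ⟨by linarith, hδ⟩
  refine eventually_of_box hδ fun t ht y hy => ?_
  exact ODE_solution_unique_of_mem_Ioo (v := fun _ => V) (s := fun _ => s) (K := K)
    (fun _ _ => hK) hz (fun t ht => ⟨(h t ht y hy).1, (h t ht y hy).2.2.1⟩)
    (fun t ht => ⟨(h t ht y hy).2.1, (h t ht y hy).2.2.2.1⟩) (h 0 hz y hy).2.2.2.2 ht

variable {V : X → X} {x₀ : X} {ψ : ℝ → X → X}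

namespace IsFlowGerm

theorem tendsto (h : IsFlowGerm V x₀ ψ) :
    Tendsto (fun q : ℝ × X => ψ q.1 q.2) (𝓝 (0, x₀)) (𝓝 x₀) := by
  have := h.smooth.self_of_nhds.continuousAt.tendsto
  simpa only [h.zero.self_of_nhds] using this

theorem hasFDerivAt_space (h : IsFlowGerm V x₀ ψ) : ∀ᶠ q in 𝓝 ((0 : ℝ), x₀),
    HasFDerivAt (ψ q.1) ((fderiv ℝ (fun q : ℝ × X => ψ q.1 q.2) q).comp
      (ContinuousLinearMap.inr ℝ ℝ X)) q.2 := by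
  filter_upwards [h.smooth] with q hq
  have h1 := (hq.differentiableAt (by simp)).hasFDerivAt
  exact h1.comp (f := fun x : X => (q.1, x)) q.2 (hasFDerivAt_prodMk_right q.1 q.2)

theorem fderiv_eq (h : IsFlowGerm V x₀ ψ) : ∀ᶠ q in 𝓝 ((0 : ℝ), x₀),
    fderiv ℝ (ψ q.1) q.2 = (fderiv ℝ (fun q : ℝ × X => ψ q.1 q.2) q).comp
      (ContinuousLinearMap.inr ℝ ℝ X) := by
  filter_upwards [h.hasFDerivAt_space] with q hq using hq.fderiv

theorem fderiv_total (h : IsFlowGerm V x₀ ψ) : ∀ᶠ q in 𝓝 ((0 : ℝ), x₀),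
    ∀ r u, fderiv ℝ (fun q : ℝ × X => ψ q.1 q.2) q (r, u) =
      r • V (ψ q.1 q.2) + fderiv ℝ (ψ q.1) q.2 u := by
  filter_upwards [h.smooth, h.fderiv_eq, h.deriv] with q hq hf hd r u
  have h1 := (hq.differentiableAt (by simp)).hasFDerivAt
  have h2 := h1.comp_hasDerivAt (f := fun s : ℝ => (s, q.2)) q.1
    ((hasDerivAt_id q.1).prodMk (hasDerivAt_const q.1 q.2))
  have h3 := h2.unique hd
  rw [hf, ← h3]
  have : (r, u) = r • ((1 : ℝ), (0 : X)) + (0, u) := by simp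
  rw [this, map_add, map_smul]
  simp

theorem smooth_fderiv (h : IsFlowGerm V x₀ ψ) : ∀ᶠ q in 𝓝 ((0 : ℝ), x₀),
    ContDiffAt ℝ ∞ (fun q : ℝ × X => fderiv ℝ (ψ q.1) q.2) q := by
  filter_upwards [h.smooth, h.fderiv_eq.eventually_nhds] with q hq hf
  have : ContDiffAt ℝ ∞ (fun q => (fderiv ℝ (fun q : ℝ × X => ψ q.1 q.2) q).comp
      (ContinuousLinearMap.inr ℝ ℝ X)) q := by
    have h1 : ContDiffAt ℝ ∞ (fderiv ℝ (fun q : ℝ × X => ψ q.1 q.2)) q :=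
      hq.fderiv_right (m := ∞) (by simp)
    exact h1.clm_comp contDiffAt_const
  exact this.congr_of_eventuallyEq hf

theorem fderiv_zero (h : IsFlowGerm V x₀ ψ) : ∀ᶠ x in 𝓝 x₀,
    fderiv ℝ (ψ 0) x = ContinuousLinearMap.id ℝ X := by
  filter_upwards [h.zero.eventually_nhds] with x hx
  rw [Filter.EventuallyEq.fderiv_eq (f₁ := ψ 0) (f := id) hx, fderiv_id]

theorem fderiv_zero' (h : IsFlowGerm V x₀ ψ) : ∀ᶠ q in 𝓝 ((0 : ℝ), x₀),
    fderiv ℝ (ψ 0) q.2 = ContinuousLinearMap.id ℝ X :=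
  (continuous_snd.tendsto ((0 : ℝ), x₀)).eventually h.fderiv_zero

theorem zero' (h : IsFlowGerm V x₀ ψ) : ∀ᶠ q in 𝓝 ((0 : ℝ), x₀), ψ 0 q.2 = q.2 :=
  (continuous_snd.tendsto ((0 : ℝ), x₀)).eventually h.zero

/-- The variational equation: the space derivative of a flow solves the linearized equation. -/
theorem hasDerivAt_fderiv (h : IsFlowGerm V x₀ ψ) (hV : ∀ᶠ x in 𝓝 x₀, ContDiffAt ℝ ∞ V x) :
    ∀ᶠ q in 𝓝 ((0 : ℝ), x₀), HasDerivAt (fun s => fderiv ℝ (ψ s) q.2)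
      ((fderiv ℝ V (ψ q.1 q.2)).comp (fderiv ℝ (ψ q.1) q.2)) q.1 := by
  filter_upwards [h.smooth, h.fderiv_total.eventually_nhds, h.tendsto.eventually hV,
    h.smooth_fderiv] with q hq htot hVq hsm
  set Ψ : ℝ × X → X := fun q => ψ q.1 q.2 with hΨ
  set D := fderiv ℝ Ψ with hD
  have hD1 : DifferentiableAt ℝ D q :=
    (hq.fderiv_right (m := ∞) (by simp)).differentiableAt (by simp)
  have hsymm := hq.isSymmSndFDerivAt minSmoothness_two_le
  have htl : Tendsto (fun s : ℝ => (s, q.2)) (𝓝 q.1) (𝓝 q) :=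
    (by fun_prop : Continuous fun s : ℝ => (s, q.2)).tendsto q.1
  have hdiff : DifferentiableAt ℝ (fun s => fderiv ℝ (ψ s) q.2) q.1 :=
    (hsm.differentiableAt (by simp)).comp (f := fun s : ℝ => (s, q.2)) q.1 (by fun_prop)
  have key : ∀ u, HasDerivAt (fun s => fderiv ℝ (ψ s) q.2 u)
      (fderiv ℝ V (ψ q.1 q.2) (fderiv ℝ (ψ q.1) q.2 u)) q.1 := by
    intro u
    have h1 : HasDerivAt (fun s : ℝ => D (s, q.2) (0, u)) (fderiv ℝ D q (1, 0) (0, u)) q.1 := by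
      have := hD1.hasFDerivAt.comp_hasDerivAt (f := fun s : ℝ => (s, q.2)) q.1
        ((hasDerivAt_id q.1).prodMk (hasDerivAt_const q.1 q.2))
      exact this.clm_apply (hasDerivAt_const _ _) |>.congr_deriv (by simp)
    -- The second derivative is symmetric, so time and space derivatives commute.
    have h2 : fderiv ℝ D q (1, 0) (0, u) = fderiv ℝ D q (0, u) (1, 0) := hsymm _ _
    have h3 : HasFDerivAt (fun q => D q (1, 0))
        ((fderiv ℝ D q).flip (1, 0)) q := by
      have := hD1.hasFDerivAt.clm_apply (hasFDerivAt_const ((1 : ℝ), (0 : X)) q)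
      exact this.congr_fderiv (by ext <;> simp)
    have h4 : (fun q => D q (1, 0)) =ᶠ[𝓝 q] fun q => V (Ψ q) := by
      filter_upwards [htot] with q' hq'
      rw [hq' 1 0]; simp [hΨ]
    have h5 : HasFDerivAt (fun q => V (Ψ q)) ((fderiv ℝ V (Ψ q)).comp (D q)) q :=
      (hVq.differentiableAt (by simp)).hasFDerivAt.comp q
        (hq.differentiableAt (by simp)).hasFDerivAt
    have h6 := (h3.congr_of_eventuallyEq h4.symm).unique h5
    have h7 : fderiv ℝ D q (0, u) (1, 0) = fderiv ℝ V (Ψ q) (D q (0, u)) := by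
      have := congrArg (fun L => L (0, u)) h6
      simpa using this
    have h8 := htot.self_of_nhds 0 u
    rw [zero_smul, zero_add] at h8
    rw [h2, h7] at h1
    rw [h8] at h1
    refine h1.congr_of_eventuallyEq ?_
    filter_upwards [htl.eventually htot] with s hs
    have := hs 0 u
    rw [zero_smul, zero_add] at this
    exact this.symm
  refine hdiff.hasDerivAt.congr_deriv ?_
  ext u
  exact (hdiff.hasDerivAt.clm_apply (hasDerivAt_const q.1 u)).congr_deriv (by simp) |>.unique
    (key u)

end IsFlowGerm

end FlowGerm

/-! ### First integrals -/

namespace IsFlowGerm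

variable {X : Type*} [NormedAddCommGroup X] [NormedSpace ℝ X] {V : X → X} {x₀ : X}
  {ψ : ℝ → X → X}

/-- A first integral of a vector field is preserved by the flow. -/
theorem firstIntegral (h : IsFlowGerm V x₀ ψ) {f : X → ℝ}
    (hf : ∀ᶠ x in 𝓝 x₀, DifferentiableAt ℝ f x) (hfV : ∀ᶠ x in 𝓝 x₀, fderiv ℝ f x (V x) = 0) :
    ∀ᶠ q in 𝓝 ((0 : ℝ), x₀), f (ψ q.1 q.2) = f q.2 := by
  have h1 : ∀ᶠ q in 𝓝 ((0 : ℝ), x₀), ∀ _ : Unit,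
      HasDerivAt (fun s => f (ψ s q.2)) 0 q.1 := by
    filter_upwards [h.deriv, h.tendsto.eventually hf, h.tendsto.eventually hfV] with q h1 h2 h3 _
    exact (h2.hasFDerivAt.comp_hasDerivAt q.1 h1).congr_deriv h3
  filter_upwards [eventually_eq_of_hasDerivAt_zero (G := fun s x _ => f (ψ s x)) h1, h.zero']
    with q h1 h2
  rw [h1 (), h2]

theorem fderiv_firstIntegral (h : IsFlowGerm V x₀ ψ) {f : X → ℝ}
    (hf : ∀ᶠ x in 𝓝 x₀, DifferentiableAt ℝ f x)
    (hfV : ∀ᶠ x in 𝓝 x₀, fderiv ℝ f x (V x) = 0) :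
    ∀ᶠ q in 𝓝 ((0 : ℝ), x₀), ∀ u,
      fderiv ℝ f (ψ q.1 q.2) (fderiv ℝ (ψ q.1) q.2 u) = fderiv ℝ f q.2 u := by
  filter_upwards [(h.firstIntegral hf hfV).eventually_nhds, h.tendsto.eventually hf,
    h.hasFDerivAt_space] with q h1 h2 h3 u
  have h4 : (fun x => f (ψ q.1 x)) =ᶠ[𝓝 q.2] f :=
    ((by fun_prop : Continuous fun x : X => (q.1, x)).tendsto q.2).eventually h1
  have h5 := h2.hasFDerivAt.comp q.2 h3
  have h6 := h4.fderiv_eq (𝕜 := ℝ)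
  rw [← h6, h3.fderiv]
  exact congrArg (fun L => L u) h5.fderiv.symm

end IsFlowGerm

/-! ### The phase space `E × E*` -/

/-- The cotangent bundle of the vector space `E`, the model of `T*M`. -/
abbrev Phase (E : Type*) [NormedAddCommGroup E] [NormedSpace ℝ E] : Type _ := E × (E →L[ℝ] ℝ)

section Phase

variable {E : Type*} [NormedAddCommGroup E] [NormedSpace ℝ E]

/-- The canonical symplectic form `dp ∧ dx` of `E × E*`, the exterior derivative of the Liouville
form `p dx`. -/
def phaseForm (X Y : Phase E) : ℝ := X.2 Y.1 - Y.2 X.1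

theorem hasDerivAt_fst {c : ℝ → Phase E} {c' : Phase E} {t : ℝ} (h : HasDerivAt c c' t) :
    HasDerivAt (fun s => (c s).1) c'.1 t :=
  (ContinuousLinearMap.fst ℝ E (E →L[ℝ] ℝ)).hasFDerivAt.comp_hasDerivAt t h

theorem hasDerivAt_snd {c : ℝ → Phase E} {c' : Phase E} {t : ℝ} (h : HasDerivAt c c' t) :
    HasDerivAt (fun s => (c s).2) c'.2 t :=
  (ContinuousLinearMap.snd ℝ E (E →L[ℝ] ℝ)).hasFDerivAt.comp_hasDerivAt t h

/-- A map that preserves the Liouville form `p dx` up to an exact form preserves `dp ∧ dx`. -/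
theorem phaseForm_fderiv {θ : Phase E → Phase E} {f : Phase E → ℝ} {y : Phase E}
    (hθ : ContDiffAt ℝ ∞ θ y) (hf : ContDiffAt ℝ ∞ f y)
    (h : ∀ᶠ z in 𝓝 y, ∀ u, (θ z).2 (fderiv ℝ θ z u).1 = z.2 u.1 + fderiv ℝ f z u)
    (X Y : Phase E) :
    phaseForm (fderiv ℝ θ y X) (fderiv ℝ θ y Y) = phaseForm X Y := by
  have hθ1 := (hθ.differentiableAt (by simp)).hasFDerivAt
  have hθ2 := ((hθ.fderiv_right (m := ∞) (by simp)).differentiableAt (by simp)).hasFDerivAt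
  have hf2 := ((hf.fderiv_right (m := ∞) (by simp)).differentiableAt (by simp)).hasFDerivAt
  -- The derivative of `h`; antisymmetrized in `u`, `v`, the second derivatives drop out.
  have key : ∀ u v, (fderiv ℝ θ y v).2 (fderiv ℝ θ y u).1 +
      (θ y).2 (fderiv ℝ (fderiv ℝ θ) y v u).1 = v.2 u.1 + fderiv ℝ (fderiv ℝ f) y v u := by
    intro u v
    have h1 := hθ1.snd.clm_apply (hθ2.clm_apply (hasFDerivAt_const u y)).fst
    have h2 := ((hasFDerivAt_snd (𝕜 := ℝ) (p := y)).clm_apply (hasFDerivAt_const u.1 y)).add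
      (hf2.clm_apply (hasFDerivAt_const u y))
    have h3 : (fun z => (θ z).2 (fderiv ℝ θ z u).1) =ᶠ[𝓝 y] fun z => z.2 u.1 + fderiv ℝ f z u :=
      h.mono fun z hz => hz u
    have h4 := congrArg (fun L => L v) (h1.unique (h2.congr_of_eventuallyEq h3))
    simp at h4
    linarith
  have h1 := key X Y
  have h2 := key Y X
  have h3 := hθ.isSymmSndFDerivAt minSmoothness_two_le X Y
  have h4 := hf.isSymmSndFDerivAt minSmoothness_two_le X Y
  simp only [phaseForm]
  rw [h3, h4] at h2
  linarith

/-- The musical map `S ↦ ω(·, S)`. -/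
def phaseFlat (E : Type*) [NormedAddCommGroup E] [NormedSpace ℝ E] :
    Phase E →ₗ[ℝ] (Phase E →L[ℝ] ℝ) where
  toFun S := (ContinuousLinearMap.apply ℝ ℝ S.1).comp (ContinuousLinearMap.snd ℝ E (E →L[ℝ] ℝ)) -
    S.2.comp (ContinuousLinearMap.fst ℝ E (E →L[ℝ] ℝ))
  map_add' S T := by ext <;> simp; ring
  map_smul' c S := by ext <;> simp

theorem phaseFlat_apply (S X : Phase E) : phaseFlat E S X = phaseForm X S := by
  simp [phaseFlat, phaseForm]

theorem phaseForm_nondegenerate {S : Phase E} (h : ∀ X, phaseForm X S = 0) : S = 0 := by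
  have h2 : S.2 = 0 := by
    ext u
    have := h (u, 0)
    simpa [phaseForm] using this
  have h1 : S.1 = 0 := by
    by_contra hne
    obtain ⟨f, -, hf⟩ := exists_dual_vector ℝ S.1 (by simpa using hne)
    have := h (0, f)
    simp only [phaseForm, map_zero, sub_zero] at this
    rw [this] at hf
    exact hne (by simpa using hf.symm)
  exact Prod.ext h1 h2

theorem phaseFlat_injective : Function.Injective (phaseFlat E) := by
  rw [← LinearMap.ker_eq_bot, LinearMap.ker_eq_bot']
  intro S hS
  refine phaseForm_nondegenerate fun X => ?_
  rw [← phaseFlat_apply, hS]; rfl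

variable [FiniteDimensional ℝ E]

theorem finrank_phase_dual :
    Module.finrank ℝ (Phase E) = Module.finrank ℝ (Phase E →L[ℝ] ℝ) := by
  rw [← (LinearMap.toContinuousLinearMap (𝕜 := ℝ) (E := Phase E) (F' := ℝ)).finrank_eq,
    Module.finrank_linearMap]
  simp

/-- The inverse of the musical map `S ↦ ω(·, S)`. -/
def phaseSharp (E : Type*) [NormedAddCommGroup E] [NormedSpace ℝ E] [FiniteDimensional ℝ E] :
    (Phase E →L[ℝ] ℝ) →L[ℝ] Phase E :=
  LinearMap.toContinuousLinearMap
    ((phaseFlat E).linearEquivOfInjective phaseFlat_injective finrank_phase_dual).symm.toLinearMap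

theorem phaseForm_phaseSharp (f : Phase E →L[ℝ] ℝ) (X : Phase E) :
    phaseForm X (phaseSharp E f) = f X := by
  rw [← phaseFlat_apply]
  exact congrArg (fun L => L X) (((phaseFlat E).linearEquivOfInjective phaseFlat_injective
    finrank_phase_dual).apply_symm_apply f)

theorem eq_phaseSharp {f : Phase E →L[ℝ] ℝ} {S : Phase E} (h : ∀ X, phaseForm X S = f X) :
    S = phaseSharp E f := by
  apply phaseFlat_injective
  refine ContinuousLinearMap.ext fun X => ?_
  rw [phaseFlat_apply, phaseFlat_apply, phaseForm_phaseSharp, h]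

/-- The Hamiltonian vector field `S` of `K` on `E × E*`, defined by `dK = ω(·, S)`. -/
def hamVec (K : Phase E → ℝ) (y : Phase E) : Phase E := phaseSharp E (fderiv ℝ K y)

theorem fderiv_eq_hamVec (K : Phase E → ℝ) (y X : Phase E) :
    fderiv ℝ K y X = X.2 (hamVec K y).1 - (hamVec K y).2 X.1 :=
  (phaseForm_phaseSharp (fderiv ℝ K y) X).symm

theorem fderiv_hamVec_self (K : Phase E → ℝ) (y : Phase E) : fderiv ℝ K y (hamVec K y) = 0 := by
  rw [fderiv_eq_hamVec, sub_self]

theorem contDiffAt_hamVec {K : Phase E → ℝ} {y : Phase E} (h : ContDiffAt ℝ ∞ K y) :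
    ContDiffAt ℝ ∞ (hamVec K) y :=
  (phaseSharp E).contDiff.contDiffAt.comp y (h.fderiv_right (m := ∞) (by simp))

theorem hamVec_half_sq {k : Phase E → ℝ} {y : Phase E} (h : DifferentiableAt ℝ k y) :
    hamVec (fun z => (1 / 2) * k z ^ 2) y = k y • hamVec k y := by
  have h1 := (h.hasFDerivAt.pow 2).const_mul (1 / 2 : ℝ)
  rw [hamVec, hamVec, h1.fderiv, ← map_smul]
  congr 1
  refine ContinuousLinearMap.ext fun u => ?_
  simp
  ring

/-! ### Flows of Hamiltonians that are homogeneous of degree two -/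

/-- The Euler relation `dK(C) = 2 K`, differentiated. -/
theorem fderiv_hamVec_of_euler {K : Phase E → ℝ} {y : Phase E} (hK : ContDiffAt ℝ ∞ K y)
    (hE : ∀ᶠ z in 𝓝 y, fderiv ℝ K z (0, z.2) = 2 * K z) (Z : Phase E) :
    (hamVec K y).2 Z.1 + y.2 (fderiv ℝ (hamVec K) y Z).1 = fderiv ℝ K y Z := by
  have h1 : (fun z : Phase E => z.2 (hamVec K z).1) =ᶠ[𝓝 y] fun z => 2 * K z := by
    filter_upwards [hE] with z hz
    rw [← hz, fderiv_eq_hamVec]; simp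
  have hS := ((contDiffAt_hamVec hK).differentiableAt (by simp)).hasFDerivAt
  have h2 := (hasFDerivAt_snd (𝕜 := ℝ) (p := y)).clm_apply hS.fst
  have h3 := ((hK.differentiableAt (by simp)).hasFDerivAt).const_mul (2 : ℝ)
  have h4 := congrArg (fun L => L Z) (h2.unique (h3.congr_of_eventuallyEq h1))
  simp at h4
  have h5 := fderiv_eq_hamVec K y Z
  linarith

section Quadratic

variable {K : Phase E → ℝ} {y₀ : Phase E} {ψ : ℝ → Phase E → Phase E}

/-- The flow `ψ_t` of a Hamiltonian `K` of degree two satisfies `ψ_t^* (p dx) = p dx + t dK`. -/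
theorem IsFlowGerm.liouville (h : IsFlowGerm (hamVec K) y₀ ψ)
    (hK : ∀ᶠ z in 𝓝 y₀, ContDiffAt ℝ ∞ K z)
    (hE : ∀ᶠ z in 𝓝 y₀, fderiv ℝ K z (0, z.2) = 2 * K z) :
    ∀ᶠ q in 𝓝 ((0 : ℝ), y₀), ∀ u, (ψ q.1 q.2).2 (fderiv ℝ (ψ q.1) q.2 u).1 =
      q.2.2 u.1 + q.1 * fderiv ℝ K q.2 u := by
  have h1 : ∀ᶠ q in 𝓝 ((0 : ℝ), y₀), ∀ u, HasDerivAt (fun s =>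
      (ψ s q.2).2 (fderiv ℝ (ψ s) q.2 u).1 - s * fderiv ℝ K q.2 u) 0 q.1 := by
    filter_upwards [h.deriv, h.hasDerivAt_fderiv (hK.mono fun z hz => contDiffAt_hamVec hz),
      h.tendsto.eventually hK, h.tendsto.eventually hE.eventually_nhds,
      h.fderiv_firstIntegral (hK.mono fun z hz => hz.differentiableAt (by simp))
        (Eventually.of_forall fun z => fderiv_hamVec_self K z)] with q h1 h2 h3 h4 h5 u
    have h6 := ((hasDerivAt_snd h1).clm_apply
      (hasDerivAt_fst (h2.clm_apply (hasDerivAt_const q.1 u)))).sub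
      ((hasDerivAt_id q.1).mul_const (fderiv ℝ K q.2 u))
    refine h6.congr_deriv ?_
    have h7 := fderiv_hamVec_of_euler h3 h4 (fderiv ℝ (ψ q.1) q.2 u)
    rw [h5 u] at h7
    simp
    linarith
  filter_upwards [eventually_eq_of_hasDerivAt_zero
    (G := fun s y u => (ψ s y).2 (fderiv ℝ (ψ s) y u).1 - s * fderiv ℝ K y u) h1, h.zero',
    h.fderiv_zero'] with q h1 h2 h3 u
  have := h1 u
  simp only [h2, h3] at this
  simp at this
  linarith

theorem IsFlowGerm.phaseForm_fderiv (h : IsFlowGerm (hamVec K) y₀ ψ)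
    (hK : ∀ᶠ z in 𝓝 y₀, ContDiffAt ℝ ∞ K z)
    (hE : ∀ᶠ z in 𝓝 y₀, fderiv ℝ K z (0, z.2) = 2 * K z) :
    ∀ᶠ q in 𝓝 ((0 : ℝ), y₀), ∀ X Y,
      phaseForm (fderiv ℝ (ψ q.1) q.2 X) (fderiv ℝ (ψ q.1) q.2 Y) = phaseForm X Y := by
  filter_upwards [(h.liouville hK hE).eventually_nhds, h.smooth,
    ((continuous_snd.tendsto ((0 : ℝ), y₀)).eventually hK).eventually_nhds] with q h1 h2 h3 X Y
  have hc : Tendsto (fun x : Phase E => (q.1, x)) (𝓝 q.2) (𝓝 q) :=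
    (by fun_prop : Continuous fun x : Phase E => (q.1, x)).tendsto q.2
  refine FinslerTranslation.phaseForm_fderiv (f := fun z => q.1 * K z) ?_ ?_ ?_ X Y
  · exact h2.comp (f := fun x => (q.1, x)) q.2 (by fun_prop)
  · exact contDiffAt_const.mul h3.self_of_nhds
  · filter_upwards [hc.eventually h1, hc.eventually h3] with z h4 h5 u
    rw [h4 u]
    congr 1
    have := ((h5.differentiableAt (by simp)).hasFDerivAt.const_mul q.1).fderiv
    rw [this]; simp

/-- A linear map that preserves `dp ∧ dx` is surjective. -/
theorem surjective_of_phaseForm {L : Phase E →L[ℝ] Phase E}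
    (h : ∀ X Y, phaseForm (L X) (L Y) = phaseForm X Y) : Function.Surjective L := by
  have : Function.Injective L.toLinearMap := by
    rw [← LinearMap.ker_eq_bot, LinearMap.ker_eq_bot']
    intro S hS
    refine phaseForm_nondegenerate fun X => ?_
    rw [← h, show L S = 0 from hS]; simp [phaseForm]
  exact LinearMap.surjective_of_injective this

/-- If `L` preserves `dp ∧ dx`, then `L X` is determined by its pairing with the image of `L`. -/
theorem eq_of_phaseForm_eq {L : Phase E →L[ℝ] Phase E}
    (h : ∀ X Y, phaseForm (L X) (L Y) = phaseForm X Y) {S T : Phase E}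
    (hST : ∀ X, phaseForm (L X) (L S) = phaseForm (L X) T) : L S = T := by
  rw [← sub_eq_zero]
  refine phaseForm_nondegenerate fun Y => ?_
  obtain ⟨X, rfl⟩ := surjective_of_phaseForm h Y
  have := hST X
  simp only [phaseForm, Prod.snd_sub, Prod.fst_sub, map_sub, sub_apply] at this ⊢
  linarith

/-- The flow `ψ_t` of a Hamiltonian `K` of degree two maps the tautological field `C = (0, p)` to
`C + t S_K`. -/
theorem IsFlowGerm.fderiv_tautological (h : IsFlowGerm (hamVec K) y₀ ψ)
    (hK : ∀ᶠ z in 𝓝 y₀, ContDiffAt ℝ ∞ K z)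
    (hE : ∀ᶠ z in 𝓝 y₀, fderiv ℝ K z (0, z.2) = 2 * K z) :
    ∀ᶠ q in 𝓝 ((0 : ℝ), y₀), fderiv ℝ (ψ q.1) q.2 (0, q.2.2) =
      (0, (ψ q.1 q.2).2) + q.1 • hamVec K (ψ q.1 q.2) := by
  filter_upwards [h.liouville hK hE, h.phaseForm_fderiv hK hE,
    h.fderiv_firstIntegral (hK.mono fun z hz => hz.differentiableAt (by simp))
        (Eventually.of_forall fun z => fderiv_hamVec_self K z)] with q h1 h2 h3
  refine eq_of_phaseForm_eq h2 fun X => ?_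
  have h4 := h3 X
  rw [fderiv_eq_hamVec] at h4
  have h5 := h1 X
  rw [h2]
  simp [phaseForm] at h4 h5 ⊢
  linear_combination h5 - q.1 * h4

end Quadratic

end Phase

section

variable {E : Type*} [NormedAddCommGroup E] [NormedSpace ℝ E]

/-! ### The cotangent lift of a flow -/

/-- The cotangent lift `(x, p) ↦ (φ_s x, p ∘ (Dφ_s x)⁻¹)` of a flow `φ` on `E`. `Ring.inverse` is
the inverse where `Dφ_s x` is invertible, which holds for small `s`, and `0` elsewhere. -/
def cotangentLift (φ : ℝ → E → E) (s : ℝ) (y : Phase E) : Phase E :=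
  (φ s y.1, y.2.comp (Ring.inverse (fderiv ℝ (φ s) y.1)))

/-- The vector field on `E × E*` that generates the cotangent lift of the flow of `W`; it is the
Hamiltonian vector field of `(x, p) ↦ p (W x)`. -/
def liftField (W : E → E) (y : Phase E) : Phase E := (W y.1, -(y.2.comp (fderiv ℝ W y.1)))

section Lift

variable {W : E → E} {y₀ : Phase E} {φ : ℝ → E → E}

theorem tendsto_fst_zero (y₀ : Phase E) :
    Tendsto (fun q : ℝ × Phase E => (q.1, q.2.1)) (𝓝 (0, y₀)) (𝓝 (0, y₀.1)) :=
  (by fun_prop : Continuous fun q : ℝ × Phase E => (q.1, q.2.1)).tendsto ((0 : ℝ), y₀)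

variable [FiniteDimensional ℝ E]

theorem IsFlowGerm.isUnit_fderiv {x₀ : E} (h : IsFlowGerm W x₀ φ) :
    ∀ᶠ q in 𝓝 ((0 : ℝ), x₀), IsUnit (fderiv ℝ (φ q.1) q.2) := by
  have := FiniteDimensional.complete ℝ E
  have h1 := h.smooth_fderiv.self_of_nhds.continuousAt
  have h2 : fderiv ℝ (φ 0) x₀ = ContinuousLinearMap.id ℝ E := h.fderiv_zero.self_of_nhds
  refine h1.eventually ((Units.isOpen (R := E →L[ℝ] E)).mem_nhds ?_)
  change IsUnit (fderiv ℝ (φ 0) x₀)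
  rw [h2]
  exact isUnit_one

theorem isFlowGerm_cotangentLift (h : IsFlowGerm W y₀.1 φ)
    (hW : ∀ᶠ x in 𝓝 y₀.1, ContDiffAt ℝ ∞ W x) :
    IsFlowGerm (liftField W) y₀ (cotangentLift φ) where
  smooth := by
    have := FiniteDimensional.complete ℝ E
    have ht := tendsto_fst_zero y₀
    filter_upwards [ht.eventually h.smooth, ht.eventually h.smooth_fderiv,
      ht.eventually h.isUnit_fderiv] with q h1 h2 h3
    have hp : ContDiffAt ℝ ∞ (fun q : ℝ × Phase E => (q.1, q.2.1)) q := by fun_prop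
    obtain ⟨u, hu⟩ := h3
    have h4 : ContDiffAt ℝ ∞ (Ring.inverse : (E →L[ℝ] E) → (E →L[ℝ] E))
        (fderiv ℝ (φ q.1) q.2.1) := by
      rw [← hu]; exact contDiffAt_ringInverse ℝ u
    have h5 := h2.comp (f := fun q : ℝ × Phase E => (q.1, q.2.1)) q hp
    have h6 := h4.comp (f := fun q : ℝ × Phase E => fderiv ℝ (φ q.1) q.2.1) q h5
    exact (h1.comp (f := fun q : ℝ × Phase E => (q.1, q.2.1)) q hp).prodMk
      ((by fun_prop : ContDiffAt ℝ ∞ (fun q : ℝ × Phase E => q.2.2) q).clm_comp h6)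
  zero := by
    have ht : Tendsto (fun y : Phase E => y.1) (𝓝 y₀) (𝓝 y₀.1) := continuous_fst.tendsto y₀
    filter_upwards [ht.eventually h.zero, ht.eventually h.fderiv_zero] with y h1 h2
    rw [cotangentLift, h1, h2]
    have : Ring.inverse (ContinuousLinearMap.id ℝ E) = ContinuousLinearMap.id ℝ E :=
      Ring.inverse_one (E →L[ℝ] E)
    rw [this, ContinuousLinearMap.comp_id]
  deriv := by
    have := FiniteDimensional.complete ℝ E
    have ht := tendsto_fst_zero y₀
    filter_upwards [ht.eventually h.deriv, ht.eventually (h.hasDerivAt_fderiv hW),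
      ht.eventually h.isUnit_fderiv] with q h1 h2 h3
    obtain ⟨u, hu⟩ := h3
    refine h1.prodMk ?_
    have h4 := hasFDerivAt_ringInverse (𝕜 := ℝ) u
    rw [hu] at h4
    have h5 := (hasDerivAt_const q.1 q.2.2).clm_comp (h4.comp_hasDerivAt q.1 h2)
    refine h5.congr_deriv ?_
    have h6 : (fderiv ℝ (φ q.1) q.2.1) * (↑u⁻¹ : E →L[ℝ] E) = 1 := by rw [← hu]; simp
    have h7 : Ring.inverse (fderiv ℝ (φ q.1) q.2.1) = ↑u⁻¹ := by rw [← hu]; simp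
    refine ContinuousLinearMap.ext fun v => ?_
    have h8 : (fderiv ℝ (φ q.1) q.2.1) ((↑u⁻¹ : E →L[ℝ] E) v) = v :=
      congrArg (fun L => L v) h6
    simp [cotangentLift, h7, h8]

theorem fst_fderiv_cotangentLift (h : IsFlowGerm W y₀.1 φ)
    (hW : ∀ᶠ x in 𝓝 y₀.1, ContDiffAt ℝ ∞ W x) :
    ∀ᶠ q in 𝓝 ((0 : ℝ), y₀), ∀ u,
      (fderiv ℝ (cotangentLift φ q.1) q.2 u).1 = fderiv ℝ (φ q.1) q.2.1 u.1 := by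
  filter_upwards [(isFlowGerm_cotangentLift h hW).hasFDerivAt_space,
    (tendsto_fst_zero y₀).eventually h.hasFDerivAt_space] with q h1 h2 u
  have h3 := h1.fst
  have h4 := h2.comp q.2 (hasFDerivAt_fst (𝕜 := ℝ) (p := q.2))
  rw [h1.fderiv, h2.fderiv]
  exact congrArg (fun L => L u) (h3.unique h4)

/-- The cotangent lift preserves the Liouville form. -/
theorem liouville_cotangentLift (h : IsFlowGerm W y₀.1 φ)
    (hW : ∀ᶠ x in 𝓝 y₀.1, ContDiffAt ℝ ∞ W x) :
    ∀ᶠ q in 𝓝 ((0 : ℝ), y₀), ∀ u,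
      (cotangentLift φ q.1 q.2).2 (fderiv ℝ (cotangentLift φ q.1) q.2 u).1 = q.2.2 u.1 := by
  filter_upwards [fst_fderiv_cotangentLift h hW,
    (tendsto_fst_zero y₀).eventually h.isUnit_fderiv] with q h1 h2 u
  rw [h1]
  exact congrArg (fun L : E →L[ℝ] E => q.2.2 (L u.1)) (Ring.inverse_mul_cancel _ h2)

/-- The derivative of the cotangent lift preserves the vertical vectors and no others become
vertical. -/
theorem fst_fderiv_cotangentLift_eq_zero (h : IsFlowGerm W y₀.1 φ)
    (hW : ∀ᶠ x in 𝓝 y₀.1, ContDiffAt ℝ ∞ W x) :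
    ∀ᶠ q in 𝓝 ((0 : ℝ), y₀), ∀ u,
      (fderiv ℝ (cotangentLift φ q.1) q.2 u).1 = 0 ↔ u.1 = 0 := by
  filter_upwards [fst_fderiv_cotangentLift h hW,
    (tendsto_fst_zero y₀).eventually h.isUnit_fderiv] with q h1 h2 u
  rw [h1]
  refine ⟨fun h3 => ?_, fun h3 => by rw [h3, map_zero]⟩
  have := congrArg (fun L : E →L[ℝ] E => L u.1) (Ring.inverse_mul_cancel _ h2)
  change Ring.inverse (fderiv ℝ (φ q.1) q.2.1) (fderiv ℝ (φ q.1) q.2.1 u.1) = u.1 at this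
  rw [← this, h3, map_zero]

theorem phaseForm_cotangentLift (h : IsFlowGerm W y₀.1 φ)
    (hW : ∀ᶠ x in 𝓝 y₀.1, ContDiffAt ℝ ∞ W x) :
    ∀ᶠ q in 𝓝 ((0 : ℝ), y₀), ∀ X Y,
      phaseForm (fderiv ℝ (cotangentLift φ q.1) q.2 X) (fderiv ℝ (cotangentLift φ q.1) q.2 Y) =
        phaseForm X Y := by
  filter_upwards [(liouville_cotangentLift h hW).eventually_nhds,
    (isFlowGerm_cotangentLift h hW).smooth] with q h1 h2 X Y
  have hc : Tendsto (fun x : Phase E => (q.1, x)) (𝓝 q.2) (𝓝 q) :=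
    (by fun_prop : Continuous fun x : Phase E => (q.1, x)).tendsto q.2
  refine phaseForm_fderiv (f := fun _ => 0) ?_ contDiffAt_const ?_ X Y
  · exact h2.comp (f := fun x => (q.1, x)) q.2 (by fun_prop)
  · filter_upwards [hc.eventually h1] with z h4 u
    rw [h4 u]; simp

theorem hamVec_pairing {W : E → E} {y : Phase E} (hW : DifferentiableAt ℝ W y.1) :
    hamVec (fun z : Phase E => z.2 (W z.1)) y = liftField W y := by
  refine (eq_phaseSharp fun X => ?_).symm
  have h1 := (hasFDerivAt_snd (𝕜 := ℝ) (p := y)).clm_apply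
    (hW.hasFDerivAt.comp y (hasFDerivAt_fst (𝕜 := ℝ) (p := y)))
  refine Eq.trans ?_ (congrArg (fun L => L X) h1.fderiv.symm)
  simp [phaseForm, liftField]
  ring

end Lift

/-! ### Translations in the phase space -/

/-- The Hamiltonian side of a translation by a homothetic field, near the point `y₀` of `E × E*`:
`k = H₁ + ε h` where `H₁ (x, p) = p (W x)`, `h` is homogeneous of degree one in `p`, and `h` is
scaled at the rate `σ` by the cotangent lift of the flow of `W`. -/
structure IsPhaseTranslation (h k : Phase E → ℝ) (W : E → E) (σ ε : ℝ) (y₀ : Phase E) : Prop where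
  smooth_left : ∀ᶠ z in 𝓝 y₀, ContDiffAt ℝ ∞ h z
  smooth_field : ∀ᶠ x in 𝓝 y₀.1, ContDiffAt ℝ ∞ W x
  euler_left : ∀ᶠ z in 𝓝 y₀, fderiv ℝ h z (0, z.2) = h z
  homothetic : ∀ᶠ z in 𝓝 y₀, fderiv ℝ h z (liftField W z) = σ * h z
  eq : ∀ᶠ z in 𝓝 y₀, k z = z.2 (W z.1) + ε * h z
  left_ne : h y₀ ≠ 0
  right_ne : k y₀ ≠ 0
  sq : ε * ε = 1

/-- The primitive of `s ↦ exp (σ s)` that vanishes at `0`; the value `s` at `σ = 0` is the limit. -/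
def expPrimitive (σ s : ℝ) : ℝ := if σ = 0 then s else (Real.exp (σ * s) - 1) / σ

theorem hasDerivAt_expPrimitive (σ s : ℝ) :
    HasDerivAt (expPrimitive σ) (Real.exp (σ * s)) s := by
  unfold expPrimitive
  by_cases h : σ = 0
  · simp only [h, if_true, zero_mul, Real.exp_zero]; exact hasDerivAt_id s
  · simp only [h, if_false]
    have := ((((hasDerivAt_id s).const_mul σ).exp).sub_const 1).div_const σ
    refine this.congr_deriv ?_
    simp only [id]; field_simp

theorem expPrimitive_zero (σ : ℝ) : expPrimitive σ 0 = 0 := by simp [expPrimitive]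

/-- `reparam` is, up to the factor `H₂`, the inverse function of `expPrimitive`. -/
theorem expPrimitive_reparam {σ ε a b t : ℝ} (hb : b ≠ 0) (ht : 0 < 1 + ε * σ * a * t) :
    expPrimitive σ (b * reparam σ ε a b t) = ε * a * t := by
  unfold expPrimitive reparam
  by_cases h : σ = 0
  · simp only [h, if_true]; field_simp
  · simp only [h, if_false]
    have : σ * (b * (Real.log (1 + ε * σ * a * t) / (b * σ))) = Real.log (1 + ε * σ * a * t) := by
      field_simp
    rw [this, Real.exp_log ht]; field_simp; ring

theorem tendsto_reparam (σ ε a b : ℝ) :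
    Tendsto (reparam σ ε a b) (𝓝 0) (𝓝 0) := by
  have h0 : reparam σ ε a b 0 = 0 := by simp [reparam]
  have : ContinuousAt (reparam σ ε a b) 0 := by
    unfold reparam
    by_cases h : σ = 0
    · simp only [h, if_true]; fun_prop
    · simp only [h, if_false]
      refine ContinuousAt.div_const (ContinuousAt.log (by fun_prop) (by simp)) _
  simpa [ContinuousAt, h0] using this

/-- The Euler relation for the half square of a function of degree one. -/
theorem euler_half_sq {k : Phase E → ℝ} {y₀ : Phase E} (hk : ∀ᶠ z in 𝓝 y₀, ContDiffAt ℝ ∞ k z)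
    (he : ∀ᶠ z in 𝓝 y₀, fderiv ℝ k z (0, z.2) = k z) :
    ∀ᶠ z in 𝓝 y₀, fderiv ℝ (fun z => (1 / 2) * k z ^ 2) z (0, z.2) =
      2 * ((1 / 2) * k z ^ 2) := by
  filter_upwards [hk, he] with z h1 h2
  rw [(((h1.differentiableAt (by simp)).hasFDerivAt.pow 2).const_mul (1 / 2 : ℝ)).fderiv]
  simp [h2]; ring

theorem smooth_half_sq {k : Phase E → ℝ} {y₀ : Phase E}
    (hk : ∀ᶠ z in 𝓝 y₀, ContDiffAt ℝ ∞ k z) :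
    ∀ᶠ z in 𝓝 y₀, ContDiffAt ℝ ∞ (fun z => (1 / 2) * k z ^ 2) z :=
  hk.mono fun _ h => contDiffAt_const.mul (h.pow 2)

section FirstIntegral

variable [FiniteDimensional ℝ E] {k : Phase E → ℝ} {y₀ : Phase E} {ψ : ℝ → Phase E → Phase E}

theorem fderiv_hamVec_half_sq (hk : ∀ᶠ z in 𝓝 y₀, ContDiffAt ℝ ∞ k z) :
    ∀ᶠ z in 𝓝 y₀, fderiv ℝ k z (hamVec (fun z => (1 / 2) * k z ^ 2) z) = 0 := by
  filter_upwards [hk] with z h1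
  rw [hamVec_half_sq (h1.differentiableAt (by simp)), map_smul, fderiv_hamVec_self, smul_zero]

/-- The flow `ψ_t` of `½ k²` preserves `k`; its derivative preserves `dk` and, on `ker dk`, the
Liouville form, and maps `C` to `C + t k S_k`. -/
theorem IsFlowGerm.half_sq_invariants
    (h : IsFlowGerm (hamVec fun z => (1 / 2) * k z ^ 2) y₀ ψ)
    (hk : ∀ᶠ z in 𝓝 y₀, ContDiffAt ℝ ∞ k z)
    (he : ∀ᶠ z in 𝓝 y₀, fderiv ℝ k z (0, z.2) = k z) :
    ∀ᶠ q in 𝓝 ((0 : ℝ), y₀), k (ψ q.1 q.2) = k q.2 ∧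
      (∀ u, fderiv ℝ k (ψ q.1 q.2) (fderiv ℝ (ψ q.1) q.2 u) = fderiv ℝ k q.2 u) ∧
      (∀ u, fderiv ℝ k q.2 u = 0 →
        (ψ q.1 q.2).2 (fderiv ℝ (ψ q.1) q.2 u).1 = q.2.2 u.1) ∧
      fderiv ℝ (ψ q.1) q.2 (0, q.2.2) =
        (0, (ψ q.1 q.2).2) + (q.1 * k q.2) • hamVec k (ψ q.1 q.2) := by
  have hd := hk.mono fun z hz => hz.differentiableAt (n := ∞) (by simp)
  filter_upwards [h.firstIntegral hd (fderiv_hamVec_half_sq hk),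
    h.fderiv_firstIntegral hd (fderiv_hamVec_half_sq hk),
    h.liouville (smooth_half_sq hk) (euler_half_sq hk he),
    h.fderiv_tautological (smooth_half_sq hk) (euler_half_sq hk he),
    (continuous_snd.tendsto ((0 : ℝ), y₀)).eventually hd, h.tendsto.eventually hd]
    with q h1 h2 h3 h4 h5 h6
  refine ⟨h1, h2, fun u hu => ?_, ?_⟩
  · rw [h3 u, ((h5.hasFDerivAt.pow 2).const_mul (1 / 2 : ℝ)).fderiv]
    simp [hu]
  · rw [h4, hamVec_half_sq h6, h1, smul_smul]

end FirstIntegral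

end

section

variable {E : Type*} [NormedAddCommGroup E] [NormedSpace ℝ E]

/-! ### The flows of the two Hamiltonians of a translation -/

theorem hasFDerivAt_const_div {X : Type*} [NormedAddCommGroup X] [NormedSpace ℝ X] {f : X → ℝ}
    {f' : X →L[ℝ] ℝ} {x : X} (c : ℝ) (hf : HasFDerivAt f f' x) (hx : f x ≠ 0) :
    HasFDerivAt (fun y => c / f y) (-(c / f x ^ 2) • f') x := by
  have h1 := ((hasDerivAt_inv hx).comp_hasFDerivAt x hf).const_mul c
  refine (h1.congr_fderiv ?_)
  rw [smul_smul]
  congr 1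
  field_simp

namespace IsPhaseTranslation

variable {h k : Phase E → ℝ} {W : E → E} {σ ε : ℝ} {y₀ : Phase E}

theorem smooth_field' (hT : IsPhaseTranslation h k W σ ε y₀) :
    ∀ᶠ z in 𝓝 y₀, ContDiffAt ℝ ∞ W z.1 :=
  (continuous_fst.tendsto y₀).eventually hT.smooth_field

theorem smooth_pairing (hT : IsPhaseTranslation h k W σ ε y₀) :
    ∀ᶠ z in 𝓝 y₀, ContDiffAt ℝ ∞ (fun z : Phase E => z.2 (W z.1)) z := by
  filter_upwards [hT.smooth_field'] with z hz
  exact contDiffAt_snd.clm_apply (hz.comp z contDiffAt_fst)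

theorem smooth_right (hT : IsPhaseTranslation h k W σ ε y₀) :
    ∀ᶠ z in 𝓝 y₀, ContDiffAt ℝ ∞ k z := by
  filter_upwards [hT.smooth_pairing, hT.smooth_left, hT.eq.eventually_nhds] with z h1 h2 h3
  exact (h1.add (contDiffAt_const.mul h2)).congr_of_eventuallyEq h3

theorem fderiv_right (hT : IsPhaseTranslation h k W σ ε y₀) :
    ∀ᶠ z in 𝓝 y₀, fderiv ℝ k z =
      fderiv ℝ (fun z : Phase E => z.2 (W z.1)) z + ε • fderiv ℝ h z := by
  filter_upwards [hT.smooth_pairing, hT.smooth_left, hT.eq.eventually_nhds] with z h1 h2 h3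
  have h4 := (h1.differentiableAt (by simp)).hasFDerivAt.add
    ((h2.differentiableAt (by simp)).hasFDerivAt.const_mul ε)
  rw [Filter.EventuallyEq.fderiv_eq h3]
  exact h4.fderiv

variable [FiniteDimensional ℝ E]

theorem hamVec_right (hT : IsPhaseTranslation h k W σ ε y₀) :
    ∀ᶠ z in 𝓝 y₀, hamVec k z = liftField W z + ε • hamVec h z := by
  filter_upwards [hT.fderiv_right, hT.smooth_field'] with z h1 h2
  rw [← hamVec_pairing (h2.differentiableAt (by simp))]
  simp only [hamVec]
  rw [h1, map_add, map_smul]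

theorem euler_right (hT : IsPhaseTranslation h k W σ ε y₀) :
    ∀ᶠ z in 𝓝 y₀, fderiv ℝ k z (0, z.2) = k z := by
  filter_upwards [hT.fderiv_right, hT.smooth_field', hT.euler_left, hT.eq] with z h1 h2 h3 h4
  rw [h1, h4, add_apply, fderiv_eq_hamVec (fun z : Phase E => z.2 (W z.1)),
    hamVec_pairing (h2.differentiableAt (by simp))]
  simp [liftField, h3]

variable {φ : ℝ → E → E}

/-- The cotangent lift of the flow of `W` scales `h`. -/
theorem comp_cotangentLift (hT : IsPhaseTranslation h k W σ ε y₀) (hφ : IsFlowGerm W y₀.1 φ) :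
    ∀ᶠ q in 𝓝 ((0 : ℝ), y₀), h (cotangentLift φ q.1 q.2) = Real.exp (σ * q.1) * h q.2 := by
  have hΘ := isFlowGerm_cotangentLift hφ hT.smooth_field
  have h1 : ∀ᶠ q in 𝓝 ((0 : ℝ), y₀), ∀ _ : Unit, HasDerivAt
      (fun s => Real.exp (-(σ * s)) * h (cotangentLift φ s q.2)) 0 q.1 := by
    filter_upwards [hΘ.deriv, hΘ.tendsto.eventually hT.smooth_left,
      hΘ.tendsto.eventually hT.homothetic] with q h1 h2 h3 _
    have h4 := (h2.differentiableAt (by simp)).hasFDerivAt.comp_hasDerivAt q.1 h1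
    rw [h3] at h4
    have h5 : HasDerivAt (fun s : ℝ => -(σ * s)) (-σ) q.1 :=
      ((hasDerivAt_id q.1).const_mul σ).neg.congr_deriv (by simp)
    refine (h5.exp.mul h4).congr_deriv ?_
    simp only [Function.comp_apply]; ring
  filter_upwards [eventually_eq_of_hasDerivAt_zero
    (G := fun s y _ => Real.exp (-(σ * s)) * h (cotangentLift φ s y)) h1, hΘ.zero'] with q h2 h3
  have h4 := h2 ()
  simp only [h3, mul_zero, neg_zero, Real.exp_zero, one_mul] at h4
  rw [← h4, ← mul_assoc, ← Real.exp_add]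
  simp

/-- The cotangent lift of the flow of `W` scales the Hamiltonian vector field of `h`. -/
theorem hamVec_cotangentLift (hT : IsPhaseTranslation h k W σ ε y₀) (hφ : IsFlowGerm W y₀.1 φ) :
    ∀ᶠ q in 𝓝 ((0 : ℝ), y₀), hamVec h (cotangentLift φ q.1 q.2) =
      Real.exp (σ * q.1) • fderiv ℝ (cotangentLift φ q.1) q.2 (hamVec h q.2) := by
  have hΘ := isFlowGerm_cotangentLift hφ hT.smooth_field
  filter_upwards [(hT.comp_cotangentLift hφ).eventually_nhds,
    phaseForm_cotangentLift hφ hT.smooth_field, hΘ.tendsto.eventually hT.smooth_left,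
    (continuous_snd.tendsto ((0 : ℝ), y₀)).eventually hT.smooth_left,
    hΘ.hasFDerivAt_space] with q h1 h2 h3 h4 h5
  have hc : Tendsto (fun x : Phase E => (q.1, x)) (𝓝 q.2) (𝓝 q) :=
    (by fun_prop : Continuous fun x : Phase E => (q.1, x)).tendsto q.2
  rw [← map_smul]
  refine (eq_of_phaseForm_eq h2 fun X => ?_).symm
  have h6 := (h3.differentiableAt (by simp)).hasFDerivAt.comp q.2 h5
  have h7 := (h4.differentiableAt (by simp)).hasFDerivAt.const_mul (Real.exp (σ * q.1))
  have h8 := congrArg (fun L => L X) (h6.unique (h7.congr_of_eventuallyEq (hc.eventually h1)))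
  rw [← h5.fderiv] at h8
  rw [h2]
  have h9 := fderiv_eq_hamVec h q.2 X
  have h10 := fderiv_eq_hamVec h (cotangentLift φ q.1 q.2) (fderiv ℝ (cotangentLift φ q.1) q.2 X)
  simp at h8
  rw [h9, h10] at h8
  simp only [phaseForm]
  rw [h8]
  simp
  ring

variable {ψ₁ ψ₂ : ℝ → Phase E → Phase E}

/-- After reparametrization, the flow of `½ k²` is the flow of `½ h²` followed by the cotangent lift
`Θ` of the flow of `W`. Both sides are integral curves of `S_k = S_{H₁} + ε S_h`: as the flow of
`½ k²` has velocity `k S_k` with `k` constant, the time `s / k` gives the velocity `S_k`, and `Θ_s`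
turns `S_h` into `exp (-σ s) S_h`, which the time change `expPrimitive` compensates. -/
theorem flow_eq (hT : IsPhaseTranslation h k W σ ε y₀) (hφ : IsFlowGerm W y₀.1 φ)
    (h₁ : IsFlowGerm (hamVec fun z => (1 / 2) * h z ^ 2) y₀ ψ₁)
    (h₂ : IsFlowGerm (hamVec fun z => (1 / 2) * k z ^ 2) y₀ ψ₂) :
    ∀ᶠ q in 𝓝 ((0 : ℝ), y₀), ψ₂ (q.1 / k q.2) q.2 =
      cotangentLift φ q.1 (ψ₁ (ε * expPrimitive σ q.1 / h q.2) q.2) := by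
  have hΘ := isFlowGerm_cotangentLift hφ hT.smooth_field
  have hk := hT.smooth_right
  have hkc : ContinuousAt k y₀ := hk.self_of_nhds.continuousAt
  have hhc : ContinuousAt h y₀ := hT.smooth_left.self_of_nhds.continuousAt
  have hEc : Continuous (expPrimitive σ) :=
    continuous_iff_continuousAt.2 fun s => (hasDerivAt_expPrimitive σ s).continuousAt
  have hkc' : ContinuousAt (fun q : ℝ × Phase E => k q.2) (0, y₀) :=
    ContinuousAt.comp (f := Prod.snd) (x := ((0 : ℝ), y₀)) hkc continuousAt_snd
  have hhc' : ContinuousAt (fun q : ℝ × Phase E => h q.2) (0, y₀) :=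
    ContinuousAt.comp (f := Prod.snd) (x := ((0 : ℝ), y₀)) hhc continuousAt_snd
  have ht2 : Tendsto (fun q : ℝ × Phase E => (q.1 / k q.2, q.2)) (𝓝 (0, y₀)) (𝓝 (0, y₀)) := by
    have : ContinuousAt (fun q : ℝ × Phase E => (q.1 / k q.2, q.2)) (0, y₀) :=
      (continuousAt_fst.div hkc' hT.right_ne).prodMk continuousAt_snd
    simpa [ContinuousAt] using this
  have ht1 : Tendsto (fun q : ℝ × Phase E => (ε * expPrimitive σ q.1 / h q.2, q.2))
      (𝓝 (0, y₀)) (𝓝 (0, y₀)) := by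
    have : ContinuousAt (fun q : ℝ × Phase E => (ε * expPrimitive σ q.1 / h q.2, q.2)) (0, y₀) :=
      ((continuousAt_const.mul (hEc.continuousAt.comp continuousAt_fst)).div hhc'
        hT.left_ne).prodMk continuousAt_snd
    simpa [ContinuousAt, expPrimitive_zero] using this
  have htΘ : Tendsto (fun q : ℝ × Phase E =>
      (q.1, ψ₁ (ε * expPrimitive σ q.1 / h q.2) q.2)) (𝓝 (0, y₀)) (𝓝 (0, y₀)) := by
    rw [nhds_prod_eq] at *
    exact tendsto_fst.prodMk (by have := h₁.tendsto; rw [nhds_prod_eq] at this; exact this.comp ht1)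
  have hsnd := continuous_snd.tendsto ((0 : ℝ), y₀)
  have hk0 : ∀ᶠ y in 𝓝 y₀, k y ≠ 0 := hkc.eventually_ne hT.right_ne
  have hh0 : ∀ᶠ y in 𝓝 y₀, h y ≠ 0 := hhc.eventually_ne hT.left_ne
  refine eventually_eq_of_integralCurves (V := hamVec k) (x₀ := y₀)
    (a := fun s y => ψ₂ (s / k y) y)
    (b := fun s y => cotangentLift φ s (ψ₁ (ε * expPrimitive σ s / h y) y))
    ((contDiffAt_hamVec hk.self_of_nhds).of_le (by simp))
    (h₂.tendsto.comp ht2) (hΘ.tendsto.comp htΘ) ?_ ?_ ?_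
  · filter_upwards [ht2.eventually h₂.deriv, (h₂.tendsto.comp ht2).eventually hk,
      ht2.eventually (h₂.half_sq_invariants hk hT.euler_right), hsnd.eventually hk0]
      with q h3 h4 h5 h6
    have h7 := h3.scomp q.1 ((hasDerivAt_id q.1).div_const (k q.2))
    refine h7.congr_deriv ?_
    simp only [Function.comp_apply] at h4
    rw [hamVec_half_sq (h4.differentiableAt (by simp)), h5.1, smul_smul, one_div,
      inv_mul_cancel₀ h6, one_smul]
  · filter_upwards [ht1.eventually h₁.deriv, (h₁.tendsto.comp ht1).eventually hT.smooth_left,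
      ht1.eventually (h₁.half_sq_invariants hT.smooth_left hT.euler_left), hsnd.eventually hh0,
      htΘ.eventually hΘ.smooth, htΘ.eventually hΘ.fderiv_total,
      htΘ.eventually (hT.hamVec_cotangentLift hφ),
      (hΘ.tendsto.comp htΘ).eventually hT.hamVec_right] with q h3 h4 h5 h6 h7 h8 h9 h10
    have h11 := h3.scomp q.1 (((hasDerivAt_expPrimitive σ q.1).const_mul ε).div_const (h q.2))
    have h12 := (h7.differentiableAt (by simp)).hasFDerivAt.comp_hasDerivAt q.1
      ((hasDerivAt_id q.1).prodMk h11)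
    refine h12.congr_deriv ?_
    simp only [Function.comp_apply] at h4 h10
    rw [h8, hamVec_half_sq (h4.differentiableAt (by simp)), h5.1, smul_smul, h10, one_smul, h9,
      map_smul, smul_smul]
    congr 2
    field_simp
  · filter_upwards [h₁.zero, h₂.zero, hΘ.zero] with y h3 h4 h5
    simp only [zero_div, expPrimitive_zero, mul_zero]
    rw [h3, h4, h5]

/-- The derivative of `flow_eq` in the initial point. The times `s / k` and
`ε (expPrimitive σ s) / h` depend on that point: on `ker dk` the first one contributes nothing, the
second one contributes a multiple of `S_h`. -/
theorem fderiv_flow_eq (hT : IsPhaseTranslation h k W σ ε y₀) (hφ : IsFlowGerm W y₀.1 φ)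
    (h₁ : IsFlowGerm (hamVec fun z => (1 / 2) * h z ^ 2) y₀ ψ₁)
    (h₂ : IsFlowGerm (hamVec fun z => (1 / 2) * k z ^ 2) y₀ ψ₂) :
    ∀ᶠ s in 𝓝 (0 : ℝ), ∀ X, fderiv ℝ k y₀ X = 0 →
      fderiv ℝ (ψ₂ (s / k y₀)) y₀ X =
        fderiv ℝ (cotangentLift φ s) (ψ₁ (ε * expPrimitive σ s / h y₀) y₀)
          (fderiv ℝ (ψ₁ (ε * expPrimitive σ s / h y₀)) y₀ X -
            (ε * expPrimitive σ s / h y₀ * fderiv ℝ h y₀ X) •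
              hamVec h (ψ₁ (ε * expPrimitive σ s / h y₀) y₀)) := by
  have hΘ := isFlowGerm_cotangentLift hφ hT.smooth_field
  have hk := hT.smooth_right.self_of_nhds.differentiableAt (n := ∞) (by simp)
  have hh := hT.smooth_left.self_of_nhds.differentiableAt (n := ∞) (by simp)
  have hE0 : Tendsto (expPrimitive σ) (𝓝 0) (𝓝 0) := by
    simpa [ContinuousAt, expPrimitive_zero] using (hasDerivAt_expPrimitive σ 0).continuousAt
  have hs : Tendsto (fun s : ℝ => (s, y₀)) (𝓝 0) (𝓝 (0, y₀)) :=
    (by fun_prop : Continuous fun s : ℝ => (s, y₀)).tendsto 0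
  have hs2 : Tendsto (fun s : ℝ => (s / k y₀, y₀)) (𝓝 0) (𝓝 (0, y₀)) := by
    simpa using (by fun_prop : Continuous fun s : ℝ => (s / k y₀, y₀)).tendsto 0
  have hs1 : Tendsto (fun s : ℝ => (ε * expPrimitive σ s / h y₀, y₀)) (𝓝 0) (𝓝 (0, y₀)) := by
    have : Tendsto (fun s : ℝ => ε * expPrimitive σ s / h y₀) (𝓝 0) (𝓝 0) := by
      simpa using (hE0.const_mul ε).div_const (h y₀)
    rw [nhds_prod_eq]
    exact this.prodMk tendsto_const_nhds
  have hsΘ : Tendsto (fun s : ℝ => (s, ψ₁ (ε * expPrimitive σ s / h y₀) y₀))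
      (𝓝 0) (𝓝 (0, y₀)) := by
    have := h₁.tendsto.comp hs1
    rw [nhds_prod_eq]
    exact tendsto_id.prodMk this
  filter_upwards [hs.eventually (hT.flow_eq hφ h₁ h₂).eventually_nhds, hs2.eventually h₂.smooth,
    hs2.eventually h₂.fderiv_total, hs1.eventually h₁.smooth, hs1.eventually h₁.fderiv_total,
    hsΘ.eventually hΘ.hasFDerivAt_space, hsΘ.eventually hΘ.fderiv_eq,
    hs1.eventually (h₁.half_sq_invariants hT.smooth_left hT.euler_left),
    (h₁.tendsto.comp hs1).eventually hT.smooth_left]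
    with s h3 h4 h5 h6 h7 h8 h9 h10 h11 X hX
  have hc : Tendsto (fun x : Phase E => (s, x)) (𝓝 y₀) (𝓝 (s, y₀)) :=
    (by fun_prop : Continuous fun x : Phase E => (s, x)).tendsto y₀
  have d2 : HasFDerivAt (fun y => (s / k y, y)) _ y₀ :=
    (hasFDerivAt_const_div s hk.hasFDerivAt hT.right_ne).prodMk (hasFDerivAt_id y₀)
  have d1 : HasFDerivAt (fun y => (ε * expPrimitive σ s / h y, y)) _ y₀ :=
    (hasFDerivAt_const_div (ε * expPrimitive σ s) hh.hasFDerivAt hT.left_ne).prodMk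
      (hasFDerivAt_id y₀)
  have e2 := (h4.differentiableAt (by simp)).hasFDerivAt.comp (f := fun y => (s / k y, y)) y₀ d2
  have e1 := (h6.differentiableAt (by simp)).hasFDerivAt.comp
    (f := fun y => (ε * expPrimitive σ s / h y, y)) y₀ d1
  have e3 := HasFDerivAt.comp (f := fun y => ψ₁ (ε * expPrimitive σ s / h y) y) y₀ h8 e1
  have e4 := congrArg (fun L => L X) (e2.unique (e3.congr_of_eventuallyEq (hc.eventually h3)))
  rw [← h9] at e4
  simp only [ContinuousLinearMap.comp_apply, ContinuousLinearMap.prod_apply] at e4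
  rw [h5, h7] at e4
  simp only [Function.comp_apply] at h11
  rw [hamVec_half_sq (h11.differentiableAt (by simp)), h10.1] at e4
  simp [hX] at e4
  have e5 : ε * expPrimitive σ s / h y₀ ^ 2 * fderiv ℝ h y₀ X * h y₀ =
      ε * expPrimitive σ s / h y₀ * fderiv ℝ h y₀ X := by
    have := hT.left_ne
    field_simp
  rw [e4, map_sub, map_smul, smul_smul, e5]
  abel

/-- The Jacobi curves of `½ h²` and `½ k²` correspond to each other, in the phase space: subtracting
`(dh(X) / h) C` from `X` accounts for the term `S_h` of `fderiv_flow_eq`, since the flow of `½ h²`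
maps `C` to `C + t h S_h`. -/
theorem jacobi_iff (hT : IsPhaseTranslation h k W σ ε y₀) (hφ : IsFlowGerm W y₀.1 φ)
    (h₁ : IsFlowGerm (hamVec fun z => (1 / 2) * h z ^ 2) y₀ ψ₁)
    (h₂ : IsFlowGerm (hamVec fun z => (1 / 2) * k z ^ 2) y₀ ψ₂) :
    ∀ᶠ t in 𝓝 (0 : ℝ), ∀ X, fderiv ℝ k y₀ X = 0 →
      ((fderiv ℝ (ψ₂ (reparam σ ε (h y₀) (k y₀) t)) y₀ X).1 = 0 ↔
        (fderiv ℝ (ψ₁ t) y₀ (X - (fderiv ℝ h y₀ X / h y₀) • (0, y₀.2))).1 = 0) := by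
  have hg := tendsto_reparam σ ε (h y₀) (k y₀)
  have hg' : Tendsto (fun t => k y₀ * reparam σ ε (h y₀) (k y₀) t) (𝓝 0) (𝓝 0) := by
    simpa using hg.const_mul (k y₀)
  have hpos : ∀ᶠ t in 𝓝 (0 : ℝ), 0 < 1 + ε * σ * h y₀ * t := by
    have : ContinuousAt (fun t : ℝ => 1 + ε * σ * h y₀ * t) 0 := by fun_prop
    exact this.eventually (lt_mem_nhds (by simp))
  have hs : Tendsto (fun s : ℝ => (s, y₀)) (𝓝 0) (𝓝 (0, y₀)) :=
    (by fun_prop : Continuous fun s : ℝ => (s, y₀)).tendsto 0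
  have hsΘ : Tendsto (fun t : ℝ => (k y₀ * reparam σ ε (h y₀) (k y₀) t, ψ₁ t y₀))
      (𝓝 0) (𝓝 (0, y₀)) := by
    have := h₁.tendsto.comp hs
    rw [nhds_prod_eq]
    exact hg'.prodMk this
  filter_upwards [hpos, hg'.eventually (hT.fderiv_flow_eq hφ h₁ h₂),
    hs.eventually (h₁.half_sq_invariants hT.smooth_left hT.euler_left),
    hsΘ.eventually (fst_fderiv_cotangentLift_eq_zero hφ hT.smooth_field)] with t h3 h4 h5 h6 X hX
  have h7 := h4 X hX
  -- `reparam` is the time at which the flow of `½ h²` has run for the time `t`.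
  have h8 : ε * expPrimitive σ (k y₀ * reparam σ ε (h y₀) (k y₀) t) / h y₀ = t := by
    rw [expPrimitive_reparam hT.right_ne h3, ← mul_assoc, ← mul_assoc, hT.sq]
    field_simp [hT.left_ne]
  rw [h8, mul_div_cancel_left₀ _ hT.right_ne] at h7
  rw [h7, h6, map_sub, map_smul, h5.2.2.2]
  have h9 : fderiv ℝ h y₀ X / h y₀ * (t * h y₀) = t * fderiv ℝ h y₀ X := by
    have := hT.left_ne
    field_simp
  simp [smul_smul, h9]

end IsPhaseTranslation

end

section

variable {E : Type*} [NormedAddCommGroup E] [NormedSpace ℝ E]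
variable {M : Type*} [TopologicalSpace M] [ChartedSpace E M] [IsManifold 𝓘(ℝ, E) ∞ M]

/-! ### The canonical charts of the cotangent bundle -/

section Frame

/-- The coordinate isomorphism `T_q M → E` in the chart around `p`. -/
def frame (p q : M) : TangentSpace 𝓘(ℝ, E) q →L[ℝ] E :=
  (trivializationAt E (TangentSpace 𝓘(ℝ, E) : M → Type _) p).continuousLinearMapAt ℝ q

/-- The inverse of `frame`, where `q` lies in the domain of the chart around `p`. -/
def frameInv (p q : M) : E →L[ℝ] TangentSpace 𝓘(ℝ, E) q :=
  (trivializationAt E (TangentSpace 𝓘(ℝ, E) : M → Type _) p).symmL ℝ q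

variable {p q : M}

theorem frame_frameInv (hq : q ∈ (chartAt E p).source) (u : E) :
    frame p q (frameInv p q u) = u :=
  (trivializationAt E (TangentSpace 𝓘(ℝ, E) : M → Type _) p).continuousLinearMapAt_symmL
    (by simpa using hq) u

theorem frameInv_frame (hq : q ∈ (chartAt E p).source) (u : TangentSpace 𝓘(ℝ, E) q) :
    frameInv p q (frame p q u) = u :=
  (trivializationAt E (TangentSpace 𝓘(ℝ, E) : M → Type _) p).symmL_continuousLinearMapAt
    (by simpa using hq) u

theorem mfderiv_extChartAt_eq_frame (hq : q ∈ (chartAt E p).source)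
    (u : TangentSpace 𝓘(ℝ, E) q) :
    (mfderiv 𝓘(ℝ, E) 𝓘(ℝ, E) (extChartAt 𝓘(ℝ, E) p) q u : E) = frame p q u :=
  (congrArg (fun L => L u)
    (TangentBundle.continuousLinearMapAt_trivializationAt (I := 𝓘(ℝ, E)) hq)).symm

end Frame

section CotangentChart

theorem cotangentChart_apply (ξ η : Cotangent E M) :
    extChartAt (cotangentModel E) ξ η =
      (extChartAt 𝓘(ℝ, E) ξ.proj η.proj,
        ContinuousLinearMap.comp (η.2 : TangentSpace 𝓘(ℝ, E) η.proj →L[ℝ] ℝ)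
          (frameInv ξ.proj η.proj)) := by
  rw [FiberBundle.extChartAt]
  refine Prod.ext rfl ?_
  refine ContinuousLinearMap.ext fun u => ?_
  simp [hom_trivializationAt_apply, ContinuousLinearMap.inCoordinates, frameInv]

theorem mem_cotangentChart_source {ξ η : Cotangent E M} :
    η ∈ (extChartAt (cotangentModel E) ξ).source ↔ η.proj ∈ (chartAt E ξ.proj).source := by
  rw [FiberBundle.extChartAt]
  simp only [PartialEquiv.trans_source, mem_inter_iff, mem_preimage, PartialEquiv.prod_source]
  refine ⟨fun h => ?_, fun h => ⟨by simpa using h, ?_⟩⟩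
  · have h1 := h.2.1
    rw [extChartAt_source] at h1
    exact h1
  refine ⟨?_, mem_univ _⟩
  rw [extChartAt_source]
  exact h

theorem mem_cotangentChart_target {ξ : Cotangent E M} {y : Phase E} :
    y ∈ (extChartAt (cotangentModel E) ξ).target ↔ y.1 ∈ (extChartAt 𝓘(ℝ, E) ξ.proj).target := by
  rw [FiberBundle.extChartAt_target]
  simp
  intro h
  exact (chartAt E ξ.proj).map_target h

/-- The derivative at `η` of the canonical chart of `T*M` around `ξ`. -/
def chartDeriv (ξ η : Cotangent E M) : TCotangent η →L[ℝ] Phase E :=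
  mfderiv (cotangentModel E) 𝓘(ℝ, E × (E →L[ℝ] ℝ)) (extChartAt (cotangentModel E) ξ) η

variable {ξ η : Cotangent E M}

theorem hasMFDerivAt_cotangentChart (h : η ∈ (extChartAt (cotangentModel E) ξ).source) :
    HasMFDerivAt (cotangentModel E) 𝓘(ℝ, E × (E →L[ℝ] ℝ)) (extChartAt (cotangentModel E) ξ) η
      (chartDeriv ξ η) :=
  (mdifferentiableAt_extChartAt (by simpa using h)).hasMFDerivAt

theorem chartDeriv_bijective (h : η ∈ (extChartAt (cotangentModel E) ξ).source) :
    Function.Bijective (chartDeriv ξ η) := by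
  have := (isInvertible_mfderiv_extChartAt (I := cotangentModel E) h)
  exact this.bijective

/-- The first component of the chart of `T*M` is the chart of `M` composed with `τ`. -/
theorem fst_chartDeriv (h : η ∈ (extChartAt (cotangentModel E) ξ).source) (X : TCotangent η) :
    (chartDeriv ξ η X).1 = frame ξ.proj η.proj
      (mfderiv (cotangentModel E) 𝓘(ℝ, E) (fun η : Cotangent E M => η.proj) η X) := by
  have hq := mem_cotangentChart_source.1 h
  have h1 : HasMFDerivAt (cotangentModel E) 𝓘(ℝ, E)
      (fun η : Cotangent E M => (extChartAt (cotangentModel E) ξ η).1) η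
      ((ContinuousLinearMap.fst ℝ E (E →L[ℝ] ℝ)).comp (chartDeriv ξ η)) :=
    ((ContinuousLinearMap.fst ℝ E (E →L[ℝ] ℝ)).hasMFDerivAt).comp η
      (hasMFDerivAt_cotangentChart h)
  have hp : MDifferentiableAt (cotangentModel E) 𝓘(ℝ, E)
      (fun η : Cotangent E M => η.proj) η :=
    (contMDiff_proj (n := ∞) _ η).mdifferentiableAt (by simp)
  have h2 := (mdifferentiableAt_extChartAt (I := 𝓘(ℝ, E)) hq).hasMFDerivAt.comp η hp.hasMFDerivAt
  have h3 : (fun η : Cotangent E M => (extChartAt (cotangentModel E) ξ η).1) =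
      (extChartAt 𝓘(ℝ, E) ξ.proj) ∘ fun η : Cotangent E M => η.proj := by
    funext η; rw [cotangentChart_apply]; rfl
  rw [h3] at h1
  have h4 := congrArg (fun L => L X) (hasMFDerivAt_unique h1 h2)
  rw [← mfderiv_extChartAt_eq_frame hq]
  exact h4

/-- The canonical 1-form is `p dx` in every canonical chart. -/
theorem canonicalOneForm_eq (h : η ∈ (extChartAt (cotangentModel E) ξ).source)
    (X : TCotangent η) :
    canonicalOneForm η X = (extChartAt (cotangentModel E) ξ η).2 (chartDeriv ξ η X).1 := by
  rw [fst_chartDeriv h, cotangentChart_apply]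
  have := frameInv_frame (mem_cotangentChart_source.1 h)
    (mfderiv (cotangentModel E) 𝓘(ℝ, E) (fun η : Cotangent E M => η.proj) η X)
  change _ = η.2 (frameInv ξ.proj η.proj _)
  rw [this]
  rfl

theorem chartDeriv_symm {y : Phase E} (hy : y ∈ (extChartAt (cotangentModel E) ξ).target)
    (u : Phase E) :
    chartDeriv ξ ((extChartAt (cotangentModel E) ξ).symm y)
      (mfderiv 𝓘(ℝ, E × (E →L[ℝ] ℝ)) (cotangentModel E)
        (extChartAt (cotangentModel E) ξ).symm y u) = u := by
  have h1 := mfderiv_extChartAt_comp_mfderivWithin_extChartAt_symm (I := cotangentModel E) hy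
  rw [ModelWithCorners.range_eq_univ, mfderivWithin_univ] at h1
  exact congrArg (fun L => L u) h1

theorem canonicalOneFormInChart_eq {y : Phase E}
    (hy : y ∈ (extChartAt (cotangentModel E) ξ).target) (u : Phase E) :
    canonicalOneFormInChart ξ y u = y.2 u.1 := by
  have h1 := canonicalOneForm_eq ((extChartAt (cotangentModel E) ξ).map_target hy)
    (mfderiv 𝓘(ℝ, E × (E →L[ℝ] ℝ)) (cotangentModel E)
        (extChartAt (cotangentModel E) ξ).symm y u)
  rw [chartDeriv_symm hy, (extChartAt (cotangentModel E) ξ).right_inv hy] at h1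
  exact h1

/-- The symplectic form at `ξ` in the chart around `ξ` itself, the one in which it is defined. -/
theorem symplecticForm_self (X Y : TCotangent ξ) :
    symplecticForm ξ X Y = phaseForm (chartDeriv ξ ξ X) (chartDeriv ξ ξ Y) := by
  have ht : (extChartAt (cotangentModel E) ξ).target ∈ 𝓝 (extChartAt (cotangentModel E) ξ ξ) :=
    extChartAt_target_mem_nhds ξ
  -- In the chart the canonical 1-form is linear in the base point.
  let B : Phase E →L[ℝ] (Phase E →L[ℝ] ℝ) :=
    ((ContinuousLinearMap.compL ℝ (Phase E) E ℝ).flip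
      (ContinuousLinearMap.fst ℝ E (E →L[ℝ] ℝ))).comp
      (ContinuousLinearMap.snd ℝ E (E →L[ℝ] ℝ))
  have h1 : (fun y => ContinuousAlternatingMap.ofSubsingleton ℝ (E × (E →L[ℝ] ℝ)) ℝ (0 : Fin 1)
      (canonicalOneFormInChart ξ y)) =ᶠ[𝓝 (extChartAt (cotangentModel E) ξ ξ)]
      fun y => ContinuousAlternatingMap.ofSubsingleton ℝ (E × (E →L[ℝ] ℝ)) ℝ (0 : Fin 1) (B y) := by
    filter_upwards [ht] with y hy
    congr 1
    refine ContinuousLinearMap.ext fun u => ?_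
    exact canonicalOneFormInChart_eq hy u
  have hd : Differentiable ℝ (fun y => ContinuousAlternatingMap.ofSubsingleton ℝ
      (E × (E →L[ℝ] ℝ)) ℝ (0 : Fin 1) (B y)) :=
    ((ContinuousAlternatingMap.ofSubsingletonLIE (𝕜 := ℝ) (E := Phase E) (F := ℝ)
      (0 : Fin 1)).toContinuousLinearEquiv.toContinuousLinearMap.comp B).differentiable
  have hB : ∀ u v z, fderiv ℝ (fun y => B y u) z v = v.2 u.1 := fun u v z =>
    congrArg (fun L => L v) (B.flip u).fderiv
  rw [symplecticForm, h1.extDeriv_eq, extDeriv_apply (hd _), Fin.sum_univ_two]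
  simp only [ContinuousAlternatingMap.ofSubsingleton_apply_apply, hB]
  simp [phaseForm, Fin.removeNth]
  rfl

end CotangentChart

end

/-! ### Flows, symplectic form and Hamiltonian fields in charts -/

section

section ChartFlow

variable {V : Type*} [NormedAddCommGroup V] [NormedSpace ℝ V]
  {H : Type*} [TopologicalSpace H] {J : ModelWithCorners ℝ V H} [J.Boundaryless]
  {N : Type*} [TopologicalSpace N] [ChartedSpace H N] [IsManifold J ∞ N]

theorem contMDiffAt_extChartAt_symm {y₀ : N} {z : V} (hz : z ∈ (extChartAt J y₀).target) :
    ContMDiffAt 𝓘(ℝ, V) J ∞ (extChartAt J y₀).symm z :=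
  (contMDiffOn_extChartAt_symm y₀).contMDiffAt ((isOpen_extChartAt_target y₀).mem_nhds hz)

/-- The expression of a local flow in a chart is the germ of a flow. -/
theorem IsLocalFlow.isFlowGerm {X : (y : N) → TangentSpace J y} {D : Set N} {δ : ℝ} {U : Set N}
    {ψ : ℝ → N → N} (h : IsLocalFlow J X D δ U ψ) {y₀ : N} (hy : y₀ ∈ U) {X' : V → V}
    (hX : ∀ y ∈ (extChartAt J y₀).source, y ∈ D →
      mfderiv J 𝓘(ℝ, V) (extChartAt J y₀) y (X y) = X' (extChartAt J y₀ y)) :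
    IsFlowGerm X' (extChartAt J y₀ y₀)
      (fun t z => extChartAt J y₀ (ψ t ((extChartAt J y₀).symm z))) := by
  set e := extChartAt J y₀ with he
  have ht : ∀ᶠ q in 𝓝 ((0 : ℝ), e y₀), q.2 ∈ e.target :=
    (continuous_snd.tendsto ((0 : ℝ), e y₀)).eventually (extChartAt_target_mem_nhds y₀)
  have hI : Ioo (-δ) δ ∈ 𝓝 (0 : ℝ) := isOpen_Ioo.mem_nhds ⟨by linarith [h.pos], h.pos⟩
  have hI' : ∀ᶠ q in 𝓝 ((0 : ℝ), e y₀), q.1 ∈ Ioo (-δ) δ :=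
    (continuous_fst.tendsto ((0 : ℝ), e y₀)).eventually hI
  have hUe : ∀ᶠ z in 𝓝 (e y₀), e.symm z ∈ U := by
    have : ContinuousAt e.symm (e y₀) := continuousAt_extChartAt_symm y₀
    refine this.eventually (h.isOpen.mem_nhds ?_)
    rw [he, extChartAt_to_inv]; exact hy
  have hU : ∀ᶠ q in 𝓝 ((0 : ℝ), e y₀), e.symm q.2 ∈ U :=
    (continuous_snd.tendsto ((0 : ℝ), e y₀)).eventually hUe
  have hsm : ∀ q : ℝ × V, q.1 ∈ Ioo (-δ) δ → q.2 ∈ e.target → e.symm q.2 ∈ U →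
      ContMDiffAt 𝓘(ℝ, ℝ × V) J ∞ (fun q : ℝ × V => ψ q.1 (e.symm q.2)) q := by
    intro q h1 h2 h3
    have h4 : ContMDiffAt 𝓘(ℝ, ℝ × V) (𝓘(ℝ, ℝ).prod J) ∞
        (fun q : ℝ × V => (q.1, e.symm q.2)) q := by
      refine ContMDiffAt.prodMk contDiff_fst.contMDiff.contMDiffAt ?_
      exact ContMDiffAt.comp (g := e.symm) q (contMDiffAt_extChartAt_symm h2)
        contDiff_snd.contMDiff.contMDiffAt
    exact ContMDiffAt.comp (g := fun q : ℝ × N => ψ q.1 q.2) q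
      (h.smooth.contMDiffAt ((isOpen_Ioo.prod h.isOpen).mem_nhds ⟨h1, h3⟩)) h4
  have hsrc : ∀ᶠ q in 𝓝 ((0 : ℝ), e y₀), ψ q.1 (e.symm q.2) ∈ e.source := by
    have h1 := (hsm _ hI'.self_of_nhds ht.self_of_nhds hU.self_of_nhds).continuousAt
    refine h1.eventually ((isOpen_extChartAt_source y₀).mem_nhds ?_)
    change ψ 0 (e.symm (e y₀)) ∈ _
    rw [h.zero _ hU.self_of_nhds, he, extChartAt_to_inv]
    exact mem_extChartAt_source y₀
  refine ⟨?_, ?_, ?_⟩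
  · filter_upwards [hI', ht, hU, hsrc] with q h1 h2 h3 h4
    have h5 := ContMDiffAt.comp (g := e) (f := fun q : ℝ × V => ψ q.1 (e.symm q.2)) q
      (contMDiffAt_extChartAt' (n := ∞) (by simpa [he] using h4)) (hsm q h1 h2 h3)
    exact h5.contDiffAt
  · filter_upwards [hUe, extChartAt_target_mem_nhds (I := J) y₀] with z h1 h2
    rw [h.zero _ h1]
    exact e.right_inv h2
  · filter_upwards [hI', ht, hU, hsrc] with q h1 h2 h3 h4
    have h5 := (h.integralCurve _ h3 q.1 h1).hasMFDerivAt (isOpen_Ioo.mem_nhds h1)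
    have h6 := (mdifferentiableAt_extChartAt (I := J) (x := y₀) (y := ψ q.1 (e.symm q.2))
      (by simpa [he] using h4)).hasMFDerivAt
    have h7 : HasFDerivAt (fun s => e (ψ s (e.symm q.2)))
        ((1 : ℝ →L[ℝ] ℝ).smulRight (X' (e (ψ q.1 (e.symm q.2))))) q.1 := by
      refine (h6.comp q.1 h5).hasFDerivAt.congr_fderiv (ContinuousLinearMap.ext fun (r : ℝ) => ?_)
      refine (map_smul (mfderiv J 𝓘(ℝ, V) e (ψ q.1 (e.symm q.2))) r _).trans ?_
      exact congrArg (fun u : V => r • u) (hX _ h4 (h.mem _ h1 _ h3))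
    exact h7.hasDerivAt.congr_deriv (by simp)

end ChartFlow

variable {E : Type*} [NormedAddCommGroup E] [NormedSpace ℝ E]
variable {M : Type*} [TopologicalSpace M] [ChartedSpace E M] [IsManifold 𝓘(ℝ, E) ∞ M]

section CotangentChart

variable {ξ η : Cotangent E M}

/-- The derivative of a function on `T*M` in terms of its expression in a chart. -/
theorem mfderiv_eq_fderiv_chart {V : Type*} [NormedAddCommGroup V] [NormedSpace ℝ V]
    {K : Cotangent E M → V} (h : η ∈ (extChartAt (cotangentModel E) ξ).source)
    (hK : MDifferentiableAt (cotangentModel E) 𝓘(ℝ, V) K η) (X : TCotangent η) :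
    mfderiv (cotangentModel E) 𝓘(ℝ, V) K η X =
      fderiv ℝ (fun y => K ((extChartAt (cotangentModel E) ξ).symm y))
        (extChartAt (cotangentModel E) ξ η) (chartDeriv ξ η X) := by
  have hy := (extChartAt (cotangentModel E) ξ).map_source h
  have hl := (extChartAt (cotangentModel E) ξ).left_inv h
  have h1 : MDifferentiableAt 𝓘(ℝ, Phase E) 𝓘(ℝ, V)
      (fun y => K ((extChartAt (cotangentModel E) ξ).symm y))
      (extChartAt (cotangentModel E) ξ η) := by
    refine MDifferentiableAt.comp (g := K) _ (by rw [hl]; exact hK) ?_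
    exact (contMDiffAt_extChartAt_symm (J := cotangentModel E) hy).mdifferentiableAt (by simp)
  have h2 := h1.hasMFDerivAt.comp η (hasMFDerivAt_cotangentChart h)
  have h3 : ((fun y => K ((extChartAt (cotangentModel E) ξ).symm y)) ∘
      extChartAt (cotangentModel E) ξ) =ᶠ[𝓝 η] K := by
    filter_upwards [(isOpen_extChartAt_source (I := cotangentModel E) ξ).mem_nhds h] with ζ hζ
    simp only [Function.comp_apply]
    rw [(extChartAt (cotangentModel E) ξ).left_inv hζ]
  have h4 := (h2.congr_of_eventuallyEq h3.symm).mfderiv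
  rw [h4, mfderiv_eq_fderiv]
  rfl

theorem contDiffAt_chart {V : Type*} [NormedAddCommGroup V] [NormedSpace ℝ V]
    {K : Cotangent E M → V} {y : Phase E} (hy : y ∈ (extChartAt (cotangentModel E) ξ).target)
    (hK : ContMDiffAt (cotangentModel E) 𝓘(ℝ, V) ∞ K ((extChartAt (cotangentModel E) ξ).symm y)) :
    ContDiffAt ℝ ∞ (fun y => K ((extChartAt (cotangentModel E) ξ).symm y)) y :=
  (ContMDiffAt.comp (g := K) y hK (contMDiffAt_extChartAt_symm hy)).contDiffAt

/-- The canonical symplectic form of `T*M` is `dp ∧ dx` in every canonical chart: the change of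
charts preserves the Liouville form. -/
theorem symplecticForm_eq (h : η ∈ (extChartAt (cotangentModel E) ξ).source)
    (X Y : TCotangent η) :
    symplecticForm η X Y = phaseForm (chartDeriv ξ η X) (chartDeriv ξ η Y) := by
  have hy := (extChartAt (cotangentModel E) ξ).map_source h
  have hl := (extChartAt (cotangentModel E) ξ).left_inv h
  have hK : ∀ ζ ∈ (extChartAt (cotangentModel E) η).source,
      ContMDiffAt (cotangentModel E) 𝓘(ℝ, Phase E) ∞ (extChartAt (cotangentModel E) η) ζ :=
    fun ζ hζ => contMDiffAt_extChartAt' (by simpa using hζ)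
  have hd : ∀ ζ ∈ (extChartAt (cotangentModel E) ξ).source,
      ζ ∈ (extChartAt (cotangentModel E) η).source → ∀ Z : TCotangent ζ,
      fderiv ℝ (fun y => extChartAt (cotangentModel E) η
        ((extChartAt (cotangentModel E) ξ).symm y)) (extChartAt (cotangentModel E) ξ ζ)
        (chartDeriv ξ ζ Z) = chartDeriv η ζ Z := fun ζ h1 h2 Z =>
    (mfderiv_eq_fderiv_chart h1 ((hK ζ h2).mdifferentiableAt (by simp)) Z).symm
  have hηs : η ∈ (extChartAt (cotangentModel E) η).source := mem_extChartAt_source η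
  rw [symplecticForm_self, ← hd η h hηs X, ← hd η h hηs Y]
  refine phaseForm_fderiv (f := fun _ => 0) (contDiffAt_chart hy ?_) contDiffAt_const ?_ _ _
  · rw [hl]; exact hK η hηs
  · have hc : ContinuousAt (extChartAt (cotangentModel E) ξ).symm
        (extChartAt (cotangentModel E) ξ η) := continuousAt_extChartAt_symm' h
    have h3 : ∀ᶠ z in 𝓝 (extChartAt (cotangentModel E) ξ η),
        (extChartAt (cotangentModel E) ξ).symm z ∈ (extChartAt (cotangentModel E) η).source := by
      refine hc.eventually ((isOpen_extChartAt_source η).mem_nhds ?_)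
      rw [hl]; exact hηs
    filter_upwards [h3, (isOpen_extChartAt_target ξ).mem_nhds hy] with z h4 h5 u
    have h6 := (extChartAt (cotangentModel E) ξ).map_target h5
    obtain ⟨Z, rfl⟩ := (chartDeriv_bijective h6).2 u
    have h7 := hd _ h6 h4 Z
    rw [(extChartAt (cotangentModel E) ξ).right_inv h5] at h7
    rw [h7, ← canonicalOneForm_eq h4, canonicalOneForm_eq h6,
      (extChartAt (cotangentModel E) ξ).right_inv h5]
    simp

theorem chartDeriv_tautologicalField :
    chartDeriv ξ ξ (tautologicalField ξ) = (0, (extChartAt (cotangentModel E) ξ ξ).2) := by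
  have hs : ξ ∈ (extChartAt (cotangentModel E) ξ).source := mem_extChartAt_source ξ
  let p₀ : E →L[ℝ] ℝ := ξ.2
  let a : (E →L[ℝ] ℝ) → Phase E := fun p =>
    (extChartAt 𝓘(ℝ, E) ξ.proj ξ.proj, ContinuousLinearMap.comp p (frameInv ξ.proj ξ.proj))
  have ha : HasFDerivAt a (ContinuousLinearMap.prod 0
      ((ContinuousLinearMap.compL ℝ E E ℝ).flip (frameInv ξ.proj ξ.proj))) p₀ :=
    (hasFDerivAt_const _ _).prodMk
      (((ContinuousLinearMap.compL ℝ E E ℝ).flip (frameInv ξ.proj ξ.proj)).hasFDerivAt)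
  have h1 : ∀ p : E →L[ℝ] ℝ,
      extChartAt (cotangentModel E) ξ (⟨ξ.proj, p⟩ : Cotangent E M) = a p :=
    fun p => cotangentChart_apply ξ ⟨ξ.proj, p⟩
  have h2 : ∀ p : E →L[ℝ] ℝ, (⟨ξ.proj, p⟩ : Cotangent E M) ∈
      (extChartAt (cotangentModel E) ξ).source := fun p => by
    rw [mem_cotangentChart_source]; exact mem_chart_source E ξ.proj
  have h3 : (fun p : E →L[ℝ] ℝ => (⟨ξ.proj, p⟩ : Cotangent E M)) =
      (extChartAt (cotangentModel E) ξ).symm ∘ a := by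
    funext p
    rw [Function.comp_apply, ← h1 p, (extChartAt (cotangentModel E) ξ).left_inv (h2 p)]
  have h4 : MDifferentiableAt 𝓘(ℝ, E →L[ℝ] ℝ) (cotangentModel E)
      (fun p : E →L[ℝ] ℝ => (⟨ξ.proj, p⟩ : Cotangent E M)) p₀ := by
    rw [h3]
    refine MDifferentiableAt.comp (I' := 𝓘(ℝ, Phase E)) p₀ ?_ ha.differentiableAt.mdifferentiableAt
    refine (contMDiffAt_extChartAt_symm (J := cotangentModel E) ?_).mdifferentiableAt (by simp)
    rw [← h1]
    exact (extChartAt (cotangentModel E) ξ).map_source (h2 _)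
  have h5 := (hasMFDerivAt_cotangentChart hs).comp p₀ h4.hasMFDerivAt
  let D : (E →L[ℝ] ℝ) →L[ℝ] Phase E := (chartDeriv ξ ξ).comp
    (mfderiv 𝓘(ℝ, E →L[ℝ] ℝ) (cotangentModel E)
      (fun p : E →L[ℝ] ℝ => (⟨ξ.proj, p⟩ : Cotangent E M)) p₀)
  have h6 : HasFDerivAt a D p₀ := (h5.congr_of_eventuallyEq
    (Eventually.of_forall fun p => (h1 p).symm)).hasFDerivAt
  have h7 := congrArg (fun L : (E →L[ℝ] ℝ) →L[ℝ] Phase E => L p₀) (h6.unique ha)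
  refine Eq.trans h7 ?_
  refine Prod.ext rfl ?_
  exact (congrArg Prod.snd (cotangentChart_apply ξ ξ)).symm

variable [FiniteDimensional ℝ E]

/-- Hamiltonian vector fields in the charts. Since the field of `K` exists in the chart, the choice
in the definition of `hamiltonianField` is not void. -/
theorem chartDeriv_hamiltonianField {K : Cotangent E M → ℝ}
    (h : η ∈ (extChartAt (cotangentModel E) ξ).source)
    (hK : MDifferentiableAt (cotangentModel E) 𝓘(ℝ, ℝ) K η) :
    chartDeriv ξ η (hamiltonianField K η) =
      hamVec (fun y => K ((extChartAt (cotangentModel E) ξ).symm y))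
        (extChartAt (cotangentModel E) ξ η) := by
  set K' := fun y => K ((extChartAt (cotangentModel E) ξ).symm y)
  obtain ⟨S, hS⟩ := (chartDeriv_bijective h).2 (hamVec K' (extChartAt (cotangentModel E) ξ η))
  have h1 : ∃ S : TCotangent η, ∀ X : TCotangent η,
      mfderiv (cotangentModel E) 𝓘(ℝ, ℝ) K η X = symplecticForm η X S := by
    refine ⟨S, fun X => ?_⟩
    rw [symplecticForm_eq h, hS, mfderiv_eq_fderiv_chart h hK]
    exact fderiv_eq_hamVec _ _ _
  have h2 := Classical.epsilon_spec h1
  refine eq_phaseSharp fun X => ?_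
  obtain ⟨Z, rfl⟩ := (chartDeriv_bijective h).2 X
  rw [← mfderiv_eq_fderiv_chart h hK, ← symplecticForm_eq h]
  exact (h2 Z).symm

end CotangentChart

end

section

variable {E : Type*} [NormedAddCommGroup E] [NormedSpace ℝ E]
variable {M : Type*} [TopologicalSpace M] [ChartedSpace E M] [IsManifold 𝓘(ℝ, E) ∞ M]

/-! ### Conic metrics in the charts of the tangent bundle -/

section TangentChart

/-- The canonical chart of `TM` over the chart of `M` around `p`. -/
def tangentChart (p : M) : PartialEquiv (TangentBundle 𝓘(ℝ, E) M) (E × E) :=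
  extChartAt 𝓘(ℝ, E).tangent (⟨p, 0⟩ : TangentBundle 𝓘(ℝ, E) M)

theorem tangentChart_apply {p : M} {v : TangentBundle 𝓘(ℝ, E) M}
    (hv : v.proj ∈ (chartAt E p).source) :
    tangentChart p v = (extChartAt 𝓘(ℝ, E) p v.proj, frame p v.proj v.2) := by
  have h1 : tangentChart p v = (extChartAt 𝓘(ℝ, E) p v.proj,
      (trivializationAt E (TangentSpace 𝓘(ℝ, E) : M → Type _) p v).2) := by
    rw [tangentChart]
    erw [FiberBundle.extChartAt]
    rfl
  rw [h1, frame, Trivialization.continuousLinearMapAt_apply,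
    Trivialization.coe_linearMapAt_of_mem _ (by simpa using hv)]

theorem mem_tangentChart_source {p : M} {v : TangentBundle 𝓘(ℝ, E) M} :
    v ∈ (tangentChart p).source ↔ v.proj ∈ (chartAt E p).source := by
  rw [tangentChart, extChartAt_source]
  exact TangentBundle.mem_chart_source_iff (I := 𝓘(ℝ, E)) v ⟨p, 0⟩

theorem mem_tangentChart_target {p : M} {y : E × E} :
    y ∈ (tangentChart p).target ↔ y.1 ∈ (extChartAt 𝓘(ℝ, E) p).target := by
  rw [tangentChart]
  erw [FiberBundle.extChartAt_target]
  simp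
  intro h
  exact (chartAt E p).map_target h

theorem contMDiffAt_tangentChart {p : M} {v : TangentBundle 𝓘(ℝ, E) M}
    (hv : v.proj ∈ (chartAt E p).source) :
    ContMDiffAt 𝓘(ℝ, E).tangent 𝓘(ℝ, E × E) ∞ (tangentChart p) v := by
  refine contMDiffAt_extChartAt' ?_
  exact (TangentBundle.mem_chart_source_iff (I := 𝓘(ℝ, E)) v ⟨p, 0⟩).2 hv

theorem contMDiffAt_tangentChart_symm {p : M} {y : E × E} (hy : y ∈ (tangentChart p).target) :
    ContMDiffAt 𝓘(ℝ, E × E) 𝓘(ℝ, E).tangent ∞ (tangentChart p).symm y :=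
  contMDiffAt_extChartAt_symm hy

theorem tangentChart_symm_apply {p q : M} (hq : q ∈ (chartAt E p).source)
    (w : TangentSpace 𝓘(ℝ, E) q) :
    (tangentChart p).symm (extChartAt 𝓘(ℝ, E) p q, frame p q w) = ⟨q, w⟩ := by
  rw [← tangentChart_apply (p := p) (v := ⟨q, w⟩) hq]
  exact (tangentChart p).left_inv (mem_tangentChart_source.2 hq)

/-- The vector part of an element of `TM`, as an element of the model space `E`, which carries a
norm, unlike the tangent space. -/
def vec (v : TangentBundle 𝓘(ℝ, E) M) : E := v.2

/-- The covector part of an element of `T*M`, as a linear form on the model space `E`. -/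
def covec (η : Cotangent E M) : E →L[ℝ] ℝ := η.2

/-- `frame` as an endomorphism of the model space `E`. -/
def frameEnd (p q : M) : E →L[ℝ] E := frame p q

end TangentChart

section Finsler

/-- The part of the definition of a conic pseudo-Finsler metric that concerns smoothness, sign and
homogeneity. The class is closed under passing to the reverse. -/
structure IsConicMetric (F : ConicFunction E M) : Prop where
  isOpen_domain : IsOpen F.domain
  conic : ∀ v ∈ F.domain, ∀ c : ℝ, 0 < c →
    (⟨v.proj, c • v.2⟩ : TangentBundle 𝓘(ℝ, E) M) ∈ F.domain
  smooth : ContMDiffOn 𝓘(ℝ, E).tangent 𝓘(ℝ, ℝ) ∞ F.toFun F.domain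
  pos : ∀ v ∈ F.domain, 0 < F.toFun v
  homogeneous : ∀ v ∈ F.domain, ∀ c : ℝ, 0 < c →
    F.toFun ⟨v.proj, c • v.2⟩ = c * F.toFun v

theorem IsPseudoFinsler.isConicMetric {F : ConicFunction E M} (h : IsPseudoFinsler F) :
    IsConicMetric F :=
  ⟨h.isOpen_domain, h.conic, h.smooth, h.pos, h.homogeneous⟩

/-- The expression of `F` in the chart of `TM` over the chart around `p`. -/
def ConicFunction.inChart (F : ConicFunction E M) (p : M) (y : E × E) : ℝ :=
  F.toFun ((tangentChart p).symm y)

/-- The restriction of `F` to the tangent space at `q`. -/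
def ConicFunction.fiber (F : ConicFunction E M) (q : M) (w : E) : ℝ :=
  F.toFun (⟨q, w⟩ : TangentBundle 𝓘(ℝ, E) M)

variable {F : ConicFunction E M} {p : M} {v : TangentBundle 𝓘(ℝ, E) M}

theorem IsConicMetric.contDiffAt_inChart (hF : IsConicMetric F) (hv : v ∈ F.domain)
    (hp : v.proj ∈ (chartAt E p).source) :
    ContDiffAt ℝ ∞ (F.inChart p) (tangentChart p v) := by
  have hs := mem_tangentChart_source.2 hp
  have h1 : ContMDiffAt 𝓘(ℝ, E).tangent 𝓘(ℝ, ℝ) ∞ F.toFun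
      ((tangentChart p).symm (tangentChart p v)) := by
    rw [(tangentChart p).left_inv hs]
    exact hF.smooth.contMDiffAt (hF.isOpen_domain.mem_nhds hv)
  exact (h1.comp _ (contMDiffAt_tangentChart_symm ((tangentChart p).map_source hs))).contDiffAt

theorem inChart_tangentChart (hp : v.proj ∈ (chartAt E p).source) :
    F.inChart p (tangentChart p v) = F.toFun v := by
  rw [ConicFunction.inChart, (tangentChart p).left_inv (mem_tangentChart_source.2 hp)]

theorem fiber_eq_inChart {q : M} (hq : q ∈ (chartAt E p).source) :
    F.fiber q = fun w : E => F.inChart p (extChartAt 𝓘(ℝ, E) p q, frame p q w) := by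
  funext w
  rw [ConicFunction.inChart, ConicFunction.fiber]
  exact congrArg F.toFun (tangentChart_symm_apply hq (w : TangentSpace 𝓘(ℝ, E) q)).symm

/-- The fibre derivative of `F` in a chart. -/
theorem IsConicMetric.hasFDerivAt_fiber (hF : IsConicMetric F) (hv : v ∈ F.domain)
    (hp : v.proj ∈ (chartAt E p).source) :
    HasFDerivAt (F.fiber v.proj) ((fderiv ℝ (F.inChart p) (tangentChart p v)).comp
      ((ContinuousLinearMap.inr ℝ E E).comp (frameEnd p v.proj))) (vec v) := by
  have h1 := ((hF.contDiffAt_inChart hv hp).differentiableAt (by simp)).hasFDerivAt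
  rw [tangentChart_apply hp] at h1 ⊢
  rw [fiber_eq_inChart hp]
  have h2 : HasFDerivAt (fun w : E => (extChartAt 𝓘(ℝ, E) p v.proj,
      (frameEnd p v.proj) w))
      ((ContinuousLinearMap.inr ℝ E E).comp (frameEnd p v.proj)) (vec v) := by
    exact (hasFDerivAt_const _ _).prodMk (frameEnd p v.proj).hasFDerivAt
  exact HasFDerivAt.comp (g := F.inChart p) (vec v) h1 h2

theorem IsConicMetric.differentiableAt_fiber (hF : IsConicMetric F) (hv : v ∈ F.domain) :
    DifferentiableAt ℝ (F.fiber v.proj) (vec v) :=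
  (hF.hasFDerivAt_fiber hv (mem_chart_source E v.proj)).differentiableAt

/-- The Euler relation in a fibre. -/
theorem IsConicMetric.fderiv_fiber_self (hF : IsConicMetric F) (hv : v ∈ F.domain) :
    fderiv ℝ (F.fiber v.proj) (vec v) (vec v) = F.toFun v := by
  have h1 := (hF.differentiableAt_fiber hv).hasFDerivAt
  have h2 : HasDerivAt (fun c : ℝ => c • (vec v)) (vec v) 1 := by
    simpa using (hasDerivAt_id (1 : ℝ)).smul_const (vec v)
  have h3 : HasDerivAt (fun c : ℝ => F.fiber v.proj (c • (vec v)))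
      (fderiv ℝ (F.fiber v.proj) (vec v) (vec v)) 1 := by
    refine HasFDerivAt.comp_hasDerivAt (l := F.fiber v.proj) 1 ?_ h2
    rw [one_smul]; exact h1
  have h4 : (fun c : ℝ => F.fiber v.proj (c • (vec v))) =ᶠ[𝓝 1] fun c => c * F.toFun v := by
    filter_upwards [lt_mem_nhds (show (0 : ℝ) < 1 by norm_num)] with c hc
    exact hF.homogeneous v hv c hc
  have h5 : HasDerivAt (fun c : ℝ => c * F.toFun v) (F.toFun v) 1 := by
    simpa using (hasDerivAt_id (1 : ℝ)).mul_const (F.toFun v)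
  exact h3.unique (h5.congr_of_eventuallyEq h4)

/-- The Legendre transformation is `F DF`. -/
theorem IsConicMetric.legendre_apply (hF : IsConicMetric F) (hv : v ∈ F.domain) (u : E) :
    covec (legendre F v) u = F.toFun v * fderiv ℝ (F.fiber v.proj) (vec v) u := by
  have h1 := ((hF.differentiableAt_fiber hv).hasFDerivAt.pow 2)
  have h2 : covec (legendre F v) u =
      (1 / 2) * fderiv ℝ (fun w : E => F.fiber v.proj w ^ 2) (vec v) u := rfl
  rw [h2, h1.fderiv]
  have h3 : F.fiber v.proj (vec v) = F.toFun v := rfl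
  simp [h3]
  ring

theorem IsConicMetric.legendre_self (hF : IsConicMetric F) (hv : v ∈ F.domain) :
    covec (legendre F v) (vec v) = F.toFun v ^ 2 := by
  rw [hF.legendre_apply hv, hF.fderiv_fiber_self hv]; ring

end Finsler

end

/-! ### Legendre duals in charts -/

section

section Dual

variable {E : Type*} [NormedAddCommGroup E] [NormedSpace ℝ E]

/-- The derivative of the Legendre dual `h (x, p) = L (x, v (x, p))`, where `v` inverts the Legendre
transformation `p = L D_v L`. By homogeneity `p (v) = h²`, so the derivatives of `v` cancel. -/
theorem fderiv_dual {L : E × E → ℝ} {v : Phase E → E} {h : Phase E → ℝ} {y : Phase E}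
    (hL : DifferentiableAt ℝ L (y.1, v y)) (hv : DifferentiableAt ℝ v y)
    (hh : ∀ᶠ z in 𝓝 y, h z = L (z.1, v z)) (he : ∀ᶠ z in 𝓝 y, z.2 (v z) = h z ^ 2)
    (hleg : ∀ u, y.2 u = h y * fderiv ℝ L (y.1, v y) (0, u)) (X : Phase E) :
    h y * fderiv ℝ h y X = X.2 (v y) - h y * fderiv ℝ L (y.1, v y) (X.1, 0) := by
  have h1 : HasFDerivAt (fun z : Phase E => (z.1, v z))
      ((ContinuousLinearMap.fst ℝ E (E →L[ℝ] ℝ)).prod (fderiv ℝ v y)) y :=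
    (ContinuousLinearMap.fst ℝ E (E →L[ℝ] ℝ)).hasFDerivAt.prodMk hv.hasFDerivAt
  have h2 := HasFDerivAt.comp (f := fun z : Phase E => (z.1, v z)) y hL.hasFDerivAt h1
  have h3 := h2.congr_of_eventuallyEq hh
  have h4 := (hasFDerivAt_snd (𝕜 := ℝ) (p := y)).clm_apply hv.hasFDerivAt
  have h5 := congrArg (fun T => T X) (h4.unique ((h3.pow 2).congr_of_eventuallyEq he))
  have h6 : fderiv ℝ h y X = fderiv ℝ L (y.1, v y) (X.1, fderiv ℝ v y X) := by
    rw [h3.fderiv]; rfl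
  have h7 : fderiv ℝ L (y.1, v y) (X.1, fderiv ℝ v y X) =
      fderiv ℝ L (y.1, v y) (X.1, 0) + fderiv ℝ L (y.1, v y) (0, fderiv ℝ v y X) := by
    rw [← map_add]; simp
  have h8 := hleg (fderiv ℝ v y X)
  simp at h5
  rw [h7] at h5 h6
  rw [h6]
  linear_combination h8 - h5

end Dual

variable {E : Type*} [NormedAddCommGroup E] [NormedSpace ℝ E]
variable {M : Type*} [TopologicalSpace M] [ChartedSpace E M] [IsManifold 𝓘(ℝ, E) ∞ M]

section Finsler

variable {F : ConicFunction E M} {p : M} {v : TangentBundle 𝓘(ℝ, E) M}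

theorem IsConicMetric.legendre_inChart (hF : IsConicMetric F) (hv : v ∈ F.domain)
    (hp : v.proj ∈ (chartAt E p).source) (u : E) :
    ContinuousLinearMap.comp ((legendre F v).2 : TangentSpace 𝓘(ℝ, E) v.proj →L[ℝ] ℝ)
      (frameInv p v.proj) u = F.toFun v * fderiv ℝ (F.inChart p) (tangentChart p v) (0, u) := by
  have h1 := hF.legendre_apply hv (frameInv p v.proj u : E)
  rw [(hF.hasFDerivAt_fiber hv hp).fderiv] at h1
  exact h1.trans (congrArg
    (fun z : E => F.toFun v * fderiv ℝ (F.inChart p) (tangentChart p v) (0, z))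
    (frame_frameInv hp u))

theorem IsLegendreInverse.proj_eq {O : Set (Cotangent E M)}
    {inv : Cotangent E M → TangentBundle 𝓘(ℝ, E) M} (h : IsLegendreInverse F O inv)
    {η : Cotangent E M} (hη : η ∈ O) : (inv η).proj = η.proj :=
  congrArg TotalSpace.proj (h.legendre_inv η hη)

theorem IsLegendreInverse.contMDiffAt_dual (hF : IsConicMetric F) {O : Set (Cotangent E M)}
    {inv : Cotangent E M → TangentBundle 𝓘(ℝ, E) M} (h : IsLegendreInverse F O inv)
    {η : Cotangent E M} (hη : η ∈ O) :
    ContMDiffAt (cotangentModel E) 𝓘(ℝ, ℝ) ∞ (legendreDual F inv) η := by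
  have h1 := h.smooth.contMDiffAt (h.isOpen.mem_nhds hη)
  have h2 := hF.smooth.contMDiffAt (hF.isOpen_domain.mem_nhds (h.mem η hη))
  exact h2.comp η h1

variable {ξ : Cotangent E M} {O : Set (Cotangent E M)}
  {inv : Cotangent E M → TangentBundle 𝓘(ℝ, E) M}

/-- The vector field `W` in the chart around `p`. -/
def fieldInChart (W : (p : M) → TangentSpace 𝓘(ℝ, E) p) (p : M) (x : E) : E :=
  frame p ((extChartAt 𝓘(ℝ, E) p).symm x) (W ((extChartAt 𝓘(ℝ, E) p).symm x))

theorem fieldInChart_apply (W : (p : M) → TangentSpace 𝓘(ℝ, E) p) {p q : M}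
    (hq : q ∈ (chartAt E p).source) :
    fieldInChart W p (extChartAt 𝓘(ℝ, E) p q) = frame p q (W q) := by
  have h1 : (extChartAt 𝓘(ℝ, E) p).symm (extChartAt 𝓘(ℝ, E) p q) = q :=
    (extChartAt 𝓘(ℝ, E) p).left_inv (by simpa using hq)
  rw [fieldInChart, h1]

theorem contDiffAt_fieldInChart {W : (p : M) → TangentSpace 𝓘(ℝ, E) p}
    (hW : ContMDiff 𝓘(ℝ, E) 𝓘(ℝ, E).tangent ∞
      fun p => (⟨p, W p⟩ : TangentBundle 𝓘(ℝ, E) M)) {p : M} {x : E}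
    (hx : x ∈ (extChartAt 𝓘(ℝ, E) p).target) : ContDiffAt ℝ ∞ (fieldInChart W p) x := by
  have hs : ∀ z ∈ (extChartAt 𝓘(ℝ, E) p).target,
      (extChartAt 𝓘(ℝ, E) p).symm z ∈ (chartAt E p).source := fun z hz => by
    simpa using (extChartAt 𝓘(ℝ, E) p).map_target hz
  have h1 := (contMDiffAt_tangentChart (p := p)
    (v := ⟨_, W ((extChartAt 𝓘(ℝ, E) p).symm x)⟩) (hs x hx)).comp x
    ((hW _).comp x (contMDiffAt_extChartAt_symm hx))
  have h2 : ContDiffAt ℝ ∞ (fun z => (tangentChart p (⟨(extChartAt 𝓘(ℝ, E) p).symm z,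
    W ((extChartAt 𝓘(ℝ, E) p).symm z)⟩ : TangentBundle 𝓘(ℝ, E) M)).2) x :=
    contDiffAt_snd.comp x h1.contDiffAt
  refine h2.congr_of_eventuallyEq ?_
  filter_upwards [(isOpen_extChartAt_target p).mem_nhds hx] with z hz
  rw [tangentChart_apply (hs z hz)]
  rfl

/-- The vector part of the local inverse of the Legendre transformation, in the charts of `T*M` and
`TM` over the chart around `ξ.proj`. -/
def inverseInChart (inv : Cotangent E M → TangentBundle 𝓘(ℝ, E) M) (ξ : Cotangent E M)
    (y : Phase E) : E :=
  (tangentChart ξ.proj (inv ((extChartAt (cotangentModel E) ξ).symm y))).2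

/-- The Legendre dual in the chart around `ξ`. -/
def dualInChart (F : ConicFunction E M) (inv : Cotangent E M → TangentBundle 𝓘(ℝ, E) M)
    (ξ : Cotangent E M) (y : Phase E) : ℝ :=
  legendreDual F inv ((extChartAt (cotangentModel E) ξ).symm y)

/-- The points of the chart domain around `ξ` that represent points of `O`. -/
def chartRegion (O : Set (Cotangent E M)) (ξ : Cotangent E M) : Set (Phase E) :=
  (extChartAt (cotangentModel E) ξ).target ∩ (extChartAt (cotangentModel E) ξ).symm ⁻¹' O

theorem isOpen_chartRegion (hO : IsOpen O) : IsOpen (chartRegion O ξ) :=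
  (continuousOn_extChartAt_symm ξ).isOpen_inter_preimage (isOpen_extChartAt_target ξ) hO

theorem mem_chartRegion {η : Cotangent E M}
    (hη : η ∈ (extChartAt (cotangentModel E) ξ).source) (hO : η ∈ O) :
    extChartAt (cotangentModel E) ξ η ∈ chartRegion O ξ := by
  refine ⟨(extChartAt (cotangentModel E) ξ).map_source hη, ?_⟩
  rw [mem_preimage, (extChartAt (cotangentModel E) ξ).left_inv hη]
  exact hO

theorem contDiffAt_dualInChart (hF : IsConicMetric F) (h : IsLegendreInverse F O inv) {y : Phase E}
    (hy : y ∈ chartRegion O ξ) : ContDiffAt ℝ ∞ (dualInChart F inv ξ) y :=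
  contDiffAt_chart hy.1 (h.contMDiffAt_dual hF hy.2)

theorem IsLegendreInverse.proj_mem (h : IsLegendreInverse F O inv) {y : Phase E}
    (hy : y ∈ chartRegion O ξ) :
    (inv ((extChartAt (cotangentModel E) ξ).symm y)).proj ∈ (chartAt E ξ.proj).source := by
  rw [h.proj_eq hy.2]
  exact mem_cotangentChart_source.1 ((extChartAt (cotangentModel E) ξ).map_target hy.1)

theorem IsLegendreInverse.tangentChart_eq (h : IsLegendreInverse F O inv) {y : Phase E}
    (hy : y ∈ chartRegion O ξ) :
    tangentChart ξ.proj (inv ((extChartAt (cotangentModel E) ξ).symm y)) =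
      (y.1, inverseInChart inv ξ y) := by
  refine Prod.ext ?_ rfl
  rw [tangentChart_apply (h.proj_mem hy), h.proj_eq hy.2]
  have h1 := congrArg Prod.fst ((extChartAt (cotangentModel E) ξ).right_inv hy.1)
  rwa [cotangentChart_apply] at h1

theorem contDiffAt_inverseInChart (h : IsLegendreInverse F O inv) {y : Phase E}
    (hy : y ∈ chartRegion O ξ) : ContDiffAt ℝ ∞ (inverseInChart inv ξ) y := by
  refine contDiffAt_snd.comp y
    (contDiffAt_chart (K := fun η => tangentChart ξ.proj (inv η)) hy.1 ?_)
  exact (contMDiffAt_tangentChart (h.proj_mem hy)).comp _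
    (h.smooth.contMDiffAt (h.isOpen.mem_nhds hy.2))

theorem dualInChart_eq (h : IsLegendreInverse F O inv) {y : Phase E} (hy : y ∈ chartRegion O ξ) :
    dualInChart F inv ξ y = F.inChart ξ.proj (y.1, inverseInChart inv ξ y) := by
  rw [← h.tangentChart_eq hy, inChart_tangentChart (h.proj_mem hy)]
  rfl

theorem dualInChart_pos (hF : IsConicMetric F) (h : IsLegendreInverse F O inv) {y : Phase E}
    (hy : y ∈ chartRegion O ξ) : 0 < dualInChart F inv ξ y :=
  hF.pos _ (h.mem _ hy.2)

/-- The covector part of a point `y` of the chart, as the Legendre transform of its inverse. -/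
theorem IsLegendreInverse.snd_chart (h : IsLegendreInverse F O inv) {y : Phase E}
    (hy : y ∈ chartRegion O ξ) :
    y.2 = ContinuousLinearMap.comp
      ((legendre F (inv ((extChartAt (cotangentModel E) ξ).symm y))).2 :
        TangentSpace 𝓘(ℝ, E) (inv ((extChartAt (cotangentModel E) ξ).symm y)).proj →L[ℝ] ℝ)
      (frameInv ξ.proj (inv ((extChartAt (cotangentModel E) ξ).symm y)).proj) := by
  have h1 := congrArg Prod.snd ((extChartAt (cotangentModel E) ξ).right_inv hy.1)
  rw [← h.legendre_inv _ hy.2, cotangentChart_apply] at h1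
  exact h1.symm

/-- The Legendre transformation in the chart. -/
theorem snd_eq_fderiv_inChart (hF : IsConicMetric F) (h : IsLegendreInverse F O inv) {y : Phase E}
    (hy : y ∈ chartRegion O ξ) (u : E) :
    y.2 u = dualInChart F inv ξ y *
      fderiv ℝ (F.inChart ξ.proj) (y.1, inverseInChart inv ξ y) (0, u) := by
  have h1 := hF.legendre_inChart (h.mem _ hy.2) (h.proj_mem hy) u
  rw [← h.snd_chart hy, h.tangentChart_eq hy] at h1
  exact h1

theorem snd_inverseInChart (hF : IsConicMetric F) (h : IsLegendreInverse F O inv) {y : Phase E}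
    (hy : y ∈ chartRegion O ξ) : y.2 (inverseInChart inv ξ y) = dualInChart F inv ξ y ^ 2 := by
  have h1 := congrArg Prod.snd (h.tangentChart_eq hy)
  rw [tangentChart_apply (h.proj_mem hy)] at h1
  refine (congrArg y.2 h1).symm.trans ?_
  refine (congrArg (fun T : E →L[ℝ] ℝ => T _) (h.snd_chart hy)).trans ?_
  refine Eq.trans ?_ (hF.legendre_self (h.mem _ hy.2))
  exact congrArg (fun z => (legendre F (inv ((extChartAt (cotangentModel E) ξ).symm y))).2 z)
    (frameInv_frame (h.proj_mem hy) _)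

theorem fderiv_dualInChart (hF : IsConicMetric F) (h : IsLegendreInverse F O inv) {y : Phase E}
    (hy : y ∈ chartRegion O ξ) (X : Phase E) :
    dualInChart F inv ξ y * fderiv ℝ (dualInChart F inv ξ) y X =
      X.2 (inverseInChart inv ξ y) - dualInChart F inv ξ y *
        fderiv ℝ (F.inChart ξ.proj) (y.1, inverseInChart inv ξ y) (X.1, 0) := by
  have hn := (isOpen_chartRegion (ξ := ξ) h.isOpen).mem_nhds hy
  refine fderiv_dual ?_ ((contDiffAt_inverseInChart h hy).differentiableAt (by simp))
    (by filter_upwards [hn] with z hz using dualInChart_eq h hz)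
    (by filter_upwards [hn] with z hz using snd_inverseInChart hF h hz)
    (snd_eq_fderiv_inChart hF h hy) X
  rw [← h.tangentChart_eq hy]
  exact (hF.contDiffAt_inChart (h.mem _ hy.2) (h.proj_mem hy)).differentiableAt (by simp)

/-- The Legendre dual is homogeneous of degree one. -/
theorem euler_dualInChart (hF : IsConicMetric F) (h : IsLegendreInverse F O inv) {y : Phase E}
    (hy : y ∈ chartRegion O ξ) :
    fderiv ℝ (dualInChart F inv ξ) y (0, y.2) = dualInChart F inv ξ y := by
  have h1 := fderiv_dualInChart hF h hy (0, y.2)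
  rw [snd_inverseInChart hF h hy] at h1
  have h2 := (dualInChart_pos hF h hy).ne'
  have h3 : fderiv ℝ (F.inChart ξ.proj) (y.1, inverseInChart inv ξ y) ((0 : E), (0 : E)) = 0 :=
    map_zero _
  rw [h3] at h1
  exact mul_left_cancel₀ h2 (by linear_combination h1)

end Finsler

/-! ### Homothetic fields in charts -/

section Homothety

variable {F : ConicFunction E M} {W : (p : M) → TangentSpace 𝓘(ℝ, E) p}

/-- The local flow of `W` in the chart around `p`. -/
theorem isFlowGerm_fieldInChart {p : M} {δ : ℝ} {U : Set M} {φ : ℝ → M → M}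
    (hφ : IsLocalFlow 𝓘(ℝ, E) W univ δ U φ) (hp : p ∈ U) :
    IsFlowGerm (fieldInChart W p) (extChartAt 𝓘(ℝ, E) p p)
      (fun t x => extChartAt 𝓘(ℝ, E) p (φ t ((extChartAt 𝓘(ℝ, E) p).symm x))) := by
  refine hφ.isFlowGerm hp fun q hq _ => ?_
  have hq' : q ∈ (chartAt E p).source := by simpa using hq
  rw [fieldInChart_apply W hq']
  exact mfderiv_extChartAt_eq_frame hq' (W q)

/-- The tangent map of `f` in a chart is the derivative of `f` in that chart. -/
theorem tangentChart_tangentMap {p q : M} (hq : q ∈ (chartAt E p).source) {f : M → M}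
    (hf : MDifferentiableAt 𝓘(ℝ, E) 𝓘(ℝ, E) f q) (hfq : f q ∈ (chartAt E p).source)
    (w : TangentSpace 𝓘(ℝ, E) q) :
    tangentChart p (tangentMap 𝓘(ℝ, E) 𝓘(ℝ, E) f ⟨q, w⟩) =
      (extChartAt 𝓘(ℝ, E) p (f q),
        fderiv ℝ (fun x => extChartAt 𝓘(ℝ, E) p (f ((extChartAt 𝓘(ℝ, E) p).symm x)))
          (extChartAt 𝓘(ℝ, E) p q) (frame p q w)) := by
  have hs : q ∈ (extChartAt 𝓘(ℝ, E) p).source := by simpa using hq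
  rw [tangentChart_apply hfq]
  refine Prod.ext rfl ?_
  have h1 := (mdifferentiableAt_extChartAt (I := 𝓘(ℝ, E)) hfq).hasMFDerivAt.comp q hf.hasMFDerivAt
  have hl := (extChartAt 𝓘(ℝ, E) p).left_inv hs
  have h2 : MDifferentiableAt 𝓘(ℝ, E) 𝓘(ℝ, E)
      (fun x => extChartAt 𝓘(ℝ, E) p (f ((extChartAt 𝓘(ℝ, E) p).symm x)))
      (extChartAt 𝓘(ℝ, E) p q) := by
    refine MDifferentiableAt.comp (g := fun q => extChartAt 𝓘(ℝ, E) p (f q)) _ ?_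
      ((contMDiffAt_extChartAt_symm ((extChartAt 𝓘(ℝ, E) p).map_source hs)).mdifferentiableAt
        (by simp))
    rw [hl]
    exact h1.mdifferentiableAt
  have h3 := h2.hasMFDerivAt.comp q
    (mdifferentiableAt_extChartAt (I := 𝓘(ℝ, E)) hq).hasMFDerivAt
  have h4 : ((fun x => extChartAt 𝓘(ℝ, E) p (f ((extChartAt 𝓘(ℝ, E) p).symm x))) ∘
      extChartAt 𝓘(ℝ, E) p) =ᶠ[𝓝 q] (extChartAt 𝓘(ℝ, E) p ∘ f) := by
    filter_upwards [(isOpen_extChartAt_source (I := 𝓘(ℝ, E)) p).mem_nhds hs] with r hr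
    simp only [Function.comp_apply]
    rw [(extChartAt 𝓘(ℝ, E) p).left_inv hr]
  have h5 := hasMFDerivAt_unique h1 (h3.congr_of_eventuallyEq h4.symm)
  refine (mfderiv_extChartAt_eq_frame hfq _).symm.trans ?_
  refine (congrArg (fun L => L w) h5).trans ?_
  rw [mfderiv_eq_fderiv]
  exact congrArg (fun u => fderiv ℝ (fun x => extChartAt 𝓘(ℝ, E) p
    (f ((extChartAt 𝓘(ℝ, E) p).symm x))) (extChartAt 𝓘(ℝ, E) p q) u)
    (mfderiv_extChartAt_eq_frame hq w)

/-- The infinitesimal form of the homothety condition in a chart: the derivative of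
`F (φ_t x, Dφ_t(x) u) = exp (-σ t) F (x, u)` at `t = 0`. -/
theorem IsHomothetic.fderiv_inChart {σ : ℝ} (hσ : IsHomothetic F W σ) (hF : IsConicMetric F)
    (hW : ContMDiff 𝓘(ℝ, E) 𝓘(ℝ, E).tangent ∞
      fun p => (⟨p, W p⟩ : TangentBundle 𝓘(ℝ, E) M)) (p : M) :
    ∀ᶠ x in 𝓝 (extChartAt 𝓘(ℝ, E) p p), ∀ u : E, (tangentChart p).symm (x, u) ∈ F.domain →
      fderiv ℝ (F.inChart p) (x, u) (fieldInChart W p x, fderiv ℝ (fieldInChart W p) x u) =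
        -σ * F.inChart p (x, u) := by
  obtain ⟨δ, U, φ, hpU, hφ, hhom⟩ := hσ p
  have hg := isFlowGerm_fieldInChart hφ hpU
  set e := extChartAt 𝓘(ℝ, E) p with he
  set V := fieldInChart W p with hV
  set ψ : ℝ → E → E := fun t x => e (φ t (e.symm x)) with hψ
  have hVs : ∀ᶠ x in 𝓝 (e p), ContDiffAt ℝ ∞ V x := by
    filter_upwards [extChartAt_target_mem_nhds (I := 𝓘(ℝ, E)) p] with x hx
    exact contDiffAt_fieldInChart hW hx
  have hz : Tendsto (fun x : E => ((0 : ℝ), x)) (𝓝 (e p)) (𝓝 (0, e p)) :=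
    (Continuous.prodMk_right (0 : ℝ)).tendsto (e p)
  have hUe : ∀ᶠ x in 𝓝 (e p), e.symm x ∈ U := by
    have : ContinuousAt e.symm (e p) := continuousAt_extChartAt_symm p
    refine this.eventually (hφ.isOpen.mem_nhds ?_)
    rw [he, extChartAt_to_inv]; exact hpU
  filter_upwards [hz.eventually hg.deriv, hz.eventually (hg.hasDerivAt_fderiv hVs), hg.zero,
    hg.fderiv_zero, hUe, extChartAt_target_mem_nhds (I := 𝓘(ℝ, E)) p] with x h1 h2 h3 h4 h5 h6 u hu
  set q := e.symm x with hq
  have hqs : q ∈ (chartAt E p).source := extChartAt_source 𝓘(ℝ, E) p ▸ e.map_target h6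
  have hqx : e q = x := e.right_inv h6
  have hfw : frame p q (frameInv p q u) = u := frame_frameInv hqs u
  set w := frameInv p q u with hw
  have hy : (tangentChart p).symm (x, u) = ⟨q, w⟩ := by
    rw [← hqx, ← hfw]; exact tangentChart_symm_apply hqs w
  rw [hy] at hu
  have hyc : tangentChart p (⟨q, w⟩ : TangentBundle 𝓘(ℝ, E) M) = (x, u) := by
    rw [tangentChart_apply (p := p) (v := ⟨q, w⟩) hqs]; exact Prod.ext hqx hfw
  have hI : Ioo (-δ) δ ∈ 𝓝 (0 : ℝ) := isOpen_Ioo.mem_nhds ⟨by linarith [hφ.pos], hφ.pos⟩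
  have hφd : ∀ t ∈ Ioo (-δ) δ, ContMDiffAt 𝓘(ℝ, E) 𝓘(ℝ, E) ∞ (φ t) q := fun t ht => by
    have := hφ.smooth.contMDiffAt ((isOpen_Ioo.prod hφ.isOpen).mem_nhds
      (show ((t, q) : ℝ × M) ∈ _ from ⟨ht, h5⟩))
    exact this.comp (f := fun r : M => (t, r)) q (contMDiffAt_const.prodMk contMDiffAt_id)
  have hsrc : ∀ᶠ t in 𝓝 (0 : ℝ), φ t q ∈ (chartAt E p).source := by
    have h7 : ContinuousAt (fun t => φ t q) 0 :=
      ((hφ.integralCurve q h5 0 (mem_of_mem_nhds hI)).hasMFDerivAt hI).continuousAt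
    refine h7.eventually ((chartAt E p).open_source.mem_nhds ?_)
    change φ 0 q ∈ _
    rw [hφ.zero q h5]; exact hqs
  have key : (fun t => F.inChart p (ψ t x, fderiv ℝ (ψ t) x u)) =ᶠ[𝓝 0]
      fun t => Real.exp (-(σ * t)) * F.inChart p (x, u) := by
    filter_upwards [hI, hsrc] with t ht hts
    have h8 := tangentChart_tangentMap hqs ((hφd t ht).mdifferentiableAt (by simp)) hts w
    rw [hfw] at h8
    have h9 := (hhom t ht ⟨q, w⟩ hu h5).2
    rw [← inChart_tangentChart (p := p) (by exact hts), h8,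
      ← inChart_tangentChart (p := p) (v := ⟨q, w⟩) hqs, hyc, hqx] at h9
    exact h9
  have hFd := ((hF.contDiffAt_inChart (p := p) hu hqs).differentiableAt (by simp)).hasFDerivAt
  rw [hyc] at hFd
  have h0 : (ψ 0 x, fderiv ℝ (ψ 0) x u) = (x, u) := by
    rw [h4]; exact Prod.ext h3 rfl
  have h10 : HasDerivAt (fun t => (ψ t x, fderiv ℝ (ψ t) x u)) (V x, fderiv ℝ V x u) 0 := by
    have h11 := h1.prodMk (h2.clm_apply (hasDerivAt_const (0 : ℝ) u))
    refine h11.congr_deriv ?_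
    rw [h4, h3]
    simp
  rw [← h0] at hFd
  have h12 := hFd.comp_hasDerivAt (0 : ℝ) h10
  have h13 : HasDerivAt (fun t => Real.exp (-(σ * t)) * F.inChart p (x, u))
      (-σ * F.inChart p (x, u)) 0 := by
    have := ((((hasDerivAt_id (0 : ℝ)).const_mul σ).neg).exp).mul_const (F.inChart p (x, u))
    refine this.congr_deriv ?_
    simp
  have h14 := h12.unique (h13.congr_of_eventuallyEq key)
  rw [h0] at h14
  exact h14

/-- The Hamiltonian field of `η ↦ η(W)` scales the Legendre dual at the rate `σ`. -/
theorem homothetic_dualInChart {σ : ℝ} (hσ : IsHomothetic F W σ) (hF : IsConicMetric F)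
    (hW : ContMDiff 𝓘(ℝ, E) 𝓘(ℝ, E).tangent ∞
      fun p => (⟨p, W p⟩ : TangentBundle 𝓘(ℝ, E) M)) {O : Set (Cotangent E M)}
    {inv : Cotangent E M → TangentBundle 𝓘(ℝ, E) M} (h : IsLegendreInverse F O inv)
    {ξ : Cotangent E M} (hξ : ξ ∈ O) :
    ∀ᶠ y in 𝓝 (extChartAt (cotangentModel E) ξ ξ),
      fderiv ℝ (dualInChart F inv ξ) y (liftField (fieldInChart W ξ.proj) y) =
        σ * dualInChart F inv ξ y := by
  have hy₀ : (extChartAt (cotangentModel E) ξ ξ).1 = extChartAt 𝓘(ℝ, E) ξ.proj ξ.proj :=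
    congrArg Prod.fst (cotangentChart_apply ξ ξ)
  have h1 := hσ.fderiv_inChart hF hW ξ.proj
  rw [← hy₀] at h1
  have h2 := (continuous_fst.tendsto (extChartAt (cotangentModel E) ξ ξ)).eventually h1
  filter_upwards [h2, (isOpen_chartRegion h.isOpen).mem_nhds
    (mem_chartRegion (mem_extChartAt_source ξ) hξ)] with y h3 hy
  have hs : (tangentChart ξ.proj).symm (y.1, inverseInChart inv ξ y) =
      inv ((extChartAt (cotangentModel E) ξ).symm y) := by
    rw [← h.tangentChart_eq hy]
    exact (tangentChart ξ.proj).left_inv (mem_tangentChart_source.2 (h.proj_mem hy))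
  have h4 := h3 (inverseInChart inv ξ y) (by rw [hs]; exact h.mem _ hy.2)
  rw [← dualInChart_eq h hy] at h4
  have h5 := fderiv_dualInChart hF h hy (liftField (fieldInChart W ξ.proj) y)
  have h6 := snd_eq_fderiv_inChart hF h hy
    (fderiv ℝ (fieldInChart W ξ.proj) y.1 (inverseInChart inv ξ y))
  have h7 : ∀ a b : E, fderiv ℝ (F.inChart ξ.proj) (y.1, inverseInChart inv ξ y) (a, b) =
      fderiv ℝ (F.inChart ξ.proj) (y.1, inverseInChart inv ξ y) (a, 0) +
      fderiv ℝ (F.inChart ξ.proj) (y.1, inverseInChart inv ξ y) (0, b) := fun a b => by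
    rw [← map_add]; simp
  rw [h7] at h4
  refine mul_left_cancel₀ (dualInChart_pos hF h hy).ne' ?_
  simp only [liftField, neg_apply, ContinuousLinearMap.comp_apply] at h5 ⊢
  rw [h5, h6]
  linear_combination (-dualInChart F inv ξ y) * h4

end Homothety

end

section

variable {E : Type*} [NormedAddCommGroup E] [NormedSpace ℝ E]
variable {M : Type*} [TopologicalSpace M] [ChartedSpace E M]

/-! ### The reverse metric -/

section Reverse

variable {F : ConicFunction E M}

/-- Multiplication by `-1` in the fibres of `TM`. -/
def negVector (v : TangentBundle 𝓘(ℝ, E) M) : TangentBundle 𝓘(ℝ, E) M := ⟨v.proj, -v.2⟩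

theorem tangentMap_negVector (f : M → M) (v : TangentBundle 𝓘(ℝ, E) M) :
    tangentMap 𝓘(ℝ, E) 𝓘(ℝ, E) f (negVector v) =
      negVector (tangentMap 𝓘(ℝ, E) 𝓘(ℝ, E) f v) :=
  congrArg (fun w => (⟨f v.proj, w⟩ : TangentBundle 𝓘(ℝ, E) M))
    (map_neg (mfderiv 𝓘(ℝ, E) 𝓘(ℝ, E) f v.proj) v.2)

theorem covec_legendre_reverse (v : TangentBundle 𝓘(ℝ, E) M) :
    covec (legendre (reverse F) v) = -covec (legendre F (negVector v)) := by
  have h1 := (ContinuousLinearEquiv.neg ℝ (M := E)).comp_right_fderiv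
    (f := fun w : E => F.fiber v.proj w ^ 2) (x := vec v)
  have h2 : covec (legendre (FinslerTranslation.reverse F) v) =
      (1 / 2 : ℝ) • fderiv ℝ (fun w : E => F.fiber v.proj (-w) ^ 2) (vec v) := rfl
  have h3 : covec (legendre F (negVector v)) =
      (1 / 2 : ℝ) • fderiv ℝ (fun w : E => F.fiber v.proj w ^ 2) (-vec v) := rfl
  refine ContinuousLinearMap.ext fun u => ?_
  have h4 := congrArg (fun T : E →L[ℝ] ℝ => T u) h1
  simp [Function.comp_def] at h4
  rw [h2, h3]
  simp [h4]

theorem IsHomothetic.reverse {W : (p : M) → TangentSpace 𝓘(ℝ, E) p} {σ : ℝ}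
    (h : IsHomothetic F W σ) : IsHomothetic (reverse F) W σ := by
  intro p
  obtain ⟨δ, U, φ, hp, hφ, hh⟩ := h p
  refine ⟨δ, U, φ, hp, hφ, fun t ht v hv hvU => ?_⟩
  have h1 := hh t ht (negVector v) hv hvU
  rw [tangentMap_negVector] at h1
  exact h1

variable [IsManifold 𝓘(ℝ, E) ∞ M]

theorem contMDiff_negVector :
    ContMDiff 𝓘(ℝ, E).tangent 𝓘(ℝ, E).tangent ∞ (negVector (E := E) (M := M)) := by
  intro v
  set p := v.proj
  have hp : v.proj ∈ (chartAt E p).source := mem_chart_source E p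
  have hs : v ∈ (tangentChart p).source := mem_tangentChart_source.2 hp
  have h1 : (fun z => (tangentChart p).symm ((tangentChart p z).1, -(tangentChart p z).2)) =ᶠ[𝓝 v]
      negVector := by
    have h2 : ∀ᶠ z in 𝓝 v, z ∈ (tangentChart p).source :=
      (isOpen_extChartAt_source (I := 𝓘(ℝ, E).tangent)
        (⟨p, 0⟩ : TangentBundle 𝓘(ℝ, E) M)).mem_nhds hs
    filter_upwards [h2] with z hz
    have hz' := mem_tangentChart_source.1 hz
    rw [tangentChart_apply hz', ← map_neg, tangentChart_symm_apply hz']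
    rfl
  refine ContMDiffAt.congr_of_eventuallyEq ?_ h1.symm
  have h3 : (tangentChart p v).1 ∈ (extChartAt 𝓘(ℝ, E) p).target :=
    mem_tangentChart_target.1 ((tangentChart p).map_source hs)
  refine ContMDiffAt.comp (g := (tangentChart p).symm) v
    (contMDiffAt_tangentChart_symm (mem_tangentChart_target.2 h3)) ?_
  have h4 : ContDiff ℝ ∞ (fun y : E × E => (y.1, -y.2)) := by fun_prop
  exact h4.contMDiff.contMDiffAt.comp v (contMDiffAt_tangentChart hp)

theorem IsConicMetric.reverse (hF : IsConicMetric F) : IsConicMetric (reverse F) where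
  isOpen_domain := hF.isOpen_domain.preimage contMDiff_negVector.continuous
  conic v hv c hc := by
    have := hF.conic _ hv c hc
    simp only [smul_neg] at this
    exact this
  smooth := hF.smooth.comp contMDiff_negVector.contMDiffOn fun _ hv => hv
  pos v hv := hF.pos _ hv
  homogeneous v hv c hc := by
    have := hF.homogeneous _ hv c hc
    simp only [smul_neg] at this
    exact this

end Reverse

/-! ### Translations in the fibres -/

section Fiber

variable [IsManifold 𝓘(ℝ, E) ∞ M] {F : ConicFunction E M} {v : TangentBundle 𝓘(ℝ, E) M}

theorem IsConicMetric.eventually_mem_fiber (hF : IsConicMetric F) (hv : v ∈ F.domain) :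
    ∀ᶠ u : E in 𝓝 (vec v), (⟨v.proj, u⟩ : TangentBundle 𝓘(ℝ, E) M) ∈ F.domain := by
  have h1 : Continuous (fun u : E => (⟨v.proj, u⟩ : TangentBundle 𝓘(ℝ, E) M)) :=
    FiberBundle.continuous_totalSpaceMk E (TangentSpace 𝓘(ℝ, E) : M → Type _) v.proj
  exact h1.continuousAt.eventually (hF.isOpen_domain.mem_nhds hv)

/-- The fibre derivative of `F` is homogeneous of degree zero. -/
theorem IsConicMetric.fderiv_fiber_smul (hF : IsConicMetric F) (hv : v ∈ F.domain) {c : ℝ}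
    (hc : 0 < c) (u : E) :
    fderiv ℝ (F.fiber v.proj) (c • vec v) u = fderiv ℝ (F.fiber v.proj) (vec v) u := by
  have h1 : HasFDerivAt (fun w : E => c • w) (c • ContinuousLinearMap.id ℝ E) (vec v) :=
    (hasFDerivAt_id (vec v)).const_smul c
  have h2 : HasFDerivAt (F.fiber v.proj) (fderiv ℝ (F.fiber v.proj) (c • vec v)) (c • vec v) :=
    (hF.differentiableAt_fiber (hF.conic v hv c hc)).hasFDerivAt
  have h3 := HasFDerivAt.comp (vec v) h2 h1
  have h4 : (fun w : E => F.fiber v.proj (c • w)) =ᶠ[𝓝 (vec v)]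
      fun w => c * F.fiber v.proj w := by
    filter_upwards [hF.eventually_mem_fiber hv] with w hw
    exact hF.homogeneous _ hw c hc
  have h5 := ((hF.differentiableAt_fiber hv).hasFDerivAt.const_mul c).congr_of_eventuallyEq h4
  have h6 := congrArg (fun T : E →L[ℝ] ℝ => T u) (h3.unique h5)
  simp at h6
  exact h6.resolve_right hc.ne'

/-- `g_v(v, ·)` is the Legendre transform `F DF` of `v`. -/
theorem IsConicMetric.fundamentalTensor_self (hF : IsConicMetric F) (hv : v ∈ F.domain) (u : E) :
    fundamentalTensor F v v.2 u = F.toFun v * fderiv ℝ (F.fiber v.proj) (vec v) u := by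
  set f := F.fiber v.proj with hf
  set x : E := vec v
  have hfx : f x = F.toFun v := rfl
  set d : ℝ := fderiv ℝ f x u
  have h1 : HasDerivAt (fun s : ℝ => f (x + s • u) ^ 2) (2 * f x * d) 0 := by
    have h2 : HasDerivAt (fun s : ℝ => x + s • u) u 0 := by
      simpa using ((hasDerivAt_id (0 : ℝ)).smul_const u).const_add x
    have h3 : HasFDerivAt f (fderiv ℝ f x) (x + (0 : ℝ) • u) := by
      simpa using (hF.differentiableAt_fiber hv).hasFDerivAt
    have h4 := (h3.comp_hasDerivAt (0 : ℝ) h2).pow 2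
    refine h4.congr_deriv ?_
    simp [d]
  have h5 : (fun t : ℝ => deriv (fun s : ℝ => f (x + t • x + s • u) ^ 2) 0) =ᶠ[𝓝 0]
      fun t => (1 + t) * (2 * f x * d) := by
    filter_upwards [lt_mem_nhds (show (-1 : ℝ) < 0 by norm_num)] with t ht
    have hc : 0 < 1 + t := by linarith
    -- By homogeneity the inner derivative can be taken along `x + s u` for every `t`.
    have h6 : (fun s : ℝ => f (x + t • x + s • u) ^ 2) =ᶠ[𝓝 0]
        fun s => (1 + t) ^ 2 * f (x + (s * (1 + t)⁻¹) • u) ^ 2 := by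
      have h7 : Tendsto (fun s : ℝ => x + (s * (1 + t)⁻¹) • u) (𝓝 0) (𝓝 x) := by
        have : Continuous fun s : ℝ => x + (s * (1 + t)⁻¹) • u := by fun_prop
        simpa using this.tendsto 0
      filter_upwards [h7.eventually (hF.eventually_mem_fiber hv)] with s hs
      have h8 : f ((1 + t) • (x + (s * (1 + t)⁻¹) • u)) =
          (1 + t) * f (x + (s * (1 + t)⁻¹) • u) := hF.homogeneous _ hs _ hc
      have h9 : (1 + t) • (x + (s * (1 + t)⁻¹) • u) = x + t • x + s • u := by
        rw [smul_add, add_smul, one_smul, smul_smul]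
        congr 2
        field_simp
      rw [← h9, h8, mul_pow]
    rw [h6.deriv_eq]
    have h10 : HasDerivAt (fun s : ℝ => s * (1 + t)⁻¹) (1 + t)⁻¹ 0 := by
      simpa using (hasDerivAt_id (0 : ℝ)).mul_const (1 + t)⁻¹
    rw [← zero_mul ((1 + t)⁻¹)] at h1
    have h11 := (h1.comp (0 : ℝ) h10).const_mul ((1 + t) ^ 2)
    refine h11.deriv.trans ?_
    field_simp
  have h12 : fundamentalTensor F v v.2 u =
      (1 / 2) * deriv (fun t : ℝ => deriv (fun s : ℝ => f (x + t • x + s • u) ^ 2) 0) 0 := rfl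
  rw [h12, h5.deriv_eq]
  have h13 : HasDerivAt (fun t : ℝ => (1 + t) * (2 * f x * d)) (2 * f x * d) 0 := by
    simpa using ((hasDerivAt_id (0 : ℝ)).const_add 1).mul_const (2 * f x * d)
  rw [h13.deriv, hfx]
  ring

end Fiber

section Translation

variable [IsManifold 𝓘(ℝ, E) ∞ M] {F F' : ConicFunction E M} {W : (p : M) → TangentSpace 𝓘(ℝ, E) p}
  {v : TangentBundle 𝓘(ℝ, E) M}

/-- The fibre derivatives of `F` at `w = v / F'(v) - W` and of `F'` at `v` are proportional: this is
the fibre derivative of `F (v / F'(v) - W) = 1`. -/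
theorem IsTranslation.fderiv_fiber (h : IsTranslation F F' W) (hF : IsConicMetric F)
    (hF' : IsConicMetric F') (hv : v ∈ F'.domain) (u : E) :
    F'.toFun v ^ 2 * fderiv ℝ (F.fiber v.proj) (vec (navigationVector F' W v)) u =
      fderiv ℝ (F.fiber v.proj) (vec (navigationVector F' W v)) (vec v) *
        covec (legendre F' v) u := by
  have hk := (hF'.pos v hv).ne'
  have hf' := (hF'.differentiableAt_fiber hv).hasFDerivAt
  have hkv : F'.fiber v.proj (vec v) = F'.toFun v := rfl
  let W₀ : E := W v.proj
  have h1 : HasFDerivAt (fun x : E => (F'.fiber v.proj x)⁻¹ • x - W₀) _ (vec v) :=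
    (((hasDerivAt_inv (by rw [hkv]; exact hk)).comp_hasFDerivAt (vec v) hf').smul
      (hasFDerivAt_id (vec v))).sub_const _
  have h2 : HasFDerivAt (F.fiber v.proj) (fderiv ℝ (F.fiber v.proj)
      (vec (navigationVector F' W v))) ((F'.fiber v.proj (vec v))⁻¹ • vec v - W₀) :=
    (hF.differentiableAt_fiber (h v hv).1).hasFDerivAt
  have h3 := HasFDerivAt.comp (vec v) h2 h1
  have h4 : (fun x : E => F.fiber v.proj ((F'.fiber v.proj x)⁻¹ • x - W₀)) =ᶠ[𝓝 (vec v)]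
      fun _ => (1 : ℝ) := by
    filter_upwards [hF'.eventually_mem_fiber hv] with x hx
    exact (h _ hx).2
  have h5 := congrArg (fun T : E →L[ℝ] ℝ => T u)
    (h3.unique ((hasFDerivAt_const (1 : ℝ) (vec v)).congr_of_eventuallyEq h4))
  rw [hF'.legendre_apply hv]
  simp [hkv] at h5
  field_simp at h5 ⊢
  linear_combination h5

end Translation

end

section

variable {E : Type*} [NormedAddCommGroup E] [NormedSpace ℝ E]
variable {M : Type*} [TopologicalSpace M] [ChartedSpace E M]

/-! ### The Legendre transformation of a translated metric -/

section Navigation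

variable {F F' : ConicFunction E M} {W : (p : M) → TangentSpace 𝓘(ℝ, E) p}
  {v : TangentBundle 𝓘(ℝ, E) M}

/-- The value at `η = ℒ_{F'}(v)` of the function `F'^* - η(W)`. -/
def navigationDual (F' : ConicFunction E M) (W : (p : M) → TangentSpace 𝓘(ℝ, E) p)
    (v : TangentBundle 𝓘(ℝ, E) M) : ℝ :=
  F'.toFun v - covec (legendre F' v) (W v.proj)

/-- The multiple of `v / F'(v) - W` that has the Legendre transform `ℒ_{F'}(v)` with respect to
`F` or its reverse. -/
def navigationInverse (F' : ConicFunction E M) (W : (p : M) → TangentSpace 𝓘(ℝ, E) p)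
    (v : TangentBundle 𝓘(ℝ, E) M) : TangentBundle 𝓘(ℝ, E) M :=
  ⟨v.proj, navigationDual F' W v • (navigationVector F' W v).2⟩

theorem legendre_eq_of_covec {Fε : ConicFunction E M} {w : E}
    (h : covec (legendre Fε (⟨v.proj, w⟩ : TangentBundle 𝓘(ℝ, E) M)) = covec (legendre F' v)) :
    legendre Fε (⟨v.proj, w⟩ : TangentBundle 𝓘(ℝ, E) M) = legendre F' v :=
  congrArg (fun u : E →L[ℝ] ℝ => (⟨v.proj, u⟩ : Cotangent E M)) h

variable [IsManifold 𝓘(ℝ, E) ∞ M]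

theorem covec_navigationVector (hF' : IsConicMetric F') (hv : v ∈ F'.domain) :
    covec (legendre F' v) (vec (navigationVector F' W v)) = navigationDual F' W v := by
  let W₀ : E := W v.proj
  have h1 : covec (legendre F' v) (vec (navigationVector F' W v)) =
      covec (legendre F' v) ((F'.toFun v)⁻¹ • vec v - W₀) := rfl
  have h2 := (hF'.pos v hv).ne'
  rw [h1, map_sub, map_smul, hF'.legendre_self hv, navigationDual, smul_eq_mul]
  congr 1
  field_simp

/-- The factor of proportionality in `fderiv_fiber`, found by evaluating at `w = v / F'(v) - W`. -/
theorem IsTranslation.navigationDual_mul (h : IsTranslation F F' W) (hF : IsConicMetric F)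
    (hF' : IsConicMetric F') (hv : v ∈ F'.domain) :
    fderiv ℝ (F.fiber v.proj) (vec (navigationVector F' W v)) (vec v) * navigationDual F' W v =
      F'.toFun v ^ 2 := by
  have h1 := h.fderiv_fiber hF hF' hv (vec (navigationVector F' W v))
  have h2 : fderiv ℝ (F.fiber v.proj) (vec (navigationVector F' W v))
      (vec (navigationVector F' W v)) = F.toFun (navigationVector F' W v) :=
    hF.fderiv_fiber_self (h v hv).1
  rw [h2, (h v hv).2, covec_navigationVector hF' hv, mul_one] at h1
  exact h1.symm

theorem IsTranslation.covec_legendre (h : IsTranslation F F' W) (hF : IsConicMetric F)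
    (hF' : IsConicMetric F') (hv : v ∈ F'.domain) (u : E) :
    covec (legendre F' v) u = navigationDual F' W v *
      fderiv ℝ (F.fiber v.proj) (vec (navigationVector F' W v)) u := by
  have h1 := h.fderiv_fiber hF hF' hv u
  have h2 := h.navigationDual_mul hF hF' hv
  have h3 : fderiv ℝ (F.fiber v.proj) (vec (navigationVector F' W v)) (vec v) ≠ 0 := fun h3 => by
    rw [h3, zero_mul] at h2
    exact pow_ne_zero 2 (hF'.pos v hv).ne' h2.symm
  exact mul_left_cancel₀ h3 (by rw [← h1, ← h2]; ring)

theorem IsTranslation.fundamentalTensor_eq (h : IsTranslation F F' W) (hF : IsConicMetric F)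
    (hv : v ∈ F'.domain) :
    fundamentalTensor F (navigationVector F' W v) (navigationVector F' W v).2 v.2 =
      fderiv ℝ (F.fiber v.proj) (vec (navigationVector F' W v)) (vec v) := by
  refine (hF.fundamentalTensor_self (h v hv).1 (vec v)).trans ?_
  rw [(h v hv).2, one_mul]
  rfl

/-- A straight translation: `F'^* - η(W)` is positive and `navigationInverse` inverts `ℒ_F`. -/
theorem IsTranslation.navigationInverse_of_straight (h : IsTranslation F F' W)
    (hs : IsStraight F F' W) (hF : IsConicMetric F) (hF' : IsConicMetric F')
    (hv : v ∈ F'.domain) :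
    navigationInverse F' W v ∈ F.domain ∧
      F.toFun (navigationInverse F' W v) = navigationDual F' W v ∧
      legendre F (navigationInverse F' W v) = legendre F' v := by
  have h1 := hs v hv
  rw [h.fundamentalTensor_eq hF hv] at h1
  have h2 := h.navigationDual_mul hF hF' hv
  have hN : 0 < navigationDual F' W v := by
    refine pos_of_mul_pos_right ?_ h1.le
    rw [h2]; exact pow_pos (hF'.pos v hv) 2
  have h3 : navigationInverse F' W v ∈ F.domain := hF.conic _ (h v hv).1 _ hN
  have h4 : F.toFun (navigationInverse F' W v) = navigationDual F' W v := by
    refine (hF.homogeneous _ (h v hv).1 _ hN).trans ?_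
    rw [(h v hv).2, mul_one]
  refine ⟨h3, h4, legendre_eq_of_covec (ContinuousLinearMap.ext fun u => ?_)⟩
  refine (hF.legendre_apply h3 u).trans ?_
  rw [h4, h.covec_legendre hF hF' hv u]
  exact congrArg (fun r => navigationDual F' W v * r) (hF.fderiv_fiber_smul (h v hv).1 hN u)

/-- A reverse translation: `F'^* - η(W)` is negative and `navigationInverse` inverts the Legendre
transformation of the reverse of `F`. -/
theorem IsTranslation.navigationInverse_of_reverse (h : IsTranslation F F' W)
    (hs : IsReverse F F' W) (hF : IsConicMetric F) (hF' : IsConicMetric F')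
    (hv : v ∈ F'.domain) :
    navigationInverse F' W v ∈ (reverse F).domain ∧
      (reverse F).toFun (navigationInverse F' W v) = -navigationDual F' W v ∧
      legendre (reverse F) (navigationInverse F' W v) = legendre F' v := by
  have h1 := hs v hv
  rw [h.fundamentalTensor_eq hF hv] at h1
  have h2 := h.navigationDual_mul hF hF' hv
  have hN : 0 < -navigationDual F' W v := by
    have h3 : 0 < -fderiv ℝ (F.fiber v.proj) (vec (navigationVector F' W v)) (vec v) := by linarith
    refine pos_of_mul_pos_right (b := -navigationDual F' W v) ?_ h3.le
    rw [neg_mul_neg, h2]; exact pow_pos (hF'.pos v hv) 2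
  have h5 : negVector (navigationInverse F' W v) =
      ⟨v.proj, (-navigationDual F' W v) • (navigationVector F' W v).2⟩ :=
    congrArg (fun w => (⟨v.proj, w⟩ : TangentBundle 𝓘(ℝ, E) M)) (neg_smul _ _).symm
  have h3 : navigationInverse F' W v ∈ (reverse F).domain := by
    change negVector (navigationInverse F' W v) ∈ F.domain
    rw [h5]; exact hF.conic _ (h v hv).1 _ hN
  have h4 : (reverse F).toFun (navigationInverse F' W v) = -navigationDual F' W v := by
    change F.toFun (negVector (navigationInverse F' W v)) = _
    rw [h5]
    refine (hF.homogeneous _ (h v hv).1 _ hN).trans ?_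
    rw [(h v hv).2, mul_one]
  refine ⟨h3, h4, legendre_eq_of_covec (ContinuousLinearMap.ext fun u => ?_)⟩
  have h6 : covec (legendre F (negVector (navigationInverse F' W v))) u =
      F.toFun (negVector (navigationInverse F' W v)) *
        fderiv ℝ (F.fiber v.proj) (vec (negVector (navigationInverse F' W v))) u :=
    hF.legendre_apply h3 u
  have h7 : F.toFun (negVector (navigationInverse F' W v)) = -navigationDual F' W v := h4
  have h8 : vec (negVector (navigationInverse F' W v)) =
      (-navigationDual F' W v) • vec (navigationVector F' W v) := congrArg vec h5
  have h9 : fderiv ℝ (F.fiber v.proj)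
      ((-navigationDual F' W v) • vec (navigationVector F' W v)) u =
      fderiv ℝ (F.fiber v.proj) (vec (navigationVector F' W v)) u :=
    hF.fderiv_fiber_smul (h v hv).1 hN u
  refine (congrArg (fun T : E →L[ℝ] ℝ => T u)
    (covec_legendre_reverse (navigationInverse F' W v))).trans ?_
  rw [neg_apply, h6, h7, h8, h9, h.covec_legendre hF hF' hv u]
  ring

end Navigation

section Chart

variable [IsManifold 𝓘(ℝ, E) ∞ M] {F F' Fε : ConicFunction E M}
  {W : (p : M) → TangentSpace 𝓘(ℝ, E) p}
  {O : Set (Cotangent E M)} {inv inv' invε : Cotangent E M → TangentBundle 𝓘(ℝ, E) M}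
  {ξ : Cotangent E M}

theorem covec_legendre_eq_chart (h : IsLegendreInverse F O inv) {y : Phase E}
    (hy : y ∈ chartRegion O ξ)
    (u : TangentSpace 𝓘(ℝ, E) (inv ((extChartAt (cotangentModel E) ξ).symm y)).proj) :
    covec (legendre F (inv ((extChartAt (cotangentModel E) ξ).symm y))) u =
      y.2 (frame ξ.proj (inv ((extChartAt (cotangentModel E) ξ).symm y)).proj u) := by
  refine Eq.symm ((congrArg (fun T : E →L[ℝ] ℝ => T _) (h.snd_chart hy)).trans ?_)
  exact congrArg (fun z => (legendre F (inv ((extChartAt (cotangentModel E) ξ).symm y))).2 z)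
    (frameInv_frame (h.proj_mem hy) _)

theorem IsLegendreInverse.frame_field (h : IsLegendreInverse F O inv) {y : Phase E}
    (hy : y ∈ chartRegion O ξ) :
    frame ξ.proj (inv ((extChartAt (cotangentModel E) ξ).symm y)).proj
      (W (inv ((extChartAt (cotangentModel E) ξ).symm y)).proj) = fieldInChart W ξ.proj y.1 := by
  have h1 := congrArg Prod.fst (h.tangentChart_eq hy)
  rw [tangentChart_apply (h.proj_mem hy)] at h1
  rw [← h1, fieldInChart_apply W (h.proj_mem hy)]

theorem IsLegendreInverse.frame_inv (h : IsLegendreInverse F O inv) {y : Phase E}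
    (hy : y ∈ chartRegion O ξ) :
    frame ξ.proj (inv ((extChartAt (cotangentModel E) ξ).symm y)).proj
      (inv ((extChartAt (cotangentModel E) ξ).symm y)).2 = inverseInChart inv ξ y := by
  have h1 := congrArg Prod.snd (h.tangentChart_eq hy)
  rwa [tangentChart_apply (h.proj_mem hy)] at h1

/-- `navigationInverse` in the charts. -/
theorem tangentChart_navigationInverse (h : IsLegendreInverse F' O inv') {y : Phase E}
    (hy : y ∈ chartRegion O ξ) :
    tangentChart ξ.proj
        (navigationInverse F' W (inv' ((extChartAt (cotangentModel E) ξ).symm y))) =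
      (y.1, (dualInChart F' inv' ξ y - y.2 (fieldInChart W ξ.proj y.1)) •
        ((dualInChart F' inv' ξ y)⁻¹ • inverseInChart inv' ξ y - fieldInChart W ξ.proj y.1)) := by
  have h1 := congrArg Prod.fst (h.tangentChart_eq hy)
  rw [tangentChart_apply (h.proj_mem hy)] at h1
  have h2 : navigationDual F' W (inv' ((extChartAt (cotangentModel E) ξ).symm y)) =
      dualInChart F' inv' ξ y - y.2 (fieldInChart W ξ.proj y.1) := by
    rw [← h.frame_field hy, ← covec_legendre_eq_chart h hy]
    rfl
  rw [tangentChart_apply (v := navigationInverse F' W _) (h.proj_mem hy)]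
  refine Prod.ext h1 ?_
  refine (map_smul (frame ξ.proj (inv' ((extChartAt (cotangentModel E) ξ).symm y)).proj)
    _ _).trans ?_
  rw [h2]
  congr 1
  refine (map_sub (frame ξ.proj (inv' ((extChartAt (cotangentModel E) ξ).symm y)).proj)
    _ _).trans ?_
  rw [h.frame_field hy, map_smul, h.frame_inv hy]
  rfl

theorem contMDiffOn_navigationInverse (hF' : IsConicMetric F')
    (hW : ContMDiff 𝓘(ℝ, E) 𝓘(ℝ, E).tangent ∞
      fun p => (⟨p, W p⟩ : TangentBundle 𝓘(ℝ, E) M)) (h : IsLegendreInverse F' O inv') :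
    ContMDiffOn (cotangentModel E) 𝓘(ℝ, E).tangent ∞
      (fun η => navigationInverse F' W (inv' η)) O := by
  intro ξ hξ
  refine ContMDiffAt.contMDiffWithinAt ?_
  have hs : ξ ∈ (extChartAt (cotangentModel E) ξ).source := mem_extChartAt_source ξ
  have hy := mem_chartRegion hs hξ
  set y₀ := extChartAt (cotangentModel E) ξ ξ
  have ht := mem_cotangentChart_target.1 hy.1
  set G : Phase E → E × E := fun y =>
    (y.1, (dualInChart F' inv' ξ y - y.2 (fieldInChart W ξ.proj y.1)) •
        ((dualInChart F' inv' ξ y)⁻¹ • inverseInChart inv' ξ y - fieldInChart W ξ.proj y.1)) with hG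
  have hGs : ContDiffAt ℝ ∞ G y₀ := by
    have h1 := contDiffAt_dualInChart hF' h hy
    have h2 := contDiffAt_inverseInChart h hy
    have h3 : ContDiffAt ℝ ∞ (fun y : Phase E => fieldInChart W ξ.proj y.1) y₀ :=
      (contDiffAt_fieldInChart hW ht).comp y₀ contDiffAt_fst
    have h4 := (contDiffAt_snd (𝕜 := ℝ) (n := ∞) (p := y₀)).clm_apply h3
    exact contDiffAt_fst.prodMk ((h1.sub h4).smul
      (((h1.inv (dualInChart_pos hF' h hy).ne').smul h2).sub h3))
  have hc : ContMDiffAt (cotangentModel E) 𝓘(ℝ, Phase E) ∞ (extChartAt (cotangentModel E) ξ) ξ :=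
    contMDiffAt_extChartAt
  have h5 : ContMDiffAt (cotangentModel E) 𝓘(ℝ, E).tangent ∞
      (fun η => (tangentChart ξ.proj).symm (G (extChartAt (cotangentModel E) ξ η))) ξ := by
    refine ContMDiffAt.comp (g := (tangentChart ξ.proj).symm) ξ
      (contMDiffAt_tangentChart_symm (mem_tangentChart_target.2 ht)) ?_
    exact hGs.contMDiffAt.comp ξ hc
  refine h5.congr_of_eventuallyEq ?_
  filter_upwards [(isOpen_extChartAt_source (I := cotangentModel E) ξ).mem_nhds hs,
    h.isOpen.mem_nhds hξ] with η h6 h7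
  have h8 := mem_chartRegion h6 h7
  have h9 := tangentChart_navigationInverse (W := W) h h8
  have h10 := h.proj_mem h8
  rw [(extChartAt (cotangentModel E) ξ).left_inv h6] at h9 h10
  refine Eq.trans ?_ (congrArg (tangentChart ξ.proj).symm h9)
  exact ((tangentChart ξ.proj).left_inv
    (mem_tangentChart_source.2 (show (navigationInverse F' W (inv' η)).proj ∈ _ from h10))).symm

theorem exists_corresponding_inverse (hF : IsConicMetric F) (hF' : IsConicMetric F')
    (hW : ContMDiff 𝓘(ℝ, E) 𝓘(ℝ, E).tangent ∞
      fun p => (⟨p, W p⟩ : TangentBundle 𝓘(ℝ, E) M)) (htrans : IsTranslation F F' W) {ε : ℝ}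
    (hε : (IsStraight F F' W ∧ ε = 1 ∧ Fε = F) ∨ (IsReverse F F' W ∧ ε = -1 ∧ Fε = reverse F))
    (h : IsLegendreInverse F' O inv') (hFε : IsConicMetric Fε) :
    ∃ invε, IsLegendreInverse Fε O invε ∧ Corresponds F' Fε W ε O inv' invε := by
  have hεε : ε * ε = 1 := by rcases hε with ⟨-, rfl, -⟩ | ⟨-, rfl, -⟩ <;> norm_num
  have h1 : ∀ v ∈ F'.domain, navigationInverse F' W v ∈ Fε.domain ∧
      Fε.toFun (navigationInverse F' W v) = ε * navigationDual F' W v ∧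
      legendre Fε (navigationInverse F' W v) = legendre F' v := by
    intro v hv
    rcases hε with ⟨hs, rfl, rfl⟩ | ⟨hs, rfl, rfl⟩
    · rw [one_mul]; exact htrans.navigationInverse_of_straight hs hF hF' hv
    · rw [neg_one_mul]; exact htrans.navigationInverse_of_reverse hs hF hF' hv
  refine ⟨fun η => navigationInverse F' W (inv' η), ⟨h.isOpen, fun η hη => (h1 _ (h.mem η hη)).1,
    fun η hη => ?_, contMDiffOn_navigationInverse hF' hW h⟩, fun η hη => ?_⟩
  · rw [(h1 _ (h.mem η hη)).2.2, h.legendre_inv η hη]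
  · obtain ⟨h2, h3, -⟩ := h1 _ (h.mem η hη)
    have h4 := (hFε.pos _ h2).ne'
    rw [h3] at h4
    refine congrArg (fun w => (⟨(inv' η).proj, w⟩ : TangentBundle 𝓘(ℝ, E) M)) ?_
    change (Fε.toFun _)⁻¹ • navigationDual F' W (inv' η) •
      ((F'.toFun (inv' η))⁻¹ • (inv' η).2 - W (inv' η).proj) = _
    rw [h3, smul_smul]
    have h5 : (ε * navigationDual F' W (inv' η))⁻¹ * navigationDual F' W (inv' η) = ε := by
      have h6 := right_ne_zero_of_mul h4
      rw [inv_mul_eq_iff_eq_mul₀ h4]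
      linear_combination (-navigationDual F' W (inv' η)) * hεε
    rw [h5, smul_sub]
    refine (sub_eq_neg_add _ _).trans ?_
    rfl

/-- In the chart around `ξ`, the Legendre duals of `F_ε` and `F'` form a translation: pairing the
equation of `Corresponds` with `η` gives `F'^*(η) = η(W) + ε F_ε^*(η)`. -/
theorem isPhaseTranslation (hFε : IsConicMetric Fε) (hF' : IsConicMetric F')
    (hW : ContMDiff 𝓘(ℝ, E) 𝓘(ℝ, E).tangent ∞
      fun p => (⟨p, W p⟩ : TangentBundle 𝓘(ℝ, E) M)) {σ ε : ℝ} (hσ : IsHomothetic Fε W σ)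
    (hεε : ε * ε = 1) (h' : IsLegendreInverse F' O inv') (h : IsLegendreInverse Fε O invε)
    (hc : Corresponds F' Fε W ε O inv' invε) (hξ : ξ ∈ O) :
    IsPhaseTranslation (dualInChart Fε invε ξ) (dualInChart F' inv' ξ) (fieldInChart W ξ.proj) σ ε
      (extChartAt (cotangentModel E) ξ ξ) := by
  have hs : ξ ∈ (extChartAt (cotangentModel E) ξ).source := mem_extChartAt_source ξ
  have hy₀ := mem_chartRegion hs hξ
  have hn := (isOpen_chartRegion (ξ := ξ) h.isOpen).mem_nhds hy₀
  refine ⟨?_, ?_, ?_, homothetic_dualInChart hσ hFε hW h hξ, ?_, (dualInChart_pos hFε h hy₀).ne',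
    (dualInChart_pos hF' h' hy₀).ne', hεε⟩
  · filter_upwards [hn] with y hy using contDiffAt_dualInChart hFε h hy
  · filter_upwards [(isOpen_extChartAt_target (I := 𝓘(ℝ, E)) ξ.proj).mem_nhds
      (mem_cotangentChart_target.1 hy₀.1)] with x hx using contDiffAt_fieldInChart hW hx
  · filter_upwards [hn] with y hy using euler_dualInChart hFε h hy
  · filter_upwards [hn] with y hy
    have h1 := congrArg (fun v => (tangentChart ξ.proj v).2) (hc _ hy.2)
    rw [tangentChart_apply (by exact h.proj_mem hy), tangentChart_apply (by exact h'.proj_mem hy)]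
      at h1
    simp only [map_smul, map_add, map_neg] at h1
    rw [h.frame_inv hy, h'.frame_inv hy, h'.frame_field hy] at h1
    have h2 := congrArg y.2 h1
    simp only [map_smul, map_add, map_neg, snd_inverseInChart hFε h hy,
      snd_inverseInChart hF' h' hy, smul_eq_mul] at h2
    change (dualInChart Fε invε ξ y)⁻¹ * dualInChart Fε invε ξ y ^ 2 = _ + ε *
      ((dualInChart F' inv' ξ y)⁻¹ * dualInChart F' inv' ξ y ^ 2) at h2
    have h3 := (dualInChart_pos hFε h hy).ne'
    have h4 := (dualInChart_pos hF' h' hy).ne'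
    field_simp at h2
    linear_combination (-ε) * h2 -
      (dualInChart F' inv' ξ y - y.2 (fieldInChart W ξ.proj y.1)) * hεε

end Chart

end

/-! ### The projection between the contact planes -/

section

section Projection

variable {V : Type*} [AddCommGroup V] [Module ℝ V] {α β γ : V →ₗ[ℝ] ℝ} {C S : V}

theorem isCompl_ker_span (hαC : α C = 0) (hβS : β S = 0) (hβC : β C ≠ 0) (hαS : α S ≠ 0) :
    IsCompl (α.ker ⊓ β.ker) (Submodule.span ℝ {C, S}) := by
  refine ⟨Submodule.disjoint_def.2 fun X hX hX' => ?_,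
    codisjoint_iff.2 (eq_top_iff.2 fun X _ => ?_)⟩
  · obtain ⟨a, b, rfl⟩ := Submodule.mem_span_pair.1 hX'
    obtain ⟨h1, h2⟩ := hX
    simp [hαC, hαS] at h1
    simp [hβS, hβC] at h2
    simp [h1, h2]
  · refine Submodule.mem_sup.2 ⟨X - ((β X / β C) • C + (α X / α S) • S), ⟨?_, ?_⟩,
      (β X / β C) • C + (α X / α S) • S, Submodule.mem_span_pair.2 ⟨_, _, rfl⟩, by abel⟩
    · simp [hαC, hαS]
    · simp [hβS, hβC]

/-- On `ker α` the projection onto `ker α ∩ ker β` along `C` and `S` only involves `C`. -/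
theorem projectionOnto_of_mem_ker (hαC : α C = 0) (hβC : β C ≠ 0)
    (hc : IsCompl (α.ker ⊓ β.ker) (Submodule.span ℝ {C, S})) {X : V} (hX : α X = 0) :
    ((α.ker ⊓ β.ker).projectionOnto _ hc X : V) = X - (β X / β C) • C := by
  have h1 : X - (β X / β C) • C ∈ α.ker ⊓ β.ker :=
    ⟨by simp [hαC, hX], by simp [hβC]⟩
  have h2 : (β X / β C) • C ∈ Submodule.span ℝ {C, S} :=
    Submodule.smul_mem _ _ (Submodule.subset_span (by simp))
  have h3 : X = (X - (β X / β C) • C) + (β X / β C) • C := by abel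
  conv_lhs => rw [h3]
  rw [map_add, Submodule.projectionOnto_apply_of_mem_right hc h2, add_zero,
    Submodule.projectionOnto_apply_of_mem_left hc h1]

/-- The inverse of the projection subtracts a multiple of `C` as well. -/
theorem exists_projection_equiv (hαC : α C = 0) (hβC : β C ≠ 0) (hγC : γ C ≠ 0)
    (hc : IsCompl (α.ker ⊓ β.ker) (Submodule.span ℝ {C, S})) :
    ∃ T : (α.ker ⊓ γ.ker : Submodule ℝ V) ≃ₗ[ℝ] (α.ker ⊓ β.ker : Submodule ℝ V),
      ∀ X, T X = (α.ker ⊓ β.ker).projectionOnto _ hc (X : V) := by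
  let P := ((α.ker ⊓ β.ker).projectionOnto _ hc).comp (α.ker ⊓ γ.ker).subtype
  have hP : ∀ X : (α.ker ⊓ γ.ker : Submodule ℝ V), (P X : V) = X - (β X / β C) • C := fun X =>
    projectionOnto_of_mem_ker hαC hβC hc X.2.1
  refine ⟨LinearEquiv.ofBijective P ⟨?_, fun Y => ?_⟩, fun X => rfl⟩
  · refine (injective_iff_map_eq_zero P).2 fun X hX => ?_
    have h1 := hP X
    rw [hX, ZeroMemClass.coe_zero] at h1
    have h2 : γ (X : V) = 0 := X.2.2
    have h3 : (X : V) = (β X / β C) • C := (sub_eq_zero.1 h1.symm)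
    have h4 : β X / β C = 0 := by
      rw [h3, map_smul, smul_eq_mul] at h2
      exact (mul_eq_zero.1 h2).resolve_right hγC
    rw [h4, zero_smul] at h3
    exact Subtype.ext h3
  · have hα : α (Y : V) = 0 := Y.2.1
    have hβ : β (Y : V) = 0 := Y.2.2
    refine ⟨⟨(Y : V) - (γ Y / γ C) • C, by simp [hαC, hα], by simp [hγC]⟩, Subtype.ext ?_⟩
    rw [hP]
    have h1 : β ((Y : V) - (γ Y / γ C) • C) / β C = -(γ Y / γ C) := by
      rw [map_sub, map_smul, hβ, smul_eq_mul]; field_simp; ring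
    simp only [h1]
    simp

end Projection

variable {E : Type*} [NormedAddCommGroup E] [NormedSpace ℝ E]
variable {M : Type*} [TopologicalSpace M] [ChartedSpace E M] [IsManifold 𝓘(ℝ, E) ∞ M]

/-! ### Contact planes and Jacobi curves in charts -/

section Jacobi

variable {F : ConicFunction E M} {O : Set (Cotangent E M)}
  {inv : Cotangent E M → TangentBundle 𝓘(ℝ, E) M} {ξ η : Cotangent E M}

theorem mfderiv_legendreDual (hF : IsConicMetric F) (h : IsLegendreInverse F O inv) (hη : η ∈ O)
    (hs : η ∈ (extChartAt (cotangentModel E) ξ).source) (X : TCotangent η) :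
    mfderiv (cotangentModel E) 𝓘(ℝ, ℝ) (legendreDual F inv) η X =
      fderiv ℝ (dualInChart F inv ξ) (extChartAt (cotangentModel E) ξ η) (chartDeriv ξ η X) :=
  mfderiv_eq_fderiv_chart hs ((h.contMDiffAt_dual hF hη).mdifferentiableAt (by simp)) X

theorem mem_contactPlane_iff (hF : IsConicMetric F) (h : IsLegendreInverse F O inv) (hξ : ξ ∈ O)
    {X : TCotangent ξ} :
    X ∈ contactPlane (legendreDual F inv) ξ ↔
      (extChartAt (cotangentModel E) ξ ξ).2 (chartDeriv ξ ξ X).1 = 0 ∧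
      fderiv ℝ (dualInChart F inv ξ) (extChartAt (cotangentModel E) ξ ξ)
        (chartDeriv ξ ξ X) = 0 := by
  rw [← mfderiv_legendreDual hF h hξ (mem_extChartAt_source ξ),
    ← canonicalOneForm_eq (mem_extChartAt_source ξ)]
  rfl

theorem mem_legendrean_iff (hF : IsConicMetric F) (h : IsLegendreInverse F O inv) (hη : η ∈ O)
    (hs : η ∈ (extChartAt (cotangentModel E) ξ).source) {X : TCotangent η} :
    X ∈ legendrean (legendreDual F inv) η ↔ (chartDeriv ξ η X).1 = 0 ∧
      fderiv ℝ (dualInChart F inv ξ) (extChartAt (cotangentModel E) ξ η)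
        (chartDeriv ξ η X) = 0 := by
  rw [← mfderiv_legendreDual hF h hη hs, fst_chartDeriv hs]
  refine and_congr_left fun _ => ⟨fun h1 => ?_, fun h1 => ?_⟩
  · exact (congrArg (frame ξ.proj η.proj) h1).trans (map_zero (frame ξ.proj η.proj))
  · have h2 := congrArg (frameInv ξ.proj η.proj) h1
    rw [frameInv_frame (mem_cotangentChart_source.1 hs), map_zero] at h2
    exact h2

variable [FiniteDimensional ℝ E]

/-- The flow of the Hamiltonian `½ F^*²` in the chart. -/
theorem isFlowGerm_legendreDual (hF : IsConicMetric F) (h : IsLegendreInverse F O inv)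
    {δ : ℝ} {U : Set (Cotangent E M)} {ψ : ℝ → Cotangent E M → Cotangent E M} (hξU : ξ ∈ U)
    (hψ : IsLocalFlow (cotangentModel E)
      (hamiltonianField fun η => (1 / 2) * legendreDual F inv η ^ 2) O δ U ψ) :
    IsFlowGerm (hamVec fun z => (1 / 2) * dualInChart F inv ξ z ^ 2)
      (extChartAt (cotangentModel E) ξ ξ)
      (fun t z => extChartAt (cotangentModel E) ξ
        (ψ t ((extChartAt (cotangentModel E) ξ).symm z))) := by
  refine hψ.isFlowGerm hξU fun η hs hη => ?_
  refine chartDeriv_hamiltonianField hs ?_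
  have h1 := h.contMDiffAt_dual hF hη
  have h2 : ContMDiffAt (cotangentModel E) 𝓘(ℝ, ℝ) ∞
      (fun η => (1 / 2) * legendreDual F inv η ^ 2) η :=
    (show ContDiff ℝ ∞ (fun r : ℝ => (1 / 2) * r ^ 2) by fun_prop).contMDiff.contMDiffAt.comp η h1
  exact h2.mdifferentiableAt (by simp)

/-- Jacobi curves in the chart: `X ∈ ℓ(t)` if and only if `X` lies in the contact plane and the flow
of `½ F^*²` maps it to a vertical vector. The curve stays in the contact plane because the flow
preserves `dF^*` and, on `ker dF^*`, the canonical 1-form, which vanishes on vertical vectors. -/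
theorem IsJacobiCurve.exists_flowGerm (hF : IsConicMetric F) (h : IsLegendreInverse F O inv)
    (hξ : ξ ∈ O) {ℓ : ℝ → Submodule ℝ (TCotangent ξ)}
    (hℓ : IsJacobiCurve (legendreDual F inv) O ξ ℓ) :
    ∃ ψ, IsFlowGerm (hamVec fun z => (1 / 2) * dualInChart F inv ξ z ^ 2)
        (extChartAt (cotangentModel E) ξ ξ) ψ ∧
      ∀ᶠ t in 𝓝 (0 : ℝ), ∀ X, X ∈ ℓ t ↔
        (fderiv ℝ (ψ t) (extChartAt (cotangentModel E) ξ ξ) (chartDeriv ξ ξ X)).1 = 0 ∧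
        X ∈ contactPlane (legendreDual F inv) ξ := by
  obtain ⟨δ, U, ψ, hξU, hψ, hℓ⟩ := hℓ
  have hs : ξ ∈ (extChartAt (cotangentModel E) ξ).source := mem_extChartAt_source ξ
  have hg := isFlowGerm_legendreDual hF h hξU hψ
  refine ⟨_, hg, ?_⟩
  have hn := (isOpen_chartRegion (ξ := ξ) h.isOpen).mem_nhds (mem_chartRegion hs hξ)
  have hinv := hg.half_sq_invariants
    (by filter_upwards [hn] with y hy using contDiffAt_dualInChart hF h hy)
    (by filter_upwards [hn] with y hy using euler_dualInChart hF h hy)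
  have ht : Tendsto (fun t : ℝ => (t, extChartAt (cotangentModel E) ξ ξ)) (𝓝 0)
      (𝓝 (0, extChartAt (cotangentModel E) ξ ξ)) :=
    (Continuous.prodMk_left (extChartAt (cotangentModel E) ξ ξ)).tendsto 0
  have hI : Ioo (-δ) δ ∈ 𝓝 (0 : ℝ) := isOpen_Ioo.mem_nhds ⟨by linarith [hψ.pos], hψ.pos⟩
  have hsrc : ∀ᶠ t in 𝓝 (0 : ℝ), ψ t ξ ∈ (extChartAt (cotangentModel E) ξ).source := by
    have h7 : ContinuousAt (fun t => ψ t ξ) 0 :=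
      ((hψ.integralCurve ξ hξU 0 (mem_of_mem_nhds hI)).hasMFDerivAt hI).continuousAt
    refine h7.eventually ((isOpen_extChartAt_source ξ).mem_nhds ?_)
    change ψ 0 ξ ∈ _
    rw [hψ.zero ξ hξU]; exact hs
  filter_upwards [ht.eventually hinv, hI, hsrc] with t hinv hI hsrc X
  obtain ⟨-, hd, ha, -⟩ := hinv
  have hψd : MDifferentiableAt (cotangentModel E) (cotangentModel E) (ψ t) ξ := by
    have h1 := hψ.smooth.contMDiffAt ((isOpen_Ioo.prod hψ.isOpen).mem_nhds
      (show ((t, ξ) : ℝ × Cotangent E M) ∈ _ from ⟨hI, hξU⟩))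
    exact ContMDiffAt.mdifferentiableAt
      (h1.comp (f := fun r : Cotangent E M => (t, r)) ξ (contMDiffAt_const.prodMk contMDiffAt_id))
      (by simp)
  have h2 := (hasMFDerivAt_cotangentChart hsrc).comp ξ hψd.hasMFDerivAt
  have h3 : chartDeriv ξ (ψ t ξ) (mfderiv (cotangentModel E) (cotangentModel E) (ψ t) ξ X) =
      fderiv ℝ (fun z => extChartAt (cotangentModel E) ξ
        (ψ t ((extChartAt (cotangentModel E) ξ).symm z)))
        (extChartAt (cotangentModel E) ξ ξ) (chartDeriv ξ ξ X) := by
    have h4 := mfderiv_eq_fderiv_chart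
      (K := fun η => extChartAt (cotangentModel E) ξ (ψ t η)) hs h2.mdifferentiableAt X
    rw [← h4]
    exact (congrArg (fun L => L X) h2.mfderiv).symm
  have h5 := hd (chartDeriv ξ ξ X)
  have h6 := ha (chartDeriv ξ ξ X)
  have hl : (extChartAt (cotangentModel E) ξ).symm (extChartAt (cotangentModel E) ξ ξ) = ξ :=
    (extChartAt (cotangentModel E) ξ).left_inv hs
  simp only [hl] at h5 h6
  rw [hℓ t hI, Submodule.mem_comap]
  refine (mem_legendrean_iff hF h (hψ.mem t hI ξ hξU) hsrc).trans ?_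
  rw [mem_contactPlane_iff hF h hξ]
  change (chartDeriv ξ (ψ t ξ) (mfderiv (cotangentModel E) (cotangentModel E) (ψ t) ξ X)).1 = 0 ∧
    fderiv ℝ (dualInChart F inv ξ) (extChartAt (cotangentModel E) ξ (ψ t ξ))
      (chartDeriv ξ (ψ t ξ) (mfderiv (cotangentModel E) (cotangentModel E) (ψ t) ξ X)) = 0 ↔ _
  rw [h3, h5]
  refine and_congr_right fun h7 => ⟨fun h8 => ⟨?_, h8⟩, fun h8 => h8.2⟩
  rw [← h6 h8, h7, map_zero]

end Jacobi

/-! ### The correspondence of the Jacobi curves -/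

section Main

theorem phaseForm_sub_smul_vertical {p : E →L[ℝ] ℝ} {X Y : Phase E} (hX : p X.1 = 0)
    (hY : p Y.1 = 0) (a b : ℝ) :
    phaseForm (X - a • (0, p)) (Y - b • (0, p)) = phaseForm X Y := by
  simp [phaseForm, hX, hY]

variable {F F' : ConicFunction E M} {W : (p : M) → TangentSpace 𝓘(ℝ, E) p} {σ ε : ℝ}
  {O : Set (Cotangent E M)}
  {inv inv' : Cotangent E M → TangentBundle 𝓘(ℝ, E) M} {ξ : Cotangent E M}

theorem mfderiv_legendreDual_tautologicalField (hF : IsConicMetric F)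
    (h : IsLegendreInverse F O inv) (hξ : ξ ∈ O) :
    mfderiv (cotangentModel E) 𝓘(ℝ, ℝ) (legendreDual F inv) ξ (tautologicalField ξ) =
      legendreDual F inv ξ := by
  have hs : ξ ∈ (extChartAt (cotangentModel E) ξ).source := mem_extChartAt_source ξ
  rw [mfderiv_legendreDual hF h hξ hs, chartDeriv_tautologicalField]
  refine (euler_dualInChart hF h (mem_chartRegion hs hξ)).trans ?_
  rw [dualInChart, (extChartAt (cotangentModel E) ξ).left_inv hs]

theorem canonicalOneForm_tautologicalField : canonicalOneForm ξ (tautologicalField ξ) = 0 := by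
  rw [canonicalOneForm_eq (mem_extChartAt_source ξ), chartDeriv_tautologicalField, map_zero]

variable [FiniteDimensional ℝ E]

/-- The contact planes and the Jacobi curves of corresponding local inverses, where `F` stands for
the original metric or its reverse. -/
theorem exists_contactPlane_equiv (hF : IsConicMetric F) (hF' : IsConicMetric F')
    (hW : ContMDiff 𝓘(ℝ, E) 𝓘(ℝ, E).tangent ∞
      fun p => (⟨p, W p⟩ : TangentBundle 𝓘(ℝ, E) M)) (hσ : IsHomothetic F W σ)
    (hεε : ε * ε = 1) (h' : IsLegendreInverse F' O inv') (h : IsLegendreInverse F O inv)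
    (hc : Corresponds F' F W ε O inv' inv) (hξ : ξ ∈ O) :
    ∃ hcompl : IsCompl (contactPlane (legendreDual F inv) ξ)
          (Submodule.span ℝ {tautologicalField ξ, hamiltonianField (legendreDual F inv) ξ}),
      ∃ T : contactPlane (legendreDual F' inv') ξ ≃ₗ[ℝ] contactPlane (legendreDual F inv) ξ,
        (∀ X, T X = Submodule.projectionOnto _ _ hcompl (X : TCotangent ξ)) ∧
        (∀ X Y, symplecticForm ξ (T X : TCotangent ξ) (T Y : TCotangent ξ) =
          symplecticForm ξ (X : TCotangent ξ) (Y : TCotangent ξ)) ∧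
        ∀ ℓ₂ ℓε : ℝ → Submodule ℝ (TCotangent ξ),
          IsJacobiCurve (legendreDual F' inv') O ξ ℓ₂ →
          IsJacobiCurve (legendreDual F inv) O ξ ℓε →
          ∀ᶠ t in 𝓝 (0 : ℝ),
            ℓ₂ (reparam σ ε (legendreDual F inv ξ) (legendreDual F' inv' ξ) t) ≤
              contactPlane (legendreDual F' inv') ξ ∧
            (((ℓ₂ (reparam σ ε (legendreDual F inv ξ) (legendreDual F' inv' ξ) t)).comap
              (contactPlane (legendreDual F' inv') ξ).subtype).map T.toLinearMap).map
                (contactPlane (legendreDual F inv) ξ).subtype = ℓε t := by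
  have hs : ξ ∈ (extChartAt (cotangentModel E) ξ).source := mem_extChartAt_source ξ
  have hl : (extChartAt (cotangentModel E) ξ).symm (extChartAt (cotangentModel E) ξ ξ) = ξ :=
    (extChartAt (cotangentModel E) ξ).left_inv hs
  have hdh : dualInChart F inv ξ (extChartAt (cotangentModel E) ξ ξ) = legendreDual F inv ξ := by
    rw [dualInChart, hl]
  have hdk : dualInChart F' inv' ξ (extChartAt (cotangentModel E) ξ ξ) =
      legendreDual F' inv' ξ := by
    rw [dualInChart, hl]
  have hT := isPhaseTranslation hF hF' hW hσ hεε h' h hc hξ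
  have hh : legendreDual F inv ξ ≠ 0 := hdh ▸ hT.left_ne
  have hk : legendreDual F' inv' ξ ≠ 0 := hdk ▸ hT.right_ne
  set C := tautologicalField ξ
  set S := hamiltonianField (legendreDual F inv) ξ
  let α : TCotangent ξ →ₗ[ℝ] ℝ := (canonicalOneForm ξ).toLinearMap
  let β : TCotangent ξ →ₗ[ℝ] ℝ :=
    (mfderiv (cotangentModel E) 𝓘(ℝ, ℝ) (legendreDual F inv) ξ).toLinearMap
  let γ : TCotangent ξ →ₗ[ℝ] ℝ :=
    (mfderiv (cotangentModel E) 𝓘(ℝ, ℝ) (legendreDual F' inv') ξ).toLinearMap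
  have hβC' : β C = legendreDual F inv ξ := mfderiv_legendreDual_tautologicalField hF h hξ
  have hβC : β C ≠ 0 := by rw [hβC']; exact hh
  have hγC : γ C ≠ 0 := by
    rw [show γ C = legendreDual F' inv' ξ from mfderiv_legendreDual_tautologicalField hF' h' hξ]
    exact hk
  have hαC : α C = 0 := canonicalOneForm_tautologicalField
  have hLS : chartDeriv ξ ξ S = hamVec (dualInChart F inv ξ) (extChartAt (cotangentModel E) ξ ξ) :=
    chartDeriv_hamiltonianField hs ((h.contMDiffAt_dual hF hξ).mdifferentiableAt (by simp))
  have hβS : β S = 0 := by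
    refine (mfderiv_legendreDual hF h hξ hs S).trans ?_
    rw [hLS]; exact fderiv_hamVec_self _ _
  have hαS : α S ≠ 0 := by
    have h1 : α S = legendreDual F inv ξ := by
      refine (canonicalOneForm_eq hs S).trans ?_
      rw [hLS, ← hdh, ← euler_dualInChart hF h (mem_chartRegion hs hξ), fderiv_eq_hamVec]
      simp
    rw [h1]; exact hh
  have hcompl : IsCompl (contactPlane (legendreDual F inv) ξ) (Submodule.span ℝ {C, S}) :=
    isCompl_ker_span hαC hβS hβC hαS
  obtain ⟨T, hTX⟩ : ∃ T : contactPlane (legendreDual F' inv') ξ ≃ₗ[ℝ]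
      contactPlane (legendreDual F inv) ξ,
      ∀ X, T X = Submodule.projectionOnto _ _ hcompl (X : TCotangent ξ) :=
    exists_projection_equiv (γ := γ) hαC hβC hγC hcompl
  have hTv : ∀ X : contactPlane (legendreDual F' inv') ξ, (T X : TCotangent ξ) =
      X - (β X / β C) • C := fun X =>
    (congrArg Subtype.val (hTX X)).trans (projectionOnto_of_mem_ker hαC hβC hcompl X.2.1)
  refine ⟨hcompl, T, hTX, fun X Y => ?_, fun ℓ₂ ℓε hℓ₂ hℓε => ?_⟩
  · have hX : (extChartAt (cotangentModel E) ξ ξ).2 (chartDeriv ξ ξ X).1 = 0 :=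
      ((mem_contactPlane_iff hF' h' hξ).1 X.2).1
    have hY : (extChartAt (cotangentModel E) ξ ξ).2 (chartDeriv ξ ξ Y).1 = 0 :=
      ((mem_contactPlane_iff hF' h' hξ).1 Y.2).1
    rw [hTv, hTv, symplecticForm_self, symplecticForm_self, map_sub, map_sub, map_smul, map_smul,
      chartDeriv_tautologicalField]
    exact phaseForm_sub_smul_vertical hX hY _ _
  · obtain ⟨ψ₂, hψ₂, h₂⟩ := hℓ₂.exists_flowGerm hF' h' hξ
    obtain ⟨ψ₁, hψ₁, h₁⟩ := hℓε.exists_flowGerm hF h hξ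
    obtain ⟨δ, U, φ, hU, hφ, -⟩ := hσ ξ.proj
    have hφ' := isFlowGerm_fieldInChart hφ hU
    rw [← show (extChartAt (cotangentModel E) ξ ξ).1 = extChartAt 𝓘(ℝ, E) ξ.proj ξ.proj from
      congrArg Prod.fst (cotangentChart_apply ξ ξ)] at hφ'
    have hj := hT.jacobi_iff hφ' hψ₁ hψ₂
    rw [hdh, hdk] at hj
    filter_upwards [hj, h₁, (tendsto_reparam σ ε (legendreDual F inv ξ)
      (legendreDual F' inv' ξ)).eventually h₂] with t hj h₁ h₂
    have key : ∀ X : contactPlane (legendreDual F' inv') ξ,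
        (X : TCotangent ξ) ∈ ℓ₂ (reparam σ ε (legendreDual F inv ξ) (legendreDual F' inv' ξ) t) ↔
          (T X : TCotangent ξ) ∈ ℓε t := fun X => by
      have h3 := hj (chartDeriv ξ ξ X) ((mem_contactPlane_iff hF' h' hξ).1 X.2).2
      rw [h₁, h₂, hTv, map_sub, map_smul, chartDeriv_tautologicalField]
      rw [← mfderiv_legendreDual hF h hξ hs] at h3
      rw [hβC']
      refine (and_iff_left X.2).trans (h3.trans (and_iff_left ?_).symm)
      have h4 := (T X).2
      rw [hTv, hβC'] at h4
      exact h4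
    refine ⟨fun X hX => ((h₂ X).1 hX).2, Submodule.ext fun Y => ?_⟩
    simp only [Submodule.mem_map, Submodule.mem_comap, Submodule.subtype_apply]
    constructor
    · rintro ⟨_, ⟨X, hX, rfl⟩, rfl⟩
      exact (key X).1 hX
    · intro hY
      have hY' := ((h₁ Y).1 hY).2
      refine ⟨⟨Y, hY'⟩, ⟨T.symm ⟨Y, hY'⟩, (key _).2 ?_, T.apply_symm_apply _⟩, rfl⟩
      rw [T.apply_symm_apply]; exact hY

end Main

end

end FinslerTranslation

end

open FinslerTranslation in
theorem mainTheorem4 {E : Type*} [NormedAddCommGroup E] [NormedSpace ℝ E] [FiniteDimensional ℝ E]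
    {M : Type*} [TopologicalSpace M] [T2Space M] [ChartedSpace E M] [IsManifold 𝓘(ℝ, E) ∞ M]
    (F F' : ConicFunction E M) (hF : IsPseudoFinsler F) (hF' : IsPseudoFinsler F')
    (W : (p : M) → TangentSpace 𝓘(ℝ, E) p)
    (hW : ContMDiff 𝓘(ℝ, E) 𝓘(ℝ, E).tangent ∞ fun p => (⟨p, W p⟩ : TangentBundle 𝓘(ℝ, E) M))
    (σ : ℝ) (hσ : IsHomothetic F W σ)
    (htrans : IsTranslation F F' W)
    (ε : ℝ) (Fε : ConicFunction E M)
    (hε : (IsStraight F F' W ∧ ε = 1 ∧ Fε = F) ∨ (IsReverse F F' W ∧ ε = -1 ∧ Fε = reverse F))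
    (O : Set (Cotangent E M)) (inv' : Cotangent E M → TangentBundle 𝓘(ℝ, E) M)
    (hinv' : IsLegendreInverse F' O inv') (ξ : Cotangent E M) (hξ : ξ ∈ O) :
    (∃ invε, IsLegendreInverse Fε O invε ∧ Corresponds F' Fε W ε O inv' invε) ∧
    ∀ invε, IsLegendreInverse Fε O invε → Corresponds F' Fε W ε O inv' invε →
      ∃ hcompl : IsCompl (contactPlane (legendreDual Fε invε) ξ)
          (Submodule.span ℝ {tautologicalField ξ, hamiltonianField (legendreDual Fε invε) ξ}),
      ∃ T : contactPlane (legendreDual F' inv') ξ ≃ₗ[ℝ] contactPlane (legendreDual Fε invε) ξ,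
        (∀ X, T X = Submodule.projectionOnto _ _ hcompl (X : TCotangent ξ)) ∧
        (∀ X Y, symplecticForm ξ (T X : TCotangent ξ) (T Y : TCotangent ξ) =
          symplecticForm ξ (X : TCotangent ξ) (Y : TCotangent ξ)) ∧
        ∀ ℓ₂ ℓε : ℝ → Submodule ℝ (TCotangent ξ),
          IsJacobiCurve (legendreDual F' inv') O ξ ℓ₂ →
          IsJacobiCurve (legendreDual Fε invε) O ξ ℓε →
          ∀ᶠ t in 𝓝 (0 : ℝ),
            ℓ₂ (reparam σ ε (legendreDual Fε invε ξ) (legendreDual F' inv' ξ) t) ≤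
              contactPlane (legendreDual F' inv') ξ ∧
            (((ℓ₂ (reparam σ ε (legendreDual Fε invε ξ) (legendreDual F' inv' ξ) t)).comap
              (contactPlane (legendreDual F' inv') ξ).subtype).map T.toLinearMap).map
                (contactPlane (legendreDual Fε invε) ξ).subtype = ℓε t := by
  have hFε : IsConicMetric Fε := by
    rcases hε with ⟨-, -, rfl⟩ | ⟨-, -, rfl⟩
    exacts [hF.isConicMetric, hF.isConicMetric.reverse]
  have hσε : IsHomothetic Fε W σ := by
    rcases hε with ⟨-, -, rfl⟩ | ⟨-, -, rfl⟩
    exacts [hσ, hσ.reverse]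
  have hεε : ε * ε = 1 := by
    rcases hε with ⟨-, rfl, -⟩ | ⟨-, rfl, -⟩ <;> norm_num
  exact ⟨exists_corresponding_inverse hF.isConicMetric hF'.isConicMetric hW htrans hε hinv' hFε,
    fun _ hinvε hc =>
      exists_contactPlane_equiv hFε hF'.isConicMetric hW hσε hεε hinv' hinvε hc hξ⟩
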